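/- Let $\alpha\in(0,1)$, let $G(x)=\varphi(\alpha)|x|^{-\alpha}$, $\varphi(\alpha)=\frac{1}{\pi 2^{2-\alpha}}\frac{\Gamma(\alpha/2)}{\Gamma((2-\alpha)/2)}$, be the Green function of $(-\Delta)^{1-\alpha/2}$ in $\mathbb R^2$, and let $K=\nabla^\perp G$ with $\nabla^\perp=(\partial_2,-\partial_1)$. Let $\Sigma(z,r)$ denote the open disk of center $z$ and radius $r$. Let $F:\mathbb R^2\times[0,\infty)\to\mathbb R^2$ be a divergence-free field with $|F(x,t)|\le A$ and $|F(x,t)-F(y,t)|\le D|x-y|$ for all $x,y\in\mathbb R^2$ and $t\ge 0$. By a solution of the modified surface quasi-geostrophic equation in the external field $F$ we mean a function $\theta(x,t)$, $t\ge0$, bounded in $L^1(\mathbb R^2)$ locally uniformly in time, which satisfies, in time-integrated form and for every $t\ge 0$, $$\frac{d}{dt}\int\theta f\,dx=\int\theta\,\big[(u+F)\cdot\nabla f+\partial_t f\big]\,dx,\qquad u(x,t)=\int K(x-y)\,\theta(y,t)\,dy,$$ for all smooth compactly supported $f(x,t)$, and whose values are only transported, in the sense that if $a\le\theta(\cdot,0)$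 (respectively $\theta(\cdot,0)\le b$) almost everywhere, for a constant $a$ (respectively $b$), then the same bound holds almost everywhere for $\theta(\cdot,t)$, for every $t\ge0$. (The latter is automatic if $\theta$ is constant along the trajectories $\dot x=u+F$ of a measure-preserving flow.) Let $M>0$ and $$\beta\in\Big(0,\frac{2-2\alpha}{4-\alpha}\Big).$$ Then there exist $\epsilon_1\in(0,1)$ and $\zeta_1>0$, depending only on $\alpha,\beta,M,A,D$, such that the following holds for every $\epsilon\in(0,\epsilon_1)$, every field $F$ as above and every $z_*\in\mathbb R^2$. Let $\theta_\epsilon$ be a solution in the external field $F$ with $$\theta_\epsilon(\cdot,0)\ge 0,\qquad \int\theta_\epsilon(x,0)\,dx=1,\qquad \theta_\epsilon(x,0)\le M\epsilon^{-2},\qquad \operatorname{supp}\theta_\epsilon(\cdot,0)\subset\Sigma(z_*,\epsilon),$$ where the inequalities hold almost everywhere and $\operatorname{supp}$ is the essential support, and let $B$ be the solution of $\dot B(t)=F(B(t),t)$, $B(0)=z_*$ (in integrated form). Then $$T^*_{\epsilon,\beta}:=\sup\big\{t>0:\ \operatorname{supp}\theta_\epsilon(\cdot,s)\subset\Sigma(B(s),\epsilon^\beta)\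 \ \forall s\in[0,t]\big\}\in[0,\infty]$$ (the supremum of the empty set being $0$) satisfies $T^*_{\epsilon,\beta}>\zeta_1|\log\epsilon|$. -/

import Mathlib

open MeasureTheory Set
open scoped ContDiff Gradient

noncomputable section

/-- The Euclidean plane. -/
abbrev Plane : Type := EuclideanSpace ℝ (Fin 2)

namespace MSQG

/-- `∇^⊥ g = (∂₂ g, -∂₁ g)`. -/
def perpGrad (g : Plane → ℝ) (x : Plane) : Plane :=
  !₂[(∇ g x) 1, -(∇ g x) 0]

/-- The Green function of `(-Δ)^(1 - α/2)` on the plane, vanishing at infinity (`0 < α < 1`):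
`G(x) = φ(α) |x|^(-α)` with `φ(α) = Γ(α/2) / (π 2^(2-α) Γ((2-α)/2))`. -/
def green (α : ℝ) (x : Plane) : ℝ :=
  1 / (Real.pi * 2 ^ (2 - α)) * (Real.Gamma (α / 2) / Real.Gamma ((2 - α) / 2)) * ‖x‖ ^ (-α)

/-- The kernel `K = ∇^⊥ G`. -/
def kernel (α : ℝ) : Plane → Plane := perpGrad (green α)

/-- The velocity `u(x) = ∫ K(x - y) ρ(y) dy` generated by the active scalar `ρ`. -/
def velocity (α : ℝ) (ρ : Plane → ℝ) (x : Plane) : Plane :=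
  ∫ y, ρ y • kernel α (x - y)

/-- The support of a scalar field that is determined up to null sets: the points all of whose
neighbourhoods meet `{ρ ≠ 0}` in positive measure (for continuous `ρ`, the closure of `{ρ ≠ 0}`). -/
def fieldSupport (ρ : Plane → ℝ) : Set Plane :=
  (volume.restrict (Function.support ρ)).support

/-- An external field on `t ≥ 0`: measurable, bounded by `A`, Lipschitz in space with constant `D`
uniformly in time, and divergence free (in the sense of distributions). -/
structure IsExternalField (A D : ℝ) (F : ℝ → Plane → Plane) : Prop where
  measurable : Measurable (Function.uncurry F)
  bounded : ∀ t, 0 ≤ t → ∀ x, ‖F t x‖ ≤ A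
  lipschitz : ∀ t, 0 ≤ t → ∀ x y, ‖F t x - F t y‖ ≤ D * ‖x - y‖
  divFree : ∀ t, 0 ≤ t → ∀ g : Plane → ℝ, ContDiff ℝ ∞ g → HasCompactSupport g →
    ∫ x, inner ℝ (F t x) (∇ g x) = 0

/-- Global weak solutions (with bounded initial datum `θ 0`) of the modified surface
quasi-geostrophic equation `∂ₜθ + (u + F)·∇θ = 0`, `u = K * θ`, driven by the field `F`.
* `integrable`, `mass_bound`: `θ` is bounded in `L¹`, locally uniformly in time.
* `weak_form`: `d/dt θ[f] = θ[(u + F)·∇f] + θ[∂ₜf]` for all test functions `f`, integrated in time,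
  at every time `t ≥ 0`.
* `upper`, `lower`: the active scalar is only transported by the incompressible motion, so that the
  bounds on its values persist.  For Lagrangian solutions, `θ (t, x(x₀, t)) = θ (0, x₀)`
  along a measure preserving flow, this is automatic; it also passes to weak limits. -/
structure IsSolution (α : ℝ) (F : ℝ → Plane → Plane) (θ : ℝ → Plane → ℝ) : Prop where
  measurable : Measurable (Function.uncurry θ)
  integrable : ∀ t, 0 ≤ t → Integrable (θ t)
  mass_bound : ∀ T, ∃ C, ∀ t ∈ Icc 0 T, ∫ x, |θ t x| ≤ C
  weak_form : ∀ f : ℝ → Plane → ℝ,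
    ContDiff ℝ ∞ (Function.uncurry f) → HasCompactSupport (Function.uncurry f) →
    ∀ t, 0 ≤ t →
      (∫ x, θ t x * f t x) - ∫ x, θ 0 x * f 0 x =
        ∫ s in (0 : ℝ)..t, ∫ x, θ s x *
          (inner ℝ (velocity α (θ s) x + F s x) (∇ (f s) x) + deriv (fun r => f r x) s)
  upper : ∀ c : ℝ, (∀ᵐ x, θ 0 x ≤ c) → ∀ t, 0 ≤ t → ∀ᵐ x, θ t x ≤ c
  lower : ∀ c : ℝ, (∀ᵐ x, c ≤ θ 0 x) → ∀ t, 0 ≤ t → ∀ᵐ x, c ≤ θ t x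

/-- `B` solves `B'(t) = F(B(t), t)` for `t ≥ 0`, `B(0) = z`.  Since `F` need only be measurable in
time, the equation is taken in integrated form. -/
structure IsTrajectory (F : ℝ → Plane → Plane) (z : Plane) (B : ℝ → Plane) : Prop where
  continuousOn : ContinuousOn B (Ici 0)
  eq_integral : ∀ t, 0 ≤ t → B t = z + ∫ s in (0 : ℝ)..t, F s (B s)

/-- `sup {t > 0 : supp θ(·, s) ⊆ Σ(B(s), r) for all s ∈ [0, t]}`, with `Σ` an open disk; it may be
infinite. -/
def localizationTime (θ : ℝ → Plane → ℝ) (B : ℝ → Plane) (r : ℝ) : EReal :=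
  sSup ((fun t : ℝ => (t : EReal)) ''
    {t : ℝ | 0 < t ∧ ∀ s ∈ Icc 0 t, fieldSupport (θ s) ⊆ Metric.ball (B s) r})

end MSQG

end

noncomputable section

namespace MSQG

/-! ### The kernel -/

/-! The measures `ν t` with density `θ t` have mass 1 and density at most `N = M ε⁻²` at all times.
Since `K` is odd and `K(x) ⟂ x`, the self-interaction changes neither the centre of mass `c` nor the
second moment about a fixed point (`mean_eq`, `totalFlux_id`). Only the Lipschitz field acts on
them, so the second moment about `B` on `[0, T]` is at most `I = (e^(DT) ε)²`
(`integral_norm_sub_sq_le`). For `T = ζ |log ε|` this loses only a small power of `ε`. It keeps `c`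
within `e^(DT) ε` of `B` and most of the mass in a small disk; what remains is to confine the rest.

The mass far from `c` is measured by a smooth step in `τ |x - c|`, `τ = e^(-λt)`. The radii thus
dilate like `e^(λt)`, and for `λ ≥ 2D` the field, relative to its mean, carries no mass outwards
(`inner_field_sub_le`). The self-induced flux through radius `r` is split at `|x - c| = r/2`. For
the core, the leading term of the radial velocity vanishes because `K(z) ⟂ z`, and the next one
because `c` is the centre of mass, up to a tail controlled by the second moment; what is left is of
order `I r^(-2-α)` after multiplication by the distance (`inner_vel_core_le`). The exterior part
acts on itself: after symmetrization the singularity drops from `|x - y|^(-1-α)` to `|x - y|^(-α)`,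
and the density bound together with Chebyshev's bound `4 I / r²` on the exterior mass closes the
estimate (`integral_inner_vel_le_of_lipschitz`, `integral_riesz_le`). Both contributions are
proportional to the mass already outside `r`, so each doubling of the radius gains a factor
`fluxRate * T` (`measureReal_outer_pow_le`).

At `r = ε^b` this factor is at most `ε^δ` for small `ζ`, provided `2 - 2α - b(4 - α) > 0`: this is
where the threshold on `β` comes from. A number `n` of doublings independent of `ε` makes the outer
mass at most `ε^(δn)`, small enough to beat the power of `N` in the sup bound for the velocity it
generates. Then nothing crosses the next radius (`ae_notMem_outer`). The dilation `e^((2D+1)T)` is a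
small negative power of `ε`, absorbed by `b - β > 0` (`exists_scales`).

The equation being weak, no trajectories are used: everything is tested on `H(τ² |x - c|²)`. Such a
function is neither compactly supported nor smooth in time, since `c` is only Lipschitz;
`radial_of_vanishing`, `exists_support` and `radial` remove these obstacles. -/

/-- Clockwise rotation by a right angle. -/
def rot (x : Plane) : Plane := !₂[x 1, -x 0]

lemma inner_eq (x y : Plane) : inner ℝ x y = x 0 * y 0 + x 1 * y 1 := by
  rw [PiLp.inner_apply, Fin.sum_univ_two]
  simp [mul_comm]

lemma rot_sub (x y : Plane) : rot (x - y) = rot x - rot y := by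
  ext i; fin_cases i
  · simp [rot]
  · simp [rot]; ring

lemma rot_neg (x : Plane) : rot (-x) = -rot x := by
  ext i; fin_cases i <;> simp [rot]

lemma rot_smul (a : ℝ) (x : Plane) : rot (a • x) = a • rot x := by
  ext i; fin_cases i <;> simp [rot]

lemma inner_self_rot (x : Plane) : inner ℝ x (rot x) = 0 := by
  rw [inner_eq]; simp [rot]; ring

lemma inner_rot_comm (x y : Plane) : inner ℝ x (rot y) = -inner ℝ (rot x) y := by
  rw [inner_eq, inner_eq]; simp [rot]

lemma norm_rot (x : Plane) : ‖rot x‖ = ‖x‖ := by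
  rw [← sq_eq_sq₀ (norm_nonneg _) (norm_nonneg _), ← real_inner_self_eq_norm_sq,
    ← real_inner_self_eq_norm_sq, inner_eq, inner_eq]
  simp [rot]; ring

lemma measurable_rot : Measurable rot := by
  have : Continuous rot := by unfold rot; fun_prop
  exact this.measurable

/-- The constant in `K(x) = k |x|^(-2-α) x^⊥`. -/
def kernelConst (α : ℝ) : ℝ :=
  -α * (1 / (Real.pi * 2 ^ (2 - α)) * (Real.Gamma (α / 2) / Real.Gamma ((2 - α) / 2)))

/-- The Green function is even, so a derivative at the origin would equal its own negative; if there
is none, the gradient is zero by convention. This makes `kernel_eq` valid at the origin too. -/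
lemma gradient_green_zero (α : ℝ) : ∇ (green α) 0 = 0 := by
  have h : fderiv ℝ (green α) 0 = 0 := by
    by_cases hd : DifferentiableAt ℝ (green α) 0
    · have h0 : HasFDerivAt (green α) (fderiv ℝ (green α) 0) (-0) := by
        simpa using hd.hasFDerivAt
      have h1 := (h0.comp (0 : Plane) (hasFDerivAt_id (𝕜 := ℝ) (0 : Plane)).neg).fderiv
      have h2 : green α ∘ Neg.neg = green α := by
        funext x; simp [green]
      rw [h2] at h1
      ext x
      have h3 := congrArg (fun L => L x) h1
      simp only [ContinuousLinearMap.comp_apply, neg_apply,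
        ContinuousLinearMap.id_apply, map_neg] at h3
      simpa using self_eq_neg.1 h3
    · exact fderiv_zero_of_not_differentiableAt hd
  rw [gradient, h, map_zero]

lemma gradient_green (α : ℝ) {x : Plane} (hx : x ≠ 0) :
    ∇ (green α) x = (kernelConst α * ‖x‖ ^ (-α - 2)) • x := by
  apply HasGradientAt.gradient
  rw [hasGradientAt_iff_hasFDerivAt]
  have hx' : 0 < ‖x‖ := norm_pos_iff.2 hx
  have h1 := ((hasStrictFDerivAt_norm_sq x).hasFDerivAt.rpow_const (p := -α / 2)
    (Or.inl (by positivity))).const_mul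
      (1 / (Real.pi * 2 ^ (2 - α)) * (Real.Gamma (α / 2) / Real.Gamma ((2 - α) / 2)))
  have h2 : green α = fun y : Plane =>
      1 / (Real.pi * 2 ^ (2 - α)) * (Real.Gamma (α / 2) / Real.Gamma ((2 - α) / 2)) *
        (‖y‖ ^ 2) ^ (-α / 2) := by
    funext y
    rw [green, ← Real.rpow_natCast, ← Real.rpow_mul (norm_nonneg _)]
    congr 2
    push_cast; ring
  rw [h2]
  refine h1.congr_fderiv ?_
  have h3 : (‖x‖ ^ 2) ^ (-α / 2 - 1) = ‖x‖ ^ (-α - 2) := by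
    rw [← Real.rpow_natCast, ← Real.rpow_mul (norm_nonneg _)]
    congr 1
    push_cast; ring
  ext y
  simp only [h3, kernelConst, map_smul, smul_apply, smul_eq_mul,
    InnerProductSpace.toDual_apply_apply, innerSL_apply_apply, nsmul_eq_mul]
  simp
  ring

lemma kernel_eq (α : ℝ) (x : Plane) :
    kernel α x = (kernelConst α * ‖x‖ ^ (-α - 2)) • rot x := by
  have h : ∀ y : Plane, !₂[y 1, -y 0] = rot y := fun _ => rfl
  rw [kernel, perpGrad, h]
  by_cases hx : x = 0
  · subst hx
    rw [gradient_green_zero]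
    ext i; fin_cases i <;> simp [rot]
  · rw [gradient_green α hx, rot_smul]

lemma kernel_neg (α : ℝ) (x : Plane) : kernel α (-x) = -kernel α x := by
  rw [kernel_eq, kernel_eq, norm_neg, rot_neg, smul_neg]

lemma inner_kernel_self (α : ℝ) (x : Plane) : inner ℝ (kernel α x) x = 0 := by
  rw [kernel_eq, real_inner_comm, inner_smul_right, inner_self_rot, mul_zero]

lemma measurable_kernel (α : ℝ) : Measurable (kernel α) := by
  rw [funext (kernel_eq α)]
  exact ((measurable_norm.pow_const _).const_mul _).smul measurable_rot

lemma norm_kernel {α : ℝ} (hα : 0 < α) (x : Plane) :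
    ‖kernel α x‖ = |kernelConst α| * ‖x‖ ^ (-(1 + α)) := by
  rw [kernel_eq, norm_smul, norm_rot, Real.norm_eq_abs, abs_mul,
    abs_of_nonneg (Real.rpow_nonneg (norm_nonneg x) _), mul_assoc]
  congr 1
  -- At the origin both sides vanish, because `0 ^ y = 0` for every real `y ≠ 0`, negative exponents
  -- included.
  rcases (norm_nonneg x).eq_or_lt with h | h
  · rw [← h, mul_zero, Real.zero_rpow (by linarith)]
  · nth_rewrite 2 [← Real.rpow_one ‖x‖]
    rw [← Real.rpow_add h]; congr 1; ring

lemma norm_mul_norm_kernel {α : ℝ} (hα : 0 < α) (x : Plane) :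
    ‖x‖ * ‖kernel α x‖ = |kernelConst α| * ‖x‖ ^ (-α) := by
  rw [norm_kernel hα]
  rcases (norm_nonneg x).eq_or_lt with h | h
  · rw [← h, zero_mul, Real.zero_rpow (by linarith), mul_zero]
  · nth_rewrite 1 [← Real.rpow_one ‖x‖]
    rw [mul_left_comm, ← Real.rpow_add h]; congr 2; ring

/-! ### Riesz potentials of measures with bounded density -/

/-- `∫_{|y| < 1} |y|^(-p) dy`. -/
def ballRiesz (p : ℝ) : ℝ := ∫ y in Metric.ball (0 : Plane) 1, ‖y‖ ^ (-p)

lemma ballRiesz_nonneg (p : ℝ) : 0 ≤ ballRiesz p :=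
  integral_nonneg fun _ => Real.rpow_nonneg (norm_nonneg _) _

lemma integrableOn_ball_norm_rpow {p : ℝ} (hp : p < 2) (r : ℝ) :
    IntegrableOn (fun y : Plane => ‖y‖ ^ (-p)) (Metric.ball 0 r) := by
  rw [integrableOn_fun_norm_addHaar volume (f := fun t : ℝ => t ^ (-p)) (r := r)]
  rcases le_or_gt r 0 with hr | hr
  · simp [hr]
  have h1 : IntegrableOn (fun t : ℝ => t ^ (1 - p)) (Ioo 0 r) := by
    rw [← intervalIntegrable_iff_integrableOn_Ioo_of_le hr.le]
    exact intervalIntegral.intervalIntegrable_rpow' (by linarith)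
  refine h1.congr_fun (fun t ht => ?_) measurableSet_Ioo
  simp only [finrank_euclideanSpace, Fintype.card_fin, smul_eq_mul]
  have : t ^ (2 - 1) = t ^ (1 : ℝ) := by simp
  rw [this, ← Real.rpow_add ht.1]; congr 1

lemma integral_ball_norm_rpow {p : ℝ} {r : ℝ} (hr : 0 < r) :
    ∫ y in Metric.ball (0 : Plane) r, ‖y‖ ^ (-p) = r ^ (2 - p) * ballRiesz p := by
  have h := Measure.setIntegral_comp_smul_of_pos volume (fun y : Plane => ‖y‖ ^ (-p))
    (Metric.ball (0 : Plane) 1) hr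
  rw [smul_unitBall_of_pos hr] at h
  simp only [finrank_euclideanSpace, Fintype.card_fin, smul_eq_mul, norm_smul, Real.norm_eq_abs,
    abs_of_pos hr] at h
  have h2 : ∀ y : Plane, (r * ‖y‖) ^ (-p) = r ^ (-p) * ‖y‖ ^ (-p) := fun y =>
    Real.mul_rpow hr.le (norm_nonneg _)
  simp only [h2, integral_const_mul] at h
  rw [eq_inv_mul_iff_mul_eq₀ (by positivity)] at h
  rw [← h, ballRiesz, ← mul_assoc, sub_eq_add_neg, Real.rpow_add hr]
  norm_num

section Riesz

variable {μ : Measure Plane} {N p : ℝ}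

lemma preimage_sub_left_ball (x : Plane) (r : ℝ) :
    (fun y => x - y) ⁻¹' Metric.ball 0 r = Metric.ball x r := by
  ext y; simp [dist_eq_norm, norm_sub_rev]

lemma integrableOn_ball_riesz (hμ : μ ≤ ENNReal.ofReal N • volume) (hp : p < 2)
    (x : Plane) (r : ℝ) :
    IntegrableOn (fun y => ‖x - y‖ ^ (-p)) (Metric.ball x r) μ := by
  have h1 : IntegrableOn (fun y : Plane => ‖x - y‖ ^ (-p)) (Metric.ball x r) volume := by
    have h := ((volume.measurePreserving_sub_left x).integrableOn_comp_preimage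
      (Homeomorph.subLeft x).measurableEmbedding (f := fun y : Plane => ‖y‖ ^ (-p))
      (s := Metric.ball 0 r)).2 (integrableOn_ball_norm_rpow hp r)
    rw [preimage_sub_left_ball] at h
    exact h
  refine Integrable.mono_measure ?_ (Measure.restrict_mono_measure hμ _)
  rw [Measure.restrict_smul]
  exact h1.smul_measure ENNReal.ofReal_ne_top

lemma setIntegral_ball_riesz_le (hμ : μ ≤ ENNReal.ofReal N • volume) (hN : 0 ≤ N) (hp : p < 2)
    (x : Plane) {r : ℝ} (hr : 0 < r) :
    ∫ y in Metric.ball x r, ‖x - y‖ ^ (-p) ∂μ ≤ N * (r ^ (2 - p) * ballRiesz p) := by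
  have h2 : ∫ y in Metric.ball x r, ‖x - y‖ ^ (-p) = r ^ (2 - p) * ballRiesz p := by
    have h := (volume.measurePreserving_sub_left x).setIntegral_preimage_emb
      (Homeomorph.subLeft x).measurableEmbedding (fun y : Plane => ‖y‖ ^ (-p)) (Metric.ball 0 r)
    rw [preimage_sub_left_ball] at h
    rw [h, integral_ball_norm_rpow hr]
  calc ∫ y in Metric.ball x r, ‖x - y‖ ^ (-p) ∂μ
      ≤ ∫ y in Metric.ball x r, ‖x - y‖ ^ (-p) ∂(ENNReal.ofReal N • volume) := by
        refine integral_mono_measure (Measure.restrict_mono_measure hμ _)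
          (ae_of_all _ fun _ => Real.rpow_nonneg (norm_nonneg _) _)
          (integrableOn_ball_riesz le_rfl hp x r)
    _ = _ := by
        rw [Measure.restrict_smul, integral_smul_measure, h2, ENNReal.toReal_ofReal hN, smul_eq_mul]

lemma measurable_riesz (x : Plane) : Measurable fun y : Plane => ‖x - y‖ ^ (-p) :=
  (measurable_const.sub measurable_id).norm.pow_const _

lemma norm_riesz_le_of_notMem_ball (hp0 : 0 ≤ p) {x y : Plane} {r : ℝ} (hr : 0 < r)
    (hy : y ∈ (Metric.ball x r)ᶜ) : ‖x - y‖ ^ (-p) ≤ r ^ (-p) := by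
  refine Real.rpow_le_rpow_of_nonpos hr ?_ (by linarith)
  simpa [dist_eq_norm, norm_sub_rev] using hy

variable [IsFiniteMeasure μ]

lemma integrable_riesz (hμ : μ ≤ ENNReal.ofReal N • volume) (hp0 : 0 ≤ p) (hp : p < 2)
    (x : Plane) : Integrable (fun y => ‖x - y‖ ^ (-p)) μ := by
  rw [← integrableOn_univ, ← union_compl_self (Metric.ball x 1)]
  refine (integrableOn_ball_riesz hμ hp x 1).union ?_
  refine Measure.integrableOn_of_bounded (M := 1) (measure_ne_top _ _)
    (measurable_riesz x).aestronglyMeasurable ?_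
  filter_upwards [ae_restrict_mem Metric.isOpen_ball.measurableSet.compl] with y hy
  rw [Real.norm_of_nonneg (Real.rpow_nonneg (norm_nonneg _) _)]
  simpa using norm_riesz_le_of_notMem_ball hp0 one_pos hy

lemma integral_riesz_le_add (hμ : μ ≤ ENNReal.ofReal N • volume) (hN : 0 ≤ N) (hp0 : 0 ≤ p)
    (hp : p < 2) {m : ℝ} (hm : μ.real univ ≤ m) (x : Plane) {r : ℝ} (hr : 0 < r) :
    ∫ y, ‖x - y‖ ^ (-p) ∂μ ≤ N * (r ^ (2 - p) * ballRiesz p) + r ^ (-p) * m := by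
  rw [← integral_add_compl Metric.isOpen_ball.measurableSet (integrable_riesz hμ hp0 hp x)
    (s := Metric.ball x r)]
  refine add_le_add (setIntegral_ball_riesz_le hμ hN hp x hr) ?_
  calc ∫ y in (Metric.ball x r)ᶜ, ‖x - y‖ ^ (-p) ∂μ
      ≤ ∫ y in (Metric.ball x r)ᶜ, r ^ (-p) ∂μ := by
        refine setIntegral_mono_on (integrable_riesz hμ hp0 hp x).integrableOn
          (integrable_const _) Metric.isOpen_ball.measurableSet.compl fun y hy =>
            norm_riesz_le_of_notMem_ball hp0 hr hy
    _ = μ.real (Metric.ball x r)ᶜ * r ^ (-p) := by simp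
    _ ≤ m * r ^ (-p) := by
        refine mul_le_mul_of_nonneg_right (le_trans (measureReal_mono (subset_univ _)) hm)
          (by positivity)
    _ = _ := mul_comm _ _

/-- The radius `r = (m / N)^(1/2)` balances the near part, bounded through the density, against the
far part, bounded through the mass. -/
lemma integral_riesz_le (hμ : μ ≤ ENNReal.ofReal N • volume) (hN : 0 < N) (hp0 : 0 ≤ p)
    (hp : p < 2) {m : ℝ} (hm0 : 0 < m) (hm : μ.real univ ≤ m) (x : Plane) :
    ∫ y, ‖x - y‖ ^ (-p) ∂μ ≤ (ballRiesz p + 1) * (N ^ (p / 2) * m ^ (1 - p / 2)) := by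
  have h := integral_riesz_le_add hμ hN.le hp0 hp hm x (r := (m / N) ^ (1 / 2 : ℝ)) (by positivity)
  refine h.trans (le_of_eq ?_)
  rw [← Real.rpow_mul (by positivity), ← Real.rpow_mul (by positivity),
    Real.div_rpow hm0.le hN.le, Real.div_rpow hm0.le hN.le]
  have e1 : N ^ (1 / 2 * (2 - p)) = N * (N ^ (p / 2))⁻¹ := by
    rw [← Real.rpow_neg hN.le]
    nth_rewrite 2 [← Real.rpow_one N]
    rw [← Real.rpow_add hN]; congr 1; ring
  have e2 : N ^ (1 / 2 * -p) = (N ^ (p / 2))⁻¹ := by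
    rw [← Real.rpow_neg hN.le]; congr 1; ring
  have e3 : m ^ (1 / 2 * -p) = m ^ (1 - p / 2) * m⁻¹ := by
    rw [← Real.rpow_neg_one m, ← Real.rpow_add hm0]; congr 1; ring
  have e4 : m ^ (1 / 2 * (2 - p)) = m ^ (1 - p / 2) := by congr 1; ring
  rw [e1, e2, e3, e4]
  have : 0 < N ^ (p / 2) := by positivity
  field_simp

end Riesz

/-! ### The velocity generated by a measure -/

/-- The velocity `∫ K(x - y) dμ(y)`. -/
def vel (α : ℝ) (μ : Measure Plane) (x : Plane) : Plane := ∫ y, kernel α (x - y) ∂μ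

section Velocity

variable {μ : Measure Plane} [IsFiniteMeasure μ] {α N p : ℝ}

lemma integrable_prod_riesz (hμ : μ ≤ ENNReal.ofReal N • volume) (hN : 0 ≤ N) (hp0 : 0 ≤ p)
    (hp : p < 2) : Integrable (fun q : Plane × Plane => ‖q.1 - q.2‖ ^ (-p)) (μ.prod μ) := by
  have hm : Measurable (fun q : Plane × Plane => ‖q.1 - q.2‖ ^ (-p)) :=
    (measurable_fst.sub measurable_snd).norm.pow_const _
  refine (integrable_prod_iff hm.aestronglyMeasurable).2
    ⟨ae_of_all _ fun x => integrable_riesz hμ hp0 hp x, ?_⟩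
  refine Integrable.of_bound (C := N * (1 ^ (2 - p) * ballRiesz p) + 1 ^ (-p) * μ.real univ)
    hm.aestronglyMeasurable.norm.integral_prod_right' (ae_of_all _ fun x => ?_)
  have h0 : ∀ y : Plane, ‖‖x - y‖ ^ (-p)‖ = ‖x - y‖ ^ (-p) := fun y =>
    Real.norm_of_nonneg (Real.rpow_nonneg (norm_nonneg _) _)
  simp only [h0]
  rw [Real.norm_of_nonneg (integral_nonneg fun y => Real.rpow_nonneg (norm_nonneg _) _)]
  exact integral_riesz_le_add hμ hN hp0 hp le_rfl x one_pos

lemma integrable_kernel (hα : α ∈ Ioo (0 : ℝ) 1) (hμ : μ ≤ ENNReal.ofReal N • volume) (x : Plane) :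
    Integrable (fun y => kernel α (x - y)) μ := by
  refine Integrable.mono' ((integrable_riesz hμ (p := 1 + α) (by linarith [hα.1])
    (by linarith [hα.2]) x).const_mul |kernelConst α|)
    ((measurable_kernel α).comp (measurable_const.sub measurable_id)).aestronglyMeasurable
    (ae_of_all _ fun y => (norm_kernel hα.1 _).le)

lemma norm_vel_le_integral {μ : Measure Plane} (hα : α ∈ Ioo (0 : ℝ) 1) (x : Plane) :
    ‖vel α μ x‖ ≤ |kernelConst α| * ∫ y, ‖x - y‖ ^ (-(1 + α)) ∂μ := by
  rw [← integral_const_mul]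
  refine (norm_integral_le_integral_norm _).trans (le_of_eq ?_)
  simp only [norm_kernel hα.1]

lemma norm_vel_le (hα : α ∈ Ioo (0 : ℝ) 1) (hμ : μ ≤ ENNReal.ofReal N • volume) (hN : 0 < N)
    {m : ℝ} (hm0 : 0 < m) (hm : μ.real univ ≤ m) (x : Plane) :
    ‖vel α μ x‖ ≤ |kernelConst α| *
      ((ballRiesz (1 + α) + 1) * (N ^ ((1 + α) / 2) * m ^ (1 - (1 + α) / 2))) :=
  (norm_vel_le_integral hα x).trans (mul_le_mul_of_nonneg_left
    (integral_riesz_le hμ hN (by linarith [hα.1]) (by linarith [hα.2]) hm0 hm x) (abs_nonneg _))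

lemma stronglyMeasurable_vel (α : ℝ) (μ : Measure Plane) [SFinite μ] :
    StronglyMeasurable (vel α μ) := by
  refine StronglyMeasurable.integral_prod_right (f := fun x y => kernel α (x - y)) ?_
  exact ((measurable_kernel α).comp (measurable_fst.sub measurable_snd)).stronglyMeasurable

lemma integrable_prod_inner_kernel (hα : α ∈ Ioo (0 : ℝ) 1)
    (hμ : μ ≤ ENNReal.ofReal N • volume) (hN : 0 ≤ N)
    {a : Plane → Plane} (ha : Measurable a) {C : ℝ} (hC : ∀ᵐ x ∂μ, ‖a x‖ ≤ C) :
    Integrable (fun q : Plane × Plane => inner ℝ (kernel α (q.1 - q.2)) (a q.1)) (μ.prod μ) := by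
  refine Integrable.mono' ((integrable_prod_riesz hμ hN (p := 1 + α) (by linarith [hα.1])
    (by linarith [hα.2])).const_mul (|kernelConst α| * C)) ?_ ?_
  · exact (((measurable_kernel α).comp (measurable_fst.sub measurable_snd)).inner
      (ha.comp measurable_fst)).aestronglyMeasurable
  · have h := (Measure.quasiMeasurePreserving_fst (μ := μ) (ν := μ)).ae hC
    filter_upwards [h] with q hq
    refine (norm_inner_le_norm _ _).trans ?_
    rw [norm_kernel hα.1, mul_right_comm]
    refine mul_le_mul_of_nonneg_right (mul_le_mul_of_nonneg_left hq (abs_nonneg _))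
      (Real.rpow_nonneg (norm_nonneg _) _)

/-- Since `K` is odd, `∫ ⟨u, a⟩ dμ` only sees the increments of `a`. -/
lemma integral_inner_vel_eq (hα : α ∈ Ioo (0 : ℝ) 1)
    (hμ : μ ≤ ENNReal.ofReal N • volume) (hN : 0 ≤ N)
    {a : Plane → Plane} (ha : Measurable a) {C : ℝ} (hC : ∀ᵐ x ∂μ, ‖a x‖ ≤ C) :
    ∫ x, inner ℝ (vel α μ x) (a x) ∂μ =
      (1 / 2) * ∫ q, inner ℝ (kernel α (q.1 - q.2)) (a q.1 - a q.2) ∂(μ.prod μ) := by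
  have hi := integrable_prod_inner_kernel hα hμ hN ha hC
  have h1 : ∫ x, inner ℝ (vel α μ x) (a x) ∂μ =
      ∫ q, inner ℝ (kernel α (q.1 - q.2)) (a q.1) ∂(μ.prod μ) := by
    rw [integral_prod _ hi]
    refine integral_congr_ae (ae_of_all _ fun x => ?_)
    simp only [vel]
    rw [real_inner_comm, ← integral_inner (integrable_kernel hα hμ x)]
    simp only [real_inner_comm]
  have h2 : ∫ q, inner ℝ (kernel α (q.1 - q.2)) (a q.2) ∂(μ.prod μ) =
      -∫ q, inner ℝ (kernel α (q.1 - q.2)) (a q.1) ∂(μ.prod μ) := by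
    rw [← integral_prod_swap, ← integral_neg]
    refine integral_congr_ae (ae_of_all _ fun q => ?_)
    simp only [Prod.fst_swap, Prod.snd_swap]
    rw [← neg_sub, kernel_neg, inner_neg_left]
  have hi2 : Integrable (fun q : Plane × Plane => inner ℝ (kernel α (q.1 - q.2)) (a q.2))
      (μ.prod μ) := by
    refine hi.swap.neg.congr (ae_of_all _ fun q => ?_)
    simp only [Pi.neg_apply, Function.comp_apply, Prod.fst_swap, Prod.snd_swap]
    rw [← neg_sub, kernel_neg, inner_neg_left, neg_neg]
  simp only [inner_sub_right]
  rw [integral_sub hi hi2, h1, h2]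
  ring

/-- The increment of `x - c` between two points is `x - y`, which is orthogonal to `K(x - y)`. Hence
the self-interaction leaves second moments alone. -/
lemma integral_inner_vel_sub_center (hα : α ∈ Ioo (0 : ℝ) 1)
    (hμ : μ ≤ ENNReal.ofReal N • volume) (hN : 0 ≤ N) (c : Plane) {C : ℝ}
    (hC : ∀ᵐ x ∂μ, ‖x - c‖ ≤ C) : ∫ x, inner ℝ (vel α μ x) (x - c) ∂μ = 0 := by
  rw [integral_inner_vel_eq hα hμ hN (a := fun x => x - c) (by fun_prop) hC]
  simp [inner_kernel_self]

/-- A Lipschitz field vanishing off `P` has interaction energy controlled by the mass of `P`. -/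
lemma integral_inner_vel_le_of_lipschitz (hα : α ∈ Ioo (0 : ℝ) 1)
    (hμ : μ ≤ ENNReal.ofReal N • volume) (hN : 0 ≤ N)
    {a : Plane → Plane} (ha : Measurable a) {C L J : ℝ} (hC : ∀ᵐ x ∂μ, ‖a x‖ ≤ C) (hL0 : 0 ≤ L)
    (hL : ∀ x y, ‖a x - a y‖ ≤ L * ‖x - y‖) {P : Set Plane} (hP : MeasurableSet P)
    (haP : ∀ x, x ∉ P → a x = 0) (hJ : ∀ x, ∫ y, ‖x - y‖ ^ (-α) ∂μ ≤ J) :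
    ∫ x, inner ℝ (vel α μ x) (a x) ∂μ ≤ L * |kernelConst α| * J * μ.real P := by
  rw [integral_inner_vel_eq hα hμ hN ha hC]
  have hr := integrable_prod_riesz hμ hN hα.1.le (by linarith [hα.2] : α < 2)
  set G : Plane × Plane → ℝ := fun q => ‖q.1 - q.2‖ ^ (-α) with hG
  set g1 : Plane × Plane → ℝ := (P ×ˢ univ).indicator G with hg1
  have hi1 : Integrable g1 (μ.prod μ) := hr.indicator (hP.prod MeasurableSet.univ)
  have hi2 : Integrable (g1 ∘ Prod.swap) (μ.prod μ) := hi1.swap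
  have hG0 : ∀ q, 0 ≤ G q := fun q => Real.rpow_nonneg (norm_nonneg _) _
  have hg10 : ∀ q, 0 ≤ g1 q := fun q => indicator_nonneg (fun q _ => hG0 q) q
  -- The increment of `a` vanishes unless one of the two points lies in `P`. The Lipschitz bound
  -- cancels one power of the singularity of the kernel.
  have hpt : ∀ q : Plane × Plane, inner ℝ (kernel α (q.1 - q.2)) (a q.1 - a q.2) ≤
      L * |kernelConst α| * (g1 q + g1 q.swap) := by
    intro q
    have hk : inner ℝ (kernel α (q.1 - q.2)) (a q.1 - a q.2) ≤ L * |kernelConst α| * G q := by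
      refine (real_inner_le_norm _ _).trans ?_
      calc ‖kernel α (q.1 - q.2)‖ * ‖a q.1 - a q.2‖
          ≤ ‖kernel α (q.1 - q.2)‖ * (L * ‖q.1 - q.2‖) :=
            mul_le_mul_of_nonneg_left (hL _ _) (norm_nonneg _)
        _ = L * (‖q.1 - q.2‖ * ‖kernel α (q.1 - q.2)‖) := by ring
        _ = _ := by rw [norm_mul_norm_kernel hα.1, ← mul_assoc]
    have hc : 0 ≤ L * |kernelConst α| := by positivity
    by_cases h1 : q.1 ∈ P
    · refine hk.trans (mul_le_mul_of_nonneg_left ?_ hc)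
      have : g1 q = G q := indicator_of_mem (by simpa using h1) _
      linarith [hg10 q.swap]
    · by_cases h2 : q.2 ∈ P
      · refine hk.trans (mul_le_mul_of_nonneg_left ?_ hc)
        have : g1 q.swap = G q.swap := indicator_of_mem (by simpa using h2) _
        have h3 : G q.swap = G q := by simp only [hG, Prod.fst_swap, Prod.snd_swap, norm_sub_rev]
        linarith [hg10 q]
      · rw [haP _ h1, haP _ h2, sub_zero, inner_zero_right]
        exact mul_nonneg hc (add_nonneg (hg10 _) (hg10 _))
  have hsw : ∫ q, g1 q.swap ∂(μ.prod μ) = ∫ q, g1 q ∂(μ.prod μ) := integral_prod_swap g1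
  have hle : ∫ q, inner ℝ (kernel α (q.1 - q.2)) (a q.1 - a q.2) ∂(μ.prod μ) ≤
      L * |kernelConst α| * (2 * ∫ q, g1 q ∂(μ.prod μ)) := by
    have hR : Integrable (fun q => L * |kernelConst α| * (g1 q + g1 q.swap)) (μ.prod μ) :=
      (hi1.add hi2).const_mul _
    -- Without integrability the integral is zero by convention and the bound is trivial.
    by_cases hinner : Integrable
        (fun q : Plane × Plane => inner ℝ (kernel α (q.1 - q.2)) (a q.1 - a q.2)) (μ.prod μ)
    · refine (integral_mono hinner hR hpt).trans (le_of_eq ?_)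
      have he : ∫ q, (g1 q + g1 q.swap) ∂(μ.prod μ) = _ := integral_add hi1 hi2
      rw [integral_const_mul, he]
      change L * |kernelConst α| * (_ + ∫ q, g1 q.swap ∂(μ.prod μ)) = _
      rw [hsw]; ring
    · rw [integral_undef hinner]
      have := integral_nonneg (μ := μ.prod μ) (f := g1) hg10
      positivity
  have hg1le : ∫ q, g1 q ∂(μ.prod μ) ≤ J * μ.real P := by
    rw [integral_prod _ hi1]
    have h1 : ∀ x, ∫ y, g1 (x, y) ∂μ = P.indicator (fun x => ∫ y, G (x, y) ∂μ) x := by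
      intro x
      by_cases hx : x ∈ P <;> simp [hg1, hx, indicator]
    simp only [h1]
    rw [integral_indicator hP]
    calc ∫ x in P, ∫ y, G (x, y) ∂μ ∂μ ≤ ∫ _ in P, J ∂μ := by
          refine integral_mono hr.integral_prod_left.integrableOn (integrable_const _) fun x => hJ x
      _ = _ := by simp [mul_comm]
  have hc : 0 ≤ L * |kernelConst α| := by positivity
  calc (1 / 2) * ∫ q, inner ℝ (kernel α (q.1 - q.2)) (a q.1 - a q.2) ∂(μ.prod μ)
      ≤ (1 / 2) * (L * |kernelConst α| * (2 * ∫ q, g1 q ∂(μ.prod μ))) := by gcongr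
    _ = L * |kernelConst α| * ∫ q, g1 q ∂(μ.prod μ) := by ring
    _ ≤ L * |kernelConst α| * (J * μ.real P) := mul_le_mul_of_nonneg_left hg1le hc
    _ = _ := by ring

end Velocity

/-! ### The far field of the core -/

/-- Mean value inequality for `t ↦ t^(-p)` on `[‖z‖/2, ∞)`, which contains both norms. -/
lemma abs_rpow_neg_sub_le {p : ℝ} (hp : 0 < p) {z w : Plane} (hz : z ≠ 0)
    (hw : ‖w‖ ≤ ‖z‖ / 2) :
    |‖z - w‖ ^ (-p) - ‖z‖ ^ (-p)| ≤ p * 2 ^ (p + 1) * ‖z‖ ^ (-p - 1) * ‖w‖ := by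
  have hz' : 0 < ‖z‖ := norm_pos_iff.2 hz
  have hzw : ‖z‖ / 2 ≤ ‖z - w‖ := by
    have := norm_sub_norm_le z w; linarith
  have hd : ∀ t ∈ Ici (‖z‖ / 2), HasDerivWithinAt (fun t : ℝ => t ^ (-p)) (-p * t ^ (-p - 1))
      (Ici (‖z‖ / 2)) t := fun t ht =>
    (Real.hasDerivAt_rpow_const (Or.inl (by
      have : 0 < t := lt_of_lt_of_le (by positivity) (mem_Ici.1 ht)
      exact this.ne'))).hasDerivWithinAt
  have hb : ∀ t ∈ Ici (‖z‖ / 2), ‖-p * t ^ (-p - 1)‖ ≤ p * 2 ^ (p + 1) * ‖z‖ ^ (-p - 1) := by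
    intro t ht
    have ht0 : 0 < t := lt_of_lt_of_le (by positivity) (mem_Ici.1 ht)
    rw [norm_mul, norm_neg, Real.norm_of_nonneg hp.le,
      Real.norm_of_nonneg (Real.rpow_nonneg ht0.le _), mul_assoc]
    refine mul_le_mul_of_nonneg_left ?_ hp.le
    refine (Real.rpow_le_rpow_of_nonpos (by positivity) (mem_Ici.1 ht) (by linarith)).trans
      (le_of_eq ?_)
    rw [Real.div_rpow hz'.le two_pos.le, div_eq_mul_inv, ← Real.rpow_neg two_pos.le, mul_comm]
    congr 2; ring
  have h := (convex_Ici (‖z‖ / 2)).norm_image_sub_le_of_norm_hasDerivWithin_le hd hb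
    (x := ‖z‖) (y := ‖z - w‖) (by simp only [mem_Ici]; linarith) hzw
  rw [Real.norm_eq_abs] at h
  refine h.trans (mul_le_mul_of_nonneg_left ?_ (by positivity))
  have := abs_norm_sub_norm_le (z - w) z
  simpa using this

/-- Constant in the far field estimate. -/
def coreConst (α : ℝ) : ℝ := |kernelConst α| * (1 + (2 + α) * 2 ^ (2 + α + 1))

lemma coreConst_nonneg {α : ℝ} (hα : 0 < α) : 0 ≤ coreConst α := by
  unfold coreConst; positivity

/-- Since `rot z ⟂ z`, the part of `rot (z - w)` coming from `z` drops out. The radial velocity is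
therefore already of first order in the displacement `w`. -/
lemma inner_kernel_sub (α : ℝ) (z w : Plane) :
    inner ℝ (kernel α (z - w)) z =
      kernelConst α * ‖z - w‖ ^ (-(2 + α)) * inner ℝ (rot z) w := by
  rw [kernel_eq, real_inner_comm, inner_smul_right, rot_sub, inner_sub_right, inner_self_rot,
    inner_rot_comm, show -α - 2 = -(2 + α) by ring]
  ring

/-- The radial velocity which a core with centre of mass `c` generates far away is of second order
in the size of the core. -/
lemma inner_vel_core_le {α N : ℝ} (hα : α ∈ Ioo (0 : ℝ) 1) {μ : Measure Plane}
    [IsProbabilityMeasure μ] (hμ : μ ≤ ENNReal.ofReal N • volume) {c : Plane}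
    (hi : Integrable (fun y => ‖y - c‖ ^ 2) μ)
    (hc : ∫ y, (y - c) ∂μ = 0) {r : ℝ} (hr : 0 < r) {x : Plane} (hx : 2 * r ≤ ‖x - c‖) :
    inner ℝ (vel α (μ.restrict (Metric.ball c r)) x) (x - c) ≤
      coreConst α * (∫ y, ‖y - c‖ ^ 2 ∂μ) * r ^ (-(2 + α)) := by
  set S := Metric.ball c r with hS
  have hSm : MeasurableSet S := Metric.isOpen_ball.measurableSet
  set z := x - c with hz
  set I := ∫ y, ‖y - c‖ ^ 2 ∂μ with hI
  have hz0 : 0 < ‖z‖ := by linarith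
  set p := 2 + α with hp
  have hp0 : 0 < p := by linarith [hα.1]
  have hI0 : 0 ≤ I := integral_nonneg fun _ => by positivity
  have hIS : ∫ y in S, ‖y - c‖ ^ 2 ∂μ ≤ I :=
    setIntegral_le_integral hi (ae_of_all _ fun y => sq_nonneg ‖y - c‖)
  have hi1 : Integrable (fun y => y - c) μ := by
    refine Integrable.mono' (hi.add (integrable_const 1)) (by fun_prop) (ae_of_all _ fun y => ?_)
    simp only [Pi.add_apply]
    nlinarith [sq_nonneg (‖y - c‖ - 1)]
  have hK : Integrable (fun y => kernel α (x - y)) (μ.restrict S) :=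
    integrable_kernel hα (Measure.restrict_le_self.trans hμ) x
  have e1 : inner ℝ (vel α (μ.restrict S) x) z =
      ∫ y in S, kernelConst α * ‖z - (y - c)‖ ^ (-p) * inner ℝ (rot z) (y - c) ∂μ := by
    rw [vel, real_inner_comm, ← integral_inner hK]
    refine integral_congr_ae (ae_of_all _ fun y => ?_)
    simp only
    rw [real_inner_comm, ← inner_kernel_sub]
    congr 2
    rw [hz]; abel
  set M0 := ∫ y in S, (y - c) ∂μ with hM0
  -- The full first moment about `c` vanishes, so that of the core is minus that of the tail, and
  -- `‖y - c‖ ≤ ‖y - c‖² / r` on the tail.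
  have hM : ‖M0‖ ≤ I / r := by
    have h1 : M0 = -∫ y in Sᶜ, (y - c) ∂μ := by
      have := integral_add_compl hSm hi1
      rw [hc] at this
      exact eq_neg_of_add_eq_zero_left this
    rw [h1, norm_neg, le_div_iff₀ hr]
    refine (mul_le_mul_of_nonneg_right (norm_integral_le_integral_norm _) hr.le).trans ?_
    rw [← integral_mul_const]
    calc ∫ y in Sᶜ, ‖y - c‖ * r ∂μ ≤ ∫ y in Sᶜ, ‖y - c‖ ^ 2 ∂μ := by
          refine setIntegral_mono_on (hi1.norm.mul_const _).integrableOn hi.integrableOn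
            hSm.compl fun y hy => ?_
          have : r ≤ ‖y - c‖ := by simpa [hS, dist_eq_norm] using hy
          nlinarith [norm_nonneg (y - c)]
      _ ≤ I := setIntegral_le_integral hi (ae_of_all _ fun _ => by positivity)
  have hin : Integrable (fun y => kernelConst α * ‖z‖ ^ (-p) * inner ℝ (rot z) (y - c))
      (μ.restrict S) :=
    ((hi1.integrableOn (s := S)).const_inner (rot z)).const_mul _
  have hR : Integrable (fun y => |kernelConst α| * (p * 2 ^ (p + 1)) * ‖z‖ ^ (-p) * ‖y - c‖ ^ 2)
      (μ.restrict S) := hi.integrableOn.const_mul _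
  -- Freezing `‖z - w‖^(-p)` at `w = 0` costs a factor `‖w‖ / ‖z‖`, so the error is quadratic in `w
  -- = y - c`; the frozen term sees only the first moment.
  have hpt : ∀ y ∈ S, kernelConst α * ‖z - (y - c)‖ ^ (-p) * inner ℝ (rot z) (y - c) ≤
      kernelConst α * ‖z‖ ^ (-p) * inner ℝ (rot z) (y - c) +
        |kernelConst α| * (p * 2 ^ (p + 1)) * ‖z‖ ^ (-p) * ‖y - c‖ ^ 2 := by
    intro y hy
    have hy' : ‖y - c‖ < r := by simpa [hS, dist_eq_norm] using hy
    have h1 := abs_rpow_neg_sub_le hp0 (norm_pos_iff.1 hz0) (w := y - c) (by linarith)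
    have h2 : |inner ℝ (rot z) (y - c)| ≤ ‖z‖ * ‖y - c‖ := by
      rw [← norm_rot z]; exact abs_real_inner_le_norm _ _
    have h3 : kernelConst α * (‖z - (y - c)‖ ^ (-p) - ‖z‖ ^ (-p)) * inner ℝ (rot z) (y - c) ≤
        |kernelConst α| * (p * 2 ^ (p + 1) * ‖z‖ ^ (-p - 1) * ‖y - c‖) * (‖z‖ * ‖y - c‖) := by
      refine (le_abs_self _).trans ?_
      rw [abs_mul, abs_mul]
      gcongr
    have h4 : ‖z‖ ^ (-p - 1) * ‖z‖ = ‖z‖ ^ (-p) := by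
      nth_rewrite 2 [← Real.rpow_one ‖z‖]
      rw [← Real.rpow_add hz0]; congr 1; ring
    have h5 : |kernelConst α| * (p * 2 ^ (p + 1) * ‖z‖ ^ (-p - 1) * ‖y - c‖) * (‖z‖ * ‖y - c‖) =
        |kernelConst α| * (p * 2 ^ (p + 1)) * ‖z‖ ^ (-p) * ‖y - c‖ ^ 2 := by
      rw [← h4]; ring
    linarith
  have hzp : ‖z‖ ^ (-p) ≤ r ^ (-p) :=
    Real.rpow_le_rpow_of_nonpos hr (by linarith) (by linarith)
  have hzp1 : ‖z‖ ^ (-p) * ‖z‖ ≤ r ^ (-p) * r := by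
    have h4 : ∀ t : ℝ, 0 < t → t ^ (-p) * t = t ^ (-p + 1) := fun t ht => by
      rw [Real.rpow_add ht, Real.rpow_one]
    rw [h4 _ hz0, h4 _ hr]
    exact Real.rpow_le_rpow_of_nonpos hr (by linarith) (by linarith [hα.1])
  have hmain : inner ℝ (vel α (μ.restrict S) x) z ≤
      kernelConst α * ‖z‖ ^ (-p) * inner ℝ (rot z) M0 +
        |kernelConst α| * (p * 2 ^ (p + 1)) * ‖z‖ ^ (-p) * ∫ y in S, ‖y - c‖ ^ 2 ∂μ := by
    rw [e1, hM0, ← integral_inner hi1.integrableOn, ← integral_const_mul, ← integral_const_mul,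
      ← integral_add hin hR]
    refine setIntegral_mono_on ?_ (hin.add hR) hSm hpt
    have h := hK.const_inner (𝕜 := ℝ) z
    refine h.congr (ae_of_all _ fun y => ?_)
    simp only
    rw [real_inner_comm, ← inner_kernel_sub]
    congr 2
    rw [hz]; abel
  have hA : kernelConst α * ‖z‖ ^ (-p) * inner ℝ (rot z) M0 ≤ |kernelConst α| * r ^ (-p) * I := by
    refine (le_abs_self _).trans ?_
    rw [abs_mul, abs_mul, abs_of_nonneg (Real.rpow_nonneg hz0.le _), mul_assoc, mul_assoc]
    refine mul_le_mul_of_nonneg_left ?_ (abs_nonneg _)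
    have h2 : |inner ℝ (rot z) M0| ≤ ‖z‖ * (I / r) := by
      rw [← norm_rot z]
      exact (abs_real_inner_le_norm _ _).trans (mul_le_mul_of_nonneg_left hM (norm_nonneg _))
    calc ‖z‖ ^ (-p) * |inner ℝ (rot z) M0| ≤ ‖z‖ ^ (-p) * (‖z‖ * (I / r)) :=
          mul_le_mul_of_nonneg_left h2 (Real.rpow_nonneg hz0.le _)
      _ = (‖z‖ ^ (-p) * ‖z‖) * (I / r) := by ring
      _ ≤ (r ^ (-p) * r) * (I / r) := mul_le_mul_of_nonneg_right hzp1 (div_nonneg hI0 hr.le)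
      _ = r ^ (-p) * (r * (I / r)) := mul_assoc _ _ _
      _ = r ^ (-p) * I := by rw [mul_div_cancel₀ I hr.ne']
  have hB : |kernelConst α| * (p * 2 ^ (p + 1)) * ‖z‖ ^ (-p) * ∫ y in S, ‖y - c‖ ^ 2 ∂μ ≤
      |kernelConst α| * (p * 2 ^ (p + 1)) * r ^ (-p) * I := by
    refine mul_le_mul (mul_le_mul_of_nonneg_left hzp (by positivity)) hIS ?_ (by positivity)
    exact integral_nonneg fun y => sq_nonneg _
  refine hmain.trans ((add_le_add hA hB).trans (le_of_eq ?_))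
  rw [coreConst]; ring

/-! ### Smooth steps -/

/-- A smooth step: `0` for `s ≤ r²`, `1` for `s ≥ 2r²`. -/
def step (r s : ℝ) : ℝ := Real.smoothTransition (s / r ^ 2 - 1)

lemma contDiff_step (r : ℝ) : ContDiff ℝ ∞ (step r) :=
  (Real.smoothTransition.contDiff (n := ⊤)).comp ((contDiff_id.div_const _).sub contDiff_const)

lemma step_nonneg (r s : ℝ) : 0 ≤ step r s := Real.smoothTransition.nonneg _

lemma step_le_one (r s : ℝ) : step r s ≤ 1 := Real.smoothTransition.le_one _

lemma step_eq_zero {r s : ℝ} (hr : 0 < r) (h : s ≤ r ^ 2) : step r s = 0 := by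
  refine Real.smoothTransition.zero_of_nonpos ?_
  rw [sub_nonpos, div_le_one (by positivity)]; exact h

lemma step_pos {r s : ℝ} (hr : 0 < r) (h : r ^ 2 < s) : 0 < step r s := by
  refine Real.smoothTransition.pos_of_pos ?_
  rw [sub_pos, lt_div_iff₀ (by positivity)]; linarith

lemma step_eq_one {r s : ℝ} (hr : 0 < r) (h : 2 * r ^ 2 ≤ s) : step r s = 1 := by
  refine Real.smoothTransition.one_of_one_le ?_
  have : 2 ≤ s / r ^ 2 := by rw [le_div_iff₀ (by positivity)]; exact h
  linarith

lemma monotone_step {r : ℝ} (hr : 0 < r) : Monotone (step r) := fun a b h =>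
  Real.smoothTransition.monotone (by gcongr)

lemma deriv_step_nonneg {r : ℝ} (hr : 0 < r) (s : ℝ) : 0 ≤ deriv (step r) s :=
  (monotone_step hr).deriv_nonneg

lemma deriv_step (r s : ℝ) :
    deriv (step r) s = deriv Real.smoothTransition (s / r ^ 2 - 1) / r ^ 2 := by
  have h1 : HasDerivAt Real.smoothTransition (deriv Real.smoothTransition (s / r ^ 2 - 1))
      (s / r ^ 2 - 1) :=
    ((Real.smoothTransition.contDiff (n := 1)).differentiable one_ne_zero _).hasDerivAt
  have h2 : HasDerivAt (fun s : ℝ => s / r ^ 2 - 1) (1 / r ^ 2) s :=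
    ((hasDerivAt_id s).div_const _).sub_const _
  have h := (h1.comp s h2).deriv
  rw [mul_one_div] at h
  exact h

lemma deriv_step_eq_zero {r s : ℝ} (hr : 0 < r) (h : s < r ^ 2) : deriv (step r) s = 0 := by
  have : step r =ᶠ[nhds s] fun _ => 0 := by
    filter_upwards [Iio_mem_nhds h] with t ht
    exact step_eq_zero hr (le_of_lt ht)
  rw [this.deriv_eq, deriv_const]

lemma continuous_deriv_step (r : ℝ) : Continuous (deriv (step r)) :=
  (contDiff_step r).continuous_deriv (by simp)

lemma deriv_smoothTransition_eq_zero {s : ℝ} (h : s < 0 ∨ 1 < s) :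
    deriv Real.smoothTransition s = 0 := by
  rcases h with h | h
  · have : Real.smoothTransition =ᶠ[nhds s] fun _ => 0 := by
      filter_upwards [Iio_mem_nhds h] with t ht
      exact Real.smoothTransition.zero_of_nonpos (le_of_lt ht)
    rw [this.deriv_eq, deriv_const]
  · have : Real.smoothTransition =ᶠ[nhds s] fun _ => 1 := by
      filter_upwards [Ioi_mem_nhds h] with t ht
      exact Real.smoothTransition.one_of_one_le (le_of_lt ht)
    rw [this.deriv_eq, deriv_const]

lemma contDiff_deriv_smoothTransition : ContDiff ℝ 1 (deriv Real.smoothTransition) := by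
  have h : ContDiff ℝ (1 + 1) Real.smoothTransition :=
    Real.smoothTransition.contDiff (n := 2)
  exact (contDiff_succ_iff_deriv.1 h).2.2

/-- The derivative of the smooth transition lives on `[0, 1]`, so it is bounded, and the associated
radial field is `C¹` with compact support, hence Lipschitz. The steps of all radii are rescalings of
this one. -/
lemma exists_stepConst : ∃ C : ℝ, 0 ≤ C ∧ (∀ s, deriv Real.smoothTransition s ≤ C) ∧
    ∀ x y : Plane, ‖deriv Real.smoothTransition (‖x‖ ^ 2 - 1) • x -
      deriv Real.smoothTransition (‖y‖ ^ 2 - 1) • y‖ ≤ C * ‖x - y‖ := by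
  obtain ⟨C₁, hC₁⟩ := (isCompact_Icc (a := (0 : ℝ)) (b := 1)).exists_bound_of_continuousOn
    (contDiff_deriv_smoothTransition.continuous.continuousOn)
  have hψ : ContDiff ℝ 1 fun x : Plane => deriv Real.smoothTransition (‖x‖ ^ 2 - 1) • x :=
    (contDiff_deriv_smoothTransition.comp ((contDiff_norm_sq ℝ).sub contDiff_const)).smul
      contDiff_id
  have hc : HasCompactSupport fun x : Plane => deriv Real.smoothTransition (‖x‖ ^ 2 - 1) • x := by
    refine HasCompactSupport.intro (isCompact_closedBall (0 : Plane) 2) fun x hx => ?_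
    have hx' : 2 < ‖x‖ := by simpa using hx
    rw [deriv_smoothTransition_eq_zero (Or.inr (by nlinarith)), zero_smul]
  obtain ⟨C₂, hC₂⟩ := hψ.lipschitzWith_of_hasCompactSupport hc one_ne_zero
  refine ⟨max (max C₁ 0) C₂, le_max_of_le_left (le_max_right _ _), fun s => ?_, fun x y => ?_⟩
  · by_cases hs : s ∈ Icc (0 : ℝ) 1
    · exact ((le_abs_self _).trans (hC₁ s hs)).trans ((le_max_left _ _).trans (le_max_left _ _))
    · rw [deriv_smoothTransition_eq_zero]
      · exact le_max_of_le_left (le_max_right _ _)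
      · by_contra! h
        exact hs ⟨h.1, h.2⟩
  · have := hC₂.dist_le_mul x y
    rw [dist_eq_norm, dist_eq_norm] at this
    exact this.trans (mul_le_mul_of_nonneg_right (le_max_right _ _) (norm_nonneg _))

/-- A bound for the first and second derivatives of the smooth step. -/
def stepConst : ℝ := exists_stepConst.choose

lemma stepConst_nonneg : 0 ≤ stepConst := exists_stepConst.choose_spec.1

lemma deriv_step_le {r : ℝ} (hr : 0 < r) (s : ℝ) : deriv (step r) s ≤ stepConst / r ^ 2 := by
  rw [deriv_step]
  have := exists_stepConst.choose_spec.2.1 (s / r ^ 2 - 1)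
  exact div_le_div_of_nonneg_right this (by positivity)

/-- The gradient of `x ↦ step r (τ² |x - c|²)`. -/
def stepGrad (r τ : ℝ) (c x : Plane) : Plane :=
  (2 * τ ^ 2 * deriv (step r) (τ ^ 2 * ‖x - c‖ ^ 2)) • (x - c)

/-- `stepGrad` is `2τ/r` times the unit-scale field at `(τ/r)(x - c)`. Its Lipschitz constant
therefore scales like `τ²/r²`, and `τ ≤ 1`. -/
lemma norm_stepGrad_sub_le {r τ : ℝ} (hr : 0 < r) (hτ : 0 < τ) (hτ1 : τ ≤ 1) (c x y : Plane) :
    ‖stepGrad r τ c x - stepGrad r τ c y‖ ≤ 2 * stepConst / r ^ 2 * ‖x - y‖ := by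
  have h : ∀ x, stepGrad r τ c x = (2 * τ / r) •
      (deriv Real.smoothTransition (‖(τ / r) • (x - c)‖ ^ 2 - 1) • ((τ / r) • (x - c))) := by
    intro x
    rw [stepGrad, deriv_step, smul_smul, smul_smul, norm_smul, Real.norm_of_nonneg (by positivity)]
    have e : (τ / r * ‖x - c‖) ^ 2 = τ ^ 2 * ‖x - c‖ ^ 2 / r ^ 2 := by
      field_simp
    rw [e]
    congr 1
    field_simp
  rw [h, h, ← smul_sub, norm_smul, Real.norm_of_nonneg (by positivity)]
  have h1 := exists_stepConst.choose_spec.2.2 ((τ / r) • (x - c)) ((τ / r) • (y - c))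
  have h2 : ‖(τ / r) • (x - c) - (τ / r) • (y - c)‖ = τ / r * ‖x - y‖ := by
    rw [← smul_sub, norm_smul, Real.norm_of_nonneg (by positivity), sub_sub_sub_cancel_right]
  rw [h2] at h1
  have hC : 0 ≤ stepConst := stepConst_nonneg
  calc _ ≤ 2 * τ / r * (stepConst * (τ / r * ‖x - y‖)) :=
        mul_le_mul_of_nonneg_left h1 (by positivity)
    _ = τ ^ 2 * (2 * stepConst / r ^ 2 * ‖x - y‖) := by field_simp
    _ ≤ 1 * (2 * stepConst / r ^ 2 * ‖x - y‖) := by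
        refine mul_le_mul_of_nonneg_right (by nlinarith) (by positivity)
    _ = _ := one_mul _

lemma stepGrad_eq_zero {r τ : ℝ} (hr : 0 < r) (hτ : 0 < τ) {c x : Plane}
    (h : τ * ‖x - c‖ < r) : stepGrad r τ c x = 0 := by
  rw [stepGrad, deriv_step_eq_zero hr, mul_zero, zero_smul]
  rw [← mul_pow]
  exact pow_lt_pow_left₀ h (by positivity) two_ne_zero

lemma measurable_stepGrad (r τ : ℝ) (c : Plane) : Measurable (stepGrad r τ c) := by
  have : Continuous (stepGrad r τ c) := by
    have := continuous_deriv_step r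
    unfold stepGrad
    fun_prop
  exact this.measurable

lemma norm_stepGrad_le {r τ : ℝ} (hr : 0 < r) (hτ1 : τ ∈ Ioc (0 : ℝ) 1) (c x : Plane) :
    ‖stepGrad r τ c x‖ ≤ 2 * stepConst / r ^ 2 * ‖x - c‖ := by
  have h0 : stepGrad r τ c c = 0 := by simp [stepGrad]
  have := norm_stepGrad_sub_le hr hτ1.1 hτ1.2 c x c
  rwa [h0, sub_zero] at this

/-! ### The flux through a smooth step -/

/-- The rate in the estimate of the flux through the annulus of radius `r`. -/
def fluxRate (α N I r : ℝ) : ℝ :=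
  2 * stepConst / r ^ 2 * (coreConst α * I * (r / 2) ^ (-(2 + α)) +
    |kernelConst α| * ((ballRiesz α + 1) * (N ^ (α / 2) * (4 * I / r ^ 2) ^ (1 - α / 2))))

section Flux

variable {α N I : ℝ} {ν : Measure Plane} [IsProbabilityMeasure ν] {c : Plane}

lemma measureReal_compl_ball_le {ν : Measure Plane} (hi : Integrable (fun y => ‖y - c‖ ^ 2) ν)
    (hI : ∫ y, ‖y - c‖ ^ 2 ∂ν ≤ I) {r : ℝ} (hr : 0 < r) :
    ν.real (Metric.ball c r)ᶜ ≤ I / r ^ 2 := by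
  rw [le_div_iff₀ (by positivity), mul_comm]
  have h := mul_meas_ge_le_integral_of_nonneg (μ := ν) (f := fun y => ‖y - c‖ ^ 2)
    (ae_of_all _ fun y => sq_nonneg _) hi (r ^ 2)
  refine le_trans (le_of_eq ?_) (h.trans hI)
  congr 2
  ext y
  simp [dist_eq_norm, pow_le_pow_iff_left₀ hr.le (norm_nonneg (y - c))]

lemma vel_eq_add_compl (hα : α ∈ Ioo (0 : ℝ) 1) (hν : ν ≤ ENNReal.ofReal N • volume)
    {S : Set Plane} (hS : MeasurableSet S) (x : Plane) :
    vel α ν x = vel α (ν.restrict S) x + vel α (ν.restrict Sᶜ) x :=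
  (integral_add_compl hS (integrable_kernel hα hν x)).symm

lemma exists_norm_vel_le (hα : α ∈ Ioo (0 : ℝ) 1) (hν : ν ≤ ENNReal.ofReal N • volume)
    (hN : 0 < N) (S : Set Plane) : ∃ U, ∀ x, ‖vel α (ν.restrict S) x‖ ≤ U :=
  ⟨_, fun x => norm_vel_le hα (Measure.restrict_le_self.trans hν) hN one_pos
    (by rw [measureReal_restrict_apply_univ]; exact measureReal_le_one) x⟩

/-- The core `|y - c| < r/2` is treated pointwise by its far field, the exterior by symmetrization.
The factor `ν.real {r ≤ τ‖x - c‖}` on the right is what allows the estimate to be iterated over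
radii. -/
lemma integral_inner_vel_stepGrad_le (hα : α ∈ Ioo (0 : ℝ) 1) (hν : ν ≤ ENNReal.ofReal N • volume)
    (hN : 0 < N) {ρ : ℝ} (hρ : ∀ᵐ x ∂ν, ‖x - c‖ ≤ ρ) (hc : ∫ y, (y - c) ∂ν = 0) (hI0 : 0 < I)
    (hI : ∫ y, ‖y - c‖ ^ 2 ∂ν ≤ I) {r τ : ℝ} (hr : 0 < r) (hτ : τ ∈ Ioc (0 : ℝ) 1) :
    ∫ x, inner ℝ (vel α ν x) (stepGrad r τ c x) ∂ν ≤
      fluxRate α N I r * ν.real {x | r ≤ τ * ‖x - c‖} := by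
  set P : Set Plane := {x | r ≤ τ * ‖x - c‖} with hP
  have hPm : MeasurableSet P :=
    measurableSet_le measurable_const (((measurable_id.sub_const c).norm).const_mul τ)
  set S := Metric.ball c (r / 2) with hS
  have hSm : MeasurableSet S := Metric.isOpen_ball.measurableSet
  have hi : Integrable (fun y => ‖y - c‖ ^ 2) ν := by
    refine Integrable.of_bound (C := ρ ^ 2) (by fun_prop) ?_
    filter_upwards [hρ] with x hx
    rw [Real.norm_of_nonneg (sq_nonneg _)]
    exact pow_le_pow_left₀ (norm_nonneg _) hx 2
  have haP : ∀ x, x ∉ P → stepGrad r τ c x = 0 := fun x hx =>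
    stepGrad_eq_zero hr hτ.1 (not_le.1 hx)
  have haS : ∀ x ∈ S, stepGrad r τ c x = 0 := by
    intro x hx
    refine haP x fun h => ?_
    have h1 : ‖x - c‖ < r / 2 := by simpa [hS, dist_eq_norm] using hx
    have h2 : r ≤ τ * ‖x - c‖ := h
    nlinarith [norm_nonneg (x - c), hτ.2]
  have hB : ∀ᵐ x ∂ν, ‖stepGrad r τ c x‖ ≤ 2 * stepConst / r ^ 2 * ρ := by
    filter_upwards [hρ] with x hx
    refine (norm_stepGrad_le hr hτ c x).trans (mul_le_mul_of_nonneg_left hx ?_)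
    have := stepConst_nonneg
    positivity
  have hinner : ∀ T : Set Plane,
      Integrable (fun x => inner ℝ (vel α (ν.restrict T) x) (stepGrad r τ c x)) ν := by
    intro T
    obtain ⟨U, hU⟩ := exists_norm_vel_le (α := α) hα hν hN T
    refine Integrable.of_bound (C := U * (2 * stepConst / r ^ 2 * ρ))
      ((stronglyMeasurable_vel α _).aestronglyMeasurable.inner
        (measurable_stepGrad r τ c).aestronglyMeasurable) ?_
    filter_upwards [hB] with x hx
    exact (norm_inner_le_norm _ _).trans
      (mul_le_mul (hU x) hx (norm_nonneg _) ((norm_nonneg _).trans (hU x)))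
  have hsplit : ∫ x, inner ℝ (vel α ν x) (stepGrad r τ c x) ∂ν =
      ∫ x, inner ℝ (vel α (ν.restrict S) x) (stepGrad r τ c x) ∂ν +
      ∫ x, inner ℝ (vel α (ν.restrict Sᶜ) x) (stepGrad r τ c x) ∂ν := by
    rw [← integral_add (hinner S) (hinner Sᶜ)]
    refine integral_congr_ae (ae_of_all _ fun x => ?_)
    simp only
    rw [vel_eq_add_compl hα hν hSm x, inner_add_left]
  have hcore : ∫ x, inner ℝ (vel α (ν.restrict S) x) (stepGrad r τ c x) ∂ν ≤
      2 * stepConst / r ^ 2 * (coreConst α * I * (r / 2) ^ (-(2 + α))) * ν.real P := by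
    have hpt : ∀ x, inner ℝ (vel α (ν.restrict S) x) (stepGrad r τ c x) ≤
        P.indicator (fun _ => 2 * stepConst / r ^ 2 *
          (coreConst α * I * (r / 2) ^ (-(2 + α)))) x := by
      intro x
      by_cases hx : x ∈ P
      · rw [indicator_of_mem hx, stepGrad, inner_smul_right]
        have hx' : r ≤ τ * ‖x - c‖ := hx
        have h1 := inner_vel_core_le hα hν hi hc (half_pos hr) (x := x)
          (by nlinarith [norm_nonneg (x - c), hτ.2])
        have h2 : coreConst α * (∫ y, ‖y - c‖ ^ 2 ∂ν) * (r / 2) ^ (-(2 + α)) ≤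
            coreConst α * I * (r / 2) ^ (-(2 + α)) := by
          refine mul_le_mul_of_nonneg_right (mul_le_mul_of_nonneg_left hI
            (coreConst_nonneg hα.1)) (by positivity)
        have h3 : 2 * τ ^ 2 * deriv (step r) (τ ^ 2 * ‖x - c‖ ^ 2) ≤ 2 * stepConst / r ^ 2 := by
          have h4 := deriv_step_le hr (τ ^ 2 * ‖x - c‖ ^ 2)
          have h5 := deriv_step_nonneg hr (τ ^ 2 * ‖x - c‖ ^ 2)
          have h6 : τ ^ 2 ≤ 1 := by nlinarith [hτ.1, hτ.2]
          have : 2 * stepConst / r ^ 2 = 2 * (stepConst / r ^ 2) := by ring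
          rw [this]
          nlinarith
        have h7 : 0 ≤ 2 * τ ^ 2 * deriv (step r) (τ ^ 2 * ‖x - c‖ ^ 2) := by
          have h5 := deriv_step_nonneg hr (τ ^ 2 * ‖x - c‖ ^ 2)
          positivity
        refine (mul_le_mul_of_nonneg_left (h1.trans h2) h7).trans
          (mul_le_mul_of_nonneg_right h3 ?_)
        have := coreConst_nonneg hα.1
        positivity
      · rw [indicator_of_notMem hx, haP x hx, inner_zero_right]
    refine (integral_mono (hinner S) ((integrable_const _).indicator hPm) hpt).trans (le_of_eq ?_)
    rw [integral_indicator hPm, setIntegral_const, smul_eq_mul, mul_comm]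
  -- `stepGrad` vanishes on the core, so this is a pure self-interaction of the exterior measure,
  -- whose mass is at most `4 I / r²` by Chebyshev.
  have hext : ∫ x, inner ℝ (vel α (ν.restrict Sᶜ) x) (stepGrad r τ c x) ∂ν ≤
      2 * stepConst / r ^ 2 * |kernelConst α| *
        ((ballRiesz α + 1) * (N ^ (α / 2) * (4 * I / r ^ 2) ^ (1 - α / 2))) * ν.real P := by
    have hE : (ν.restrict Sᶜ).real univ ≤ 4 * I / r ^ 2 := by
      rw [measureReal_restrict_apply_univ]
      refine (measureReal_compl_ball_le hi hI (half_pos hr)).trans (le_of_eq ?_)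
      field_simp; norm_num
    have hνE : ν.restrict Sᶜ ≤ ENNReal.ofReal N • volume := Measure.restrict_le_self.trans hν
    have e : ∫ x, inner ℝ (vel α (ν.restrict Sᶜ) x) (stepGrad r τ c x) ∂ν =
        ∫ x in Sᶜ, inner ℝ (vel α (ν.restrict Sᶜ) x) (stepGrad r τ c x) ∂ν := by
      refine (setIntegral_eq_integral_of_forall_compl_eq_zero fun x hx => ?_).symm
      rw [haS x (not_notMem.1 hx), inner_zero_right]
    have hC := stepConst_nonneg
    have hb := ballRiesz_nonneg α
    rw [e]
    refine (integral_inner_vel_le_of_lipschitz hα hνE hN.le (measurable_stepGrad r τ c)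
      (ae_restrict_of_ae hB) (by positivity) (norm_stepGrad_sub_le hr hτ.1 hτ.2 c) hPm haP
      (fun x => integral_riesz_le hνE hN hα.1.le (by linarith [hα.2]) (by positivity) hE
        x)).trans ?_
    refine mul_le_mul_of_nonneg_left ?_ (by positivity)
    exact ENNReal.toReal_mono (measure_ne_top _ _) (Measure.restrict_le_self _)
  rw [hsplit]
  refine (add_le_add hcore hext).trans (le_of_eq ?_)
  rw [fluxRate]; ring

end Flux

/-! ### Weak measure-valued flows and radial test functions -/

/-- A measure-valued weak solution on `[0, T]` with density bounded by `N`, driven by a field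
bounded by `A`. -/
structure IsWeakFlow (α N A T : ℝ) (F : ℝ → Plane → Plane)
    (ν : ProbabilityTheory.Kernel ℝ Plane) : Prop where
  measurable_field : Measurable (Function.uncurry F)
  norm_field_le : ∀ t ∈ Icc 0 T, ∀ x, ‖F t x‖ ≤ A
  le_volume : ∀ t ∈ Icc 0 T, ν t ≤ ENNReal.ofReal N • volume
  mass_le : ∃ C : ℝ, ∀ t ∈ Icc 0 T, ν t univ ≤ ENNReal.ofReal C
  weak_form : ∀ f : ℝ → Plane → ℝ,
    ContDiff ℝ ∞ (Function.uncurry f) → HasCompactSupport (Function.uncurry f) →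
    ∀ t ∈ Icc 0 T, (∫ x, f t x ∂ν t) - ∫ x, f 0 x ∂ν 0 =
      ∫ s in (0 : ℝ)..t, ∫ x,
        (inner ℝ (vel α (ν s) x + F s x) (∇ (f s) x) + deriv (fun r => f r x) s) ∂ν s

/-- The rate of change of `H(τ² |x - c|²)` at a particle with velocity `u x`, when `c` moves with
velocity `v` and `τ` decays at the rate `lam`. -/
def flux (H : ℝ → ℝ) (lam τ : ℝ) (c v : Plane) (u : Plane → Plane) (x : Plane) : ℝ :=
  2 * τ ^ 2 * deriv H (τ ^ 2 * ‖x - c‖ ^ 2) * (inner ℝ (u x - v) (x - c) - lam * ‖x - c‖ ^ 2)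

lemma contDiff_exp_neg_mul (lam : ℝ) : ContDiff ℝ ∞ fun t : ℝ => Real.exp (-(lam * t)) :=
  Real.contDiff_exp.comp (contDiff_const.mul contDiff_id).neg

section SmoothCenter

variable {H : ℝ → ℝ} {γ : ℝ → Plane}

lemma gradient_radial (hH : ContDiff ℝ ∞ H) (τ : ℝ) (c x : Plane) :
    ∇ (fun x : Plane => H (τ ^ 2 * ‖x - c‖ ^ 2)) x =
      (2 * τ ^ 2 * deriv H (τ ^ 2 * ‖x - c‖ ^ 2)) • (x - c) := by
  apply HasGradientAt.gradient
  rw [hasGradientAt_iff_hasFDerivAt]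
  have h1 : HasFDerivAt (fun x : Plane => ‖x - c‖ ^ 2) (2 • (innerSL ℝ (x - c))) x := by
    have h := (hasStrictFDerivAt_norm_sq (x - c)).hasFDerivAt.comp x
      ((hasFDerivAt_id (𝕜 := ℝ) x).sub_const c)
    exact h.congr_fderiv (by ext y; simp)
  have h2 := (hH.differentiable (by simp) (τ ^ 2 * ‖x - c‖ ^ 2)).hasDerivAt.comp_hasFDerivAt x
    (h1.const_mul (τ ^ 2))
  refine h2.congr_fderiv ?_
  ext y
  simp
  ring

lemma deriv_radial (hH : ContDiff ℝ ∞ H) (hγ : ContDiff ℝ ∞ γ) (lam : ℝ) (x : Plane) (s : ℝ) :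
    deriv (fun r => H (Real.exp (-(lam * r)) ^ 2 * ‖x - γ r‖ ^ 2)) s =
      deriv H (Real.exp (-(lam * s)) ^ 2 * ‖x - γ s‖ ^ 2) *
        (2 * Real.exp (-(lam * s)) ^ 2 *
          (-(inner ℝ (deriv γ s) (x - γ s)) - lam * ‖x - γ s‖ ^ 2)) := by
  have hd : HasDerivAt γ (deriv γ s) s := (hγ.differentiable (by simp) s).hasDerivAt
  have h1 : HasDerivAt (fun r => ‖x - γ r‖ ^ 2) (2 * inner ℝ (x - γ s) (-deriv γ s)) s :=
    (hd.const_sub x).norm_sq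
  have h2 : HasDerivAt (fun r : ℝ => Real.exp (-(lam * r)))
      (Real.exp (-(lam * s)) * -(lam * 1)) s :=
    (((hasDerivAt_id s).const_mul lam).neg).exp
  have h3 := (hH.differentiable (by simp)
    (Real.exp (-(lam * s)) ^ 2 * ‖x - γ s‖ ^ 2)).hasDerivAt.comp s ((h2.pow 2).mul h1)
  have h4 := h3.deriv
  simp only [Function.comp_def, Pi.pow_apply, Pi.mul_apply] at h4
  rw [h4, inner_neg_right, real_inner_comm]
  push_cast
  ring

lemma contDiff_radial (hH : ContDiff ℝ ∞ H) (hγ : ContDiff ℝ ∞ γ) (lam : ℝ) :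
    ContDiff ℝ ∞ fun q : ℝ × Plane =>
      H (Real.exp (-(lam * q.1)) ^ 2 * ‖q.2 - γ q.1‖ ^ 2) := by
  refine hH.comp (ContDiff.mul (((contDiff_exp_neg_mul lam).comp contDiff_fst).pow 2) ?_)
  exact (contDiff_snd.sub (hγ.comp contDiff_fst)).norm_sq ℝ

/-- A smooth function of time equal to one on `[-T, T]` and vanishing for `|t| ≥ T + 2`. -/
def timeCutoff (T t : ℝ) : ℝ := Real.smoothTransition ((T + 2) ^ 2 - t ^ 2)

lemma contDiff_timeCutoff (T : ℝ) : ContDiff ℝ ∞ (timeCutoff T) :=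
  (Real.smoothTransition.contDiff (n := ⊤)).comp (contDiff_const.sub (contDiff_id.pow 2))

lemma timeCutoff_eventually_eq_one {T t : ℝ} (ht : t ∈ Icc 0 T) :
    ∀ᶠ s in nhds t, timeCutoff T s = 1 := by
  filter_upwards [Ioo_mem_nhds (show t - 1 < t by linarith) (show t < t + 1 by linarith)] with s hs
  refine Real.smoothTransition.one_of_one_le ?_
  nlinarith [hs.1, hs.2, ht.1, ht.2]

lemma timeCutoff_eq_zero {T t : ℝ} (hT : 0 ≤ T) (ht : t ∉ Icc (-(T + 2)) (T + 2)) :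
    timeCutoff T t = 0 := by
  refine Real.smoothTransition.zero_of_nonpos ?_
  have : T + 2 < |t| := by
    by_contra! h
    exact ht (abs_le.1 h)
  nlinarith [sq_abs t]

/-- On the support of the time cutoff `γ` is bounded and the exponential factor is bounded below by
a positive constant, so large `x` have argument beyond `s₀`. -/
lemma hasCompactSupport_radial (hγ : ContDiff ℝ ∞ γ) (lam : ℝ) {s₀ : ℝ}
    (hs₀ : ∀ s, s₀ ≤ s → H s = 0) {T : ℝ} (hT : 0 ≤ T) :
    HasCompactSupport fun q : ℝ × Plane =>
      timeCutoff T q.1 * H (Real.exp (-(lam * q.1)) ^ 2 * ‖q.2 - γ q.1‖ ^ 2) := by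
  obtain ⟨G, hG⟩ := (isCompact_Icc (a := -(T + 2)) (b := T + 2)).exists_bound_of_continuousOn
    hγ.continuous.continuousOn
  set e := Real.exp (-(|lam| * (T + 2))) with he
  have he0 : 0 < e := Real.exp_pos _
  refine HasCompactSupport.intro
    ((isCompact_Icc (a := -(T + 2)) (b := T + 2)).prod
      (isCompact_closedBall (0 : Plane) (G + (|s₀| / e ^ 2 + 1)))) fun q hq => ?_
  by_cases h1 : q.1 ∈ Icc (-(T + 2)) (T + 2)
  · have h2 : G + (|s₀| / e ^ 2 + 1) < ‖q.2‖ := by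
      by_contra! h
      exact hq ⟨h1, by simpa using h⟩
    have h3 : |s₀| / e ^ 2 + 1 ≤ ‖q.2 - γ q.1‖ := by
      have := norm_sub_norm_le q.2 (γ q.1)
      linarith [hG _ h1]
    have h4 : e ≤ Real.exp (-(lam * q.1)) := by
      refine Real.exp_le_exp.2 ?_
      have : |lam * q.1| ≤ |lam| * (T + 2) := by
        rw [abs_mul]
        exact mul_le_mul_of_nonneg_left (abs_le.2 h1) (abs_nonneg _)
      linarith [le_abs_self (lam * q.1)]
    rw [hs₀, mul_zero]
    have h5 : |s₀| / e ^ 2 ≤ ‖q.2 - γ q.1‖ ^ 2 := by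
      have : 0 ≤ |s₀| / e ^ 2 := by positivity
      nlinarith
    calc s₀ ≤ |s₀| := le_abs_self _
      _ = e ^ 2 * (|s₀| / e ^ 2) := by field_simp
      _ ≤ _ := mul_le_mul (pow_le_pow_left₀ he0.le h4 2) h5 (by positivity) (by positivity)
  · rw [timeCutoff_eq_zero hT h1, zero_mul]

/-- The cutoff only serves to make the test function compactly supported in time. The time
derivatives of the centre and of `τ` supply the terms `-v` and `-lam ‖x - c‖²` of `flux`. -/
lemma IsWeakFlow.radial_smooth {α N A T : ℝ} {F : ℝ → Plane → Plane}
    {ν : ProbabilityTheory.Kernel ℝ Plane} (h : IsWeakFlow α N A T F ν)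
    (hH : ContDiff ℝ ∞ H) (hγ : ContDiff ℝ ∞ γ) (lam : ℝ) {s₀ : ℝ}
    (hs₀ : ∀ s, s₀ ≤ s → H s = 0) {t : ℝ} (ht : t ∈ Icc 0 T) :
    (∫ x, H (Real.exp (-(lam * t)) ^ 2 * ‖x - γ t‖ ^ 2) ∂ν t) -
      ∫ x, H (‖x - γ 0‖ ^ 2) ∂ν 0 =
      ∫ s in (0 : ℝ)..t, ∫ x, flux H lam (Real.exp (-(lam * s))) (γ s) (deriv γ s)
        (fun x => vel α (ν s) x + F s x) x ∂ν s := by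
  have hT : 0 ≤ T := ht.1.trans ht.2
  have hw := h.weak_form
    (fun t x => timeCutoff T t * H (Real.exp (-(lam * t)) ^ 2 * ‖x - γ t‖ ^ 2))
    (((contDiff_timeCutoff T).comp contDiff_fst).mul (contDiff_radial hH hγ lam))
    (hasCompactSupport_radial hγ lam hs₀ hT) t ht
  have h1 : ∀ s ∈ Icc 0 T, timeCutoff T s = 1 := fun s hs =>
    (timeCutoff_eventually_eq_one hs).self_of_nhds
  simp only [h1 t ht, h1 0 ⟨le_rfl, hT⟩, one_mul, mul_zero, neg_zero, Real.exp_zero,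
    one_pow] at hw
  rw [hw]
  refine intervalIntegral.integral_congr fun s hs => ?_
  rw [uIcc_of_le ht.1] at hs
  have hs' : s ∈ Icc 0 T := ⟨hs.1, hs.2.trans ht.2⟩
  refine integral_congr_ae (ae_of_all _ fun x => ?_)
  simp only
  have hg : (fun x => timeCutoff T s * H (Real.exp (-(lam * s)) ^ 2 * ‖x - γ s‖ ^ 2)) =
      fun x => H (Real.exp (-(lam * s)) ^ 2 * ‖x - γ s‖ ^ 2) := by
    simp only [h1 s hs', one_mul]
  have hd : (fun r => timeCutoff T r * H (Real.exp (-(lam * r)) ^ 2 * ‖x - γ r‖ ^ 2)) =ᶠ[nhds s]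
      fun r => H (Real.exp (-(lam * r)) ^ 2 * ‖x - γ r‖ ^ 2) := by
    filter_upwards [timeCutoff_eventually_eq_one hs'] with r hr
    rw [hr, one_mul]
  rw [hg, hd.deriv_eq, gradient_radial hH, deriv_radial hH hγ, inner_smul_right, flux,
    inner_sub_left]
  ring

end SmoothCenter

/-! ### Centres that are merely Lipschitz in time -/

lemma exists_bound_lipschitz {E : Type*} [NormedAddCommGroup E] [NormedSpace ℝ E] {f : Plane → E}
    (hf : ContDiff ℝ 1 f) (hc : HasCompactSupport f) :
    ∃ C : ℝ, 0 ≤ C ∧ (∀ x, ‖f x‖ ≤ C) ∧ ∀ x y, ‖f x - f y‖ ≤ C * ‖x - y‖ := by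
  obtain ⟨C₁, hC₁⟩ := hc.exists_bound_of_continuous hf.continuous
  obtain ⟨C₂, hC₂⟩ := hf.lipschitzWith_of_hasCompactSupport hc one_ne_zero
  refine ⟨max C₁ C₂, le_max_of_le_right C₂.2, fun x => (hC₁ x).trans (le_max_left _ _),
    fun x y => ?_⟩
  have := hC₂.dist_le_mul x y
  rw [dist_eq_norm, dist_eq_norm] at this
  exact this.trans (mul_le_mul_of_nonneg_right (le_max_right _ _) (norm_nonneg _))

lemma deriv_eq_zero_of_vanishing {H : ℝ → ℝ} {s₀ s : ℝ} (hs₀ : ∀ s, s₀ ≤ s → H s = 0)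
    (hs : s₀ < s) : deriv H s = 0 := by
  have : H =ᶠ[nhds s] fun _ => 0 := by
    filter_upwards [Ioi_mem_nhds hs] with t ht
    exact hs₀ t (le_of_lt ht)
  rw [this.deriv_eq, deriv_const]

lemma hasCompactSupport_comp_norm_sq {E : Type*} [Zero E] {f : Plane → E} {s₀ : ℝ}
    (hf : ∀ x, s₀ < ‖x‖ ^ 2 → f x = 0) : HasCompactSupport f := by
  refine HasCompactSupport.intro (isCompact_closedBall (0 : Plane) (|s₀| + 1)) fun x hx => ?_
  have hx' : |s₀| + 1 < ‖x‖ := by simpa using hx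
  exact hf x (by nlinarith [le_abs_self s₀, abs_nonneg s₀])

/-- Uniform bounds for the radial functions that occur in `flux`. -/
lemma exists_radial_bounds {H : ℝ → ℝ} (hH : ContDiff ℝ ∞ H) {s₀ : ℝ}
    (hs₀ : ∀ s, s₀ ≤ s → H s = 0) : ∃ C : ℝ, 0 ≤ C ∧
      (∀ x : Plane, ‖deriv H (‖x‖ ^ 2) • x‖ ≤ C) ∧
      (∀ x : Plane, |deriv H (‖x‖ ^ 2) * ‖x‖ ^ 2| ≤ C) ∧
      (∀ x y : Plane, |H (‖x‖ ^ 2) - H (‖y‖ ^ 2)| ≤ C * ‖x - y‖) ∧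
      (∀ x y : Plane, ‖deriv H (‖x‖ ^ 2) • x - deriv H (‖y‖ ^ 2) • y‖ ≤ C * ‖x - y‖) ∧
      ∀ x y : Plane, |deriv H (‖x‖ ^ 2) * ‖x‖ ^ 2 - deriv H (‖y‖ ^ 2) * ‖y‖ ^ 2| ≤
        C * ‖x - y‖ := by
  have hn : ContDiff ℝ 1 fun x : Plane => ‖x‖ ^ 2 := contDiff_norm_sq ℝ
  have hH1 : ContDiff ℝ 1 H := hH.of_le (by simp)
  have hH' : ContDiff ℝ 1 (deriv H) := by
    have : ContDiff ℝ (1 + 1) H := hH.of_le (by norm_cast)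
    exact (contDiff_succ_iff_deriv.1 this).2.2
  obtain ⟨C₁, hC₁, -, hL₁⟩ := exists_bound_lipschitz (hH1.comp hn)
    (hasCompactSupport_comp_norm_sq (s₀ := s₀) fun x hx => hs₀ _ hx.le)
  obtain ⟨C₂, hC₂, hB₂, hL₂⟩ := exists_bound_lipschitz ((hH'.comp hn).smul contDiff_id)
    (hasCompactSupport_comp_norm_sq (s₀ := s₀) fun x hx => by
      simp [deriv_eq_zero_of_vanishing hs₀ hx])
  obtain ⟨C₃, hC₃, hB₃, hL₃⟩ := exists_bound_lipschitz ((hH'.comp hn).mul hn)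
    (hasCompactSupport_comp_norm_sq (s₀ := s₀) fun x hx => by
      simp [deriv_eq_zero_of_vanishing hs₀ hx])
  refine ⟨C₁ + C₂ + C₃, by positivity, fun x => (hB₂ x).trans (by linarith),
    fun x => (hB₃ x).trans (by linarith), fun x y => (hL₁ x y).trans ?_,
    fun x y => (hL₂ x y).trans ?_, fun x y => (hL₃ x y).trans ?_⟩ <;>
  exact mul_le_mul_of_nonneg_right (by linarith) (norm_nonneg _)

/-- In the variable `τ • (x - c)` only two fixed compactly supported radial functions occur when `H`
vanishes at infinity, so their bounds do not depend on the centre. -/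
lemma flux_eq (H : ℝ → ℝ) (lam : ℝ) {τ : ℝ} (hτ : 0 < τ) (c v : Plane) (u : Plane → Plane)
    (x : Plane) : flux H lam τ c v u x =
      inner ℝ (u x - v) ((2 * τ) • (deriv H (‖τ • (x - c)‖ ^ 2) • (τ • (x - c)))) -
        2 * lam * (deriv H (‖τ • (x - c)‖ ^ 2) * ‖τ • (x - c)‖ ^ 2) := by
  rw [norm_smul, Real.norm_of_nonneg hτ.le, mul_pow, flux, inner_smul_right, inner_smul_right,
    inner_smul_right]
  ring

/-- Boundedness of the flux and its Lipschitz dependence on the centre and on the velocity of the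
centre, uniformly in `x`; this is what lets smooth centres approximate Lipschitz ones. -/
lemma exists_flux_bounds {H : ℝ → ℝ} (hH : ContDiff ℝ ∞ H) {s₀ : ℝ}
    (hs₀ : ∀ s, s₀ ≤ s → H s = 0) (lam : ℝ) {U V b : ℝ} (hU : 0 ≤ U) (hV : 0 ≤ V) (hb : 0 ≤ b) :
    ∃ C : ℝ, 0 ≤ C ∧ ∀ τ ∈ Ioc 0 b, ∀ (c v : Plane) (u : Plane → Plane) (x : Plane),
      ‖u x‖ ≤ U → ‖v‖ ≤ V → |flux H lam τ c v u x| ≤ C ∧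
      ∀ γ g : Plane, |flux H lam τ γ g u x - flux H lam τ c v u x| ≤
        C * (‖γ - c‖ + ‖g - v‖) ∧
        |H (τ ^ 2 * ‖x - γ‖ ^ 2) - H (τ ^ 2 * ‖x - c‖ ^ 2)| ≤ C * ‖γ - c‖ := by
  obtain ⟨C, hC, hB₂, hB₃, hL₁, hL₂, hL₃⟩ := exists_radial_bounds hH hs₀
  have hla := abs_nonneg lam
  refine ⟨(U + V) * (2 * b * C) + 2 * |lam| * C + (U + V) * (2 * b * (C * b)) + 2 * b * C +
    2 * |lam| * (C * b) + C * b, by positivity, fun τ hτ c v u x hu hv => ⟨?_, fun γ g => ⟨?_, ?_⟩⟩⟩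
  · rw [flux_eq H lam hτ.1]
    have h1 : |inner ℝ (u x - v) ((2 * τ) • (deriv H (‖τ • (x - c)‖ ^ 2) • (τ • (x - c))))| ≤
        (U + V) * (2 * b * C) := by
      refine (abs_real_inner_le_norm _ _).trans (mul_le_mul ((norm_sub_le _ _).trans
        (add_le_add hu hv)) ?_ (norm_nonneg _) (by positivity))
      rw [norm_smul, Real.norm_of_nonneg (by linarith [hτ.1])]
      exact mul_le_mul (by linarith [hτ.2]) (hB₂ _) (norm_nonneg _) (by positivity)
    have h2 : |2 * lam * (deriv H (‖τ • (x - c)‖ ^ 2) * ‖τ • (x - c)‖ ^ 2)| ≤ 2 * |lam| * C := by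
      rw [abs_mul, abs_mul, abs_two]
      exact mul_le_mul_of_nonneg_left (hB₃ _) (by positivity)
    refine (abs_sub _ _).trans ?_
    have : 0 ≤ (U + V) * (2 * b * (C * b)) + 2 * b * C + 2 * |lam| * (C * b) + C * b := by
      positivity
    linarith
  · have hz : ‖τ • (x - γ) - τ • (x - c)‖ ≤ b * ‖γ - c‖ := by
      rw [← smul_sub, norm_smul, Real.norm_of_nonneg hτ.1.le, sub_sub_sub_cancel_left,
        norm_sub_rev]
      exact mul_le_mul_of_nonneg_right hτ.2 (norm_nonneg _)
    rw [flux_eq H lam hτ.1, flux_eq H lam hτ.1]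
    set zγ := τ • (x - γ)
    set zc := τ • (x - c)
    have e : inner ℝ (u x - g) ((2 * τ) • (deriv H (‖zγ‖ ^ 2) • zγ)) -
        2 * lam * (deriv H (‖zγ‖ ^ 2) * ‖zγ‖ ^ 2) -
        (inner ℝ (u x - v) ((2 * τ) • (deriv H (‖zc‖ ^ 2) • zc)) -
        2 * lam * (deriv H (‖zc‖ ^ 2) * ‖zc‖ ^ 2)) =
        inner ℝ (u x - v) ((2 * τ) • (deriv H (‖zγ‖ ^ 2) • zγ - deriv H (‖zc‖ ^ 2) • zc)) -
        inner ℝ (g - v) ((2 * τ) • (deriv H (‖zγ‖ ^ 2) • zγ)) -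
        2 * lam * (deriv H (‖zγ‖ ^ 2) * ‖zγ‖ ^ 2 - deriv H (‖zc‖ ^ 2) * ‖zc‖ ^ 2) := by
      simp only [smul_sub, inner_sub_left, inner_sub_right]
      ring
    rw [e]
    have h1 : |inner ℝ (u x - v)
        ((2 * τ) • (deriv H (‖zγ‖ ^ 2) • zγ - deriv H (‖zc‖ ^ 2) • zc))| ≤
        (U + V) * (2 * b * (C * b)) * ‖γ - c‖ := by
      refine (abs_real_inner_le_norm _ _).trans ?_
      rw [mul_assoc]
      refine mul_le_mul ((norm_sub_le _ _).trans
        (add_le_add hu hv)) ?_ (norm_nonneg _) (by positivity)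
      rw [norm_smul, Real.norm_of_nonneg (by linarith [hτ.1]), mul_assoc (2 * b)]
      refine mul_le_mul (by linarith [hτ.2]) ?_ (norm_nonneg _) (by positivity)
      rw [mul_assoc]
      exact (hL₂ _ _).trans (mul_le_mul_of_nonneg_left hz hC)
    have h2 : |inner ℝ (g - v) ((2 * τ) • (deriv H (‖zγ‖ ^ 2) • zγ))| ≤
        2 * b * C * ‖g - v‖ := by
      refine (abs_real_inner_le_norm _ _).trans ?_
      rw [mul_comm]
      refine mul_le_mul_of_nonneg_right ?_ (norm_nonneg _)
      rw [norm_smul, Real.norm_of_nonneg (by linarith [hτ.1])]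
      exact mul_le_mul (by linarith [hτ.2]) (hB₂ _) (norm_nonneg _) (by positivity)
    have h3 : |2 * lam * (deriv H (‖zγ‖ ^ 2) * ‖zγ‖ ^ 2 - deriv H (‖zc‖ ^ 2) * ‖zc‖ ^ 2)| ≤
        2 * |lam| * (C * b) * ‖γ - c‖ := by
      rw [abs_mul, abs_mul, abs_two, mul_assoc (2 * |lam|)]
      refine mul_le_mul_of_nonneg_left ((hL₃ _ _).trans ?_) (by positivity)
      rw [mul_assoc]
      exact mul_le_mul_of_nonneg_left hz hC
    refine (abs_sub _ _).trans ((add_le_add_left (abs_sub _ _) _).trans ?_)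
    have p1 : 0 ≤ ((U + V) * (2 * b * C) + 2 * |lam| * C + 2 * b * C + C * b) * ‖γ - c‖ := by
      positivity
    have p2 : 0 ≤ ((U + V) * (2 * b * C) + 2 * |lam| * C + (U + V) * (2 * b * (C * b)) +
      2 * |lam| * (C * b) + C * b) * ‖g - v‖ := by positivity
    linarith
  · have hz : ‖τ • (x - γ) - τ • (x - c)‖ ≤ b * ‖γ - c‖ := by
      rw [← smul_sub, norm_smul, Real.norm_of_nonneg hτ.1.le, sub_sub_sub_cancel_left,
        norm_sub_rev]
      exact mul_le_mul_of_nonneg_right hτ.2 (norm_nonneg _)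
    have hn : ∀ w : Plane, τ ^ 2 * ‖w‖ ^ 2 = ‖τ • w‖ ^ 2 := fun w => by
      rw [norm_smul, Real.norm_of_nonneg hτ.1.le, mul_pow]
    rw [hn, hn]
    refine (hL₁ _ _).trans ((mul_le_mul_of_nonneg_left hz hC).trans ?_)
    have : 0 ≤ ((U + V) * (2 * b * C) + 2 * |lam| * C + (U + V) * (2 * b * (C * b)) + 2 * b * C +
      2 * |lam| * (C * b)) * ‖γ - c‖ := by positivity
    linarith

section Measurability

variable {α : ℝ} {ν : ProbabilityTheory.Kernel ℝ Plane} [ProbabilityTheory.IsSFiniteKernel ν]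

lemma measurable_vel_kernel (α : ℝ) (ν : ProbabilityTheory.Kernel ℝ Plane)
    [ProbabilityTheory.IsSFiniteKernel ν] :
    Measurable fun q : ℝ × Plane => vel α (ν q.1) q.2 := by
  have h : StronglyMeasurable fun w : (ℝ × Plane) × Plane => kernel α (w.1.2 - w.2) :=
    ((measurable_kernel α).comp (measurable_fst.snd.sub measurable_snd)).stronglyMeasurable
  have := h.integral_kernel_prod_right' (κ := ProbabilityTheory.Kernel.prodMkRight Plane ν)
  exact this.measurable

lemma measurable_integral_flux {F : ℝ → Plane → Plane} (hF : Measurable (Function.uncurry F))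
    {H : ℝ → ℝ} (hH : Continuous (deriv H)) (lam : ℝ) {c v : ℝ → Plane} (hc : Measurable c)
    (hv : Measurable v) :
    StronglyMeasurable fun s => ∫ x, flux H lam (Real.exp (-(lam * s))) (c s) (v s)
        (fun x => vel α (ν s) x + F s x) x ∂ν s := by
  refine StronglyMeasurable.integral_kernel_prod_right ?_
  have hτ : Measurable fun q : ℝ × Plane => Real.exp (-(lam * q.1)) :=
    (measurable_fst.const_mul lam).neg.exp
  have hz : Measurable fun q : ℝ × Plane => q.2 - c q.1 :=
    measurable_snd.sub (hc.comp measurable_fst)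
  refine Measurable.stronglyMeasurable ?_
  refine Measurable.mul (((hτ.pow_const 2).const_mul 2).mul (hH.measurable.comp
    ((hτ.pow_const 2).mul (hz.norm.pow_const 2)))) (Measurable.sub ?_
      ((hz.norm.pow_const 2).const_mul lam))
  exact (((measurable_vel_kernel α ν).add hF).sub (hv.comp measurable_fst)).inner hz

end Measurability

/-- Primitive of a smooth compactly supported `L¹` approximation of `v`. Convergence of the velocity
in `L¹` is enough, since the flux enters through a time integral. -/
lemma exists_smooth_center {v : ℝ → Plane} (hv : Integrable v) (c₀ : Plane) {δ : ℝ} (hδ : 0 < δ) :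
    ∃ γ : ℝ → Plane, ContDiff ℝ ∞ γ ∧ γ 0 = c₀ ∧ Integrable (deriv γ) ∧
      ∫ s, ‖deriv γ s - v s‖ ≤ δ ∧
      ∀ t, 0 ≤ t → ‖γ t - (c₀ + ∫ s in (0 : ℝ)..t, v s)‖ ≤ δ := by
  obtain ⟨g, hgc, hg, hgv⟩ := MemLp.exist_eLpNorm_sub_le ENNReal.one_ne_top le_rfl
    (memLp_one_iff_integrable.2 hv) hδ
  have hgi : Integrable g := hg.continuous.integrable_of_hasCompactSupport hgc
  have hd : ∀ t, HasDerivAt (fun t => c₀ + ∫ s in (0 : ℝ)..t, g s) (g t) t := fun t =>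
    (intervalIntegral.integral_hasDerivAt_right (hg.continuous.intervalIntegrable _ _)
      hg.continuous.aestronglyMeasurable.stronglyMeasurableAtFilter
      hg.continuous.continuousAt).const_add c₀
  have hd' : deriv (fun t => c₀ + ∫ s in (0 : ℝ)..t, g s) = g := funext fun t => (hd t).deriv
  have hle : ∫ s, ‖g s - v s‖ ≤ δ := by
    have e := integral_norm_eq_lintegral_enorm (hgi.sub hv).aestronglyMeasurable
    simp only [Pi.sub_apply] at e
    rw [e]
    refine ENNReal.toReal_le_of_le_ofReal hδ.le ?_
    rw [eLpNorm_one_eq_lintegral_enorm] at hgv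
    refine le_trans (le_of_eq (lintegral_congr fun s => ?_)) hgv
    rw [Pi.sub_apply, ← enorm_neg, neg_sub]
  refine ⟨fun t => c₀ + ∫ s in (0 : ℝ)..t, g s, ?_, by simp, ?_, ?_, fun t ht => ?_⟩
  · rw [contDiff_infty_iff_deriv, hd']
    exact ⟨fun t => (hd t).differentiableAt, hg⟩
  · rw [hd']; exact hgi
  · rw [hd']; exact hle
  · rw [add_sub_add_left_eq_sub, ← intervalIntegral.integral_sub hgi.intervalIntegrable
      hv.intervalIntegrable]
    refine (intervalIntegral.norm_integral_le_integral_norm ht).trans ?_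
    rw [intervalIntegral.integral_of_le ht]
    exact (setIntegral_le_integral (hgi.sub hv).norm (ae_of_all _ fun s => norm_nonneg _)).trans hle

section RadialForm

variable {α N A T : ℝ} {F : ℝ → Plane → Plane} {ν : ProbabilityTheory.Kernel ℝ Plane}

lemma IsWeakFlow.isFiniteMeasure (h : IsWeakFlow α N A T F ν) {t : ℝ} (ht : t ∈ Icc 0 T) :
    IsFiniteMeasure (ν t) := by
  obtain ⟨C, hC⟩ := h.mass_le
  exact ⟨(hC t ht).trans_lt ENNReal.ofReal_lt_top⟩

lemma IsWeakFlow.exists_mass_le (h : IsWeakFlow α N A T F ν) :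
    ∃ m : ℝ, 0 < m ∧ ∀ t ∈ Icc 0 T, (ν t).real univ ≤ m := by
  obtain ⟨C, hC⟩ := h.mass_le
  refine ⟨max C 1, by positivity, fun t ht => ?_⟩
  refine ENNReal.toReal_le_of_le_ofReal (by positivity) ((hC t ht).trans ?_)
  exact ENNReal.ofReal_le_ofReal (le_max_left _ _)

lemma IsWeakFlow.exists_norm_drift_le (h : IsWeakFlow α N A T F ν) (hα : α ∈ Ioo (0 : ℝ) 1)
    (hN : 0 < N) : ∃ U : ℝ, 0 < U ∧ ∀ t ∈ Icc 0 T, ∀ x, ‖vel α (ν t) x + F t x‖ ≤ U := by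
  obtain ⟨m, hm0, hm⟩ := h.exists_mass_le
  refine ⟨max 1 (|kernelConst α| * ((ballRiesz (1 + α) + 1) *
    (N ^ ((1 + α) / 2) * m ^ (1 - (1 + α) / 2))) + A), by positivity, fun t ht x => ?_⟩
  have := h.isFiniteMeasure ht
  refine le_max_of_le_right ((norm_add_le _ _).trans (add_le_add ?_ (h.norm_field_le t ht x)))
  exact norm_vel_le hα (h.le_volume t ht) hN hm0 (hm t ht) x

lemma exp_neg_mul_mem_Ioc {lam s : ℝ} (hs : s ∈ Icc 0 T) :
    Real.exp (-(lam * s)) ∈ Ioc 0 (Real.exp (|lam| * T)) := by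
  refine ⟨Real.exp_pos _, Real.exp_le_exp.2 ?_⟩
  have h1 : -lam ≤ |lam| := neg_le_abs lam
  have h2 := abs_nonneg lam
  nlinarith [hs.1, hs.2]

lemma abs_integral_sub_le_of_abs_le {μ : Measure Plane} [IsFiniteMeasure μ] {f g : Plane → ℝ}
    (hf : Integrable f μ) (hg : Integrable g μ) {C m : ℝ} (hC : 0 ≤ C)
    (h : ∀ x, |f x - g x| ≤ C) (hm : μ.real univ ≤ m) : |∫ x, f x ∂μ - ∫ x, g x ∂μ| ≤ C * m := by
  rw [← integral_sub hf hg]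
  refine (norm_integral_le_of_norm_le_const (f := fun x => f x - g x) (ae_of_all _ h)).trans ?_
  exact mul_le_mul_of_nonneg_left hm hC

lemma aestronglyMeasurable_flux [ProbabilityTheory.IsSFiniteKernel ν]
    (hF : Measurable (Function.uncurry F)) {H : ℝ → ℝ}
    (hH : Continuous (deriv H)) (lam τ s : ℝ) (c v : Plane) :
    AEStronglyMeasurable (flux H lam τ c v fun x => vel α (ν s) x + F s x) (ν s) := by
  have h1 : Measurable fun x => vel α (ν s) x := (stronglyMeasurable_vel α (ν s)).measurable
  have h2 : Measurable (F s) := hF.of_uncurry_left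
  refine Measurable.aestronglyMeasurable ?_
  have hz : Measurable fun x : Plane => x - c := measurable_id.sub_const c
  exact ((hH.measurable.comp ((hz.norm.pow_const 2).const_mul _)).const_mul _).mul
    ((((h1.add h2).sub_const v).inner hz).sub ((hz.norm.pow_const 2).const_mul lam))

/-- The total rate of change of `∫ H(τ² |x - c|²) dν`, with `τ = exp(-lam s)`. -/
def totalFlux (α : ℝ) (F : ℝ → Plane → Plane) (ν : ProbabilityTheory.Kernel ℝ Plane) (H : ℝ → ℝ)
    (lam : ℝ) (c v : ℝ → Plane) (s : ℝ) : ℝ :=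
  ∫ x, flux H lam (Real.exp (-(lam * s))) (c s) (v s) (fun x => vel α (ν s) x + F s x) x ∂ν s

/-- The weak formulation for `H(τ² |x - c|²)`, with `H` vanishing at infinity, `τ = exp(-lam t)`
and a centre `c` with bounded velocity. -/
lemma IsWeakFlow.radial_of_vanishing [ProbabilityTheory.IsSFiniteKernel ν]
    (h : IsWeakFlow α N A T F ν) (hα : α ∈ Ioo (0 : ℝ) 1) (hN : 0 < N) {H : ℝ → ℝ}
    (hH : ContDiff ℝ ∞ H) (lam : ℝ) {s₀ : ℝ} (hs₀ : ∀ s, s₀ ≤ s → H s = 0) {c v : ℝ → Plane}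
    (hvm : Measurable v) (hvi : Integrable v) {V : ℝ} (hV : ∀ s, ‖v s‖ ≤ V)
    (hc : ∀ t ∈ Icc 0 T, c t = c 0 + ∫ s in (0 : ℝ)..t, v s) {t : ℝ} (ht : t ∈ Icc 0 T) :
    (∫ x, H (Real.exp (-(lam * t)) ^ 2 * ‖x - c t‖ ^ 2) ∂ν t) -
      ∫ x, H (‖x - c 0‖ ^ 2) ∂ν 0 =
      ∫ s in (0 : ℝ)..t, totalFlux α F ν H lam c v s := by
  -- Off `[0, T]` nothing is known about `c`; replacing it by the primitive of `v` makes it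
  -- continuous, hence measurable, everywhere.
  wlog hcd : ∀ t, c t = c 0 + ∫ s in (0 : ℝ)..t, v s generalizing c
  · have h' := this (c := fun t => c 0 + ∫ s in (0 : ℝ)..t, v s) (by simp) (by simp)
    simp only [intervalIntegral.integral_same, add_zero, ← hc t ht] at h'
    rw [h']
    refine intervalIntegral.integral_congr fun s hs => ?_
    rw [uIcc_of_le ht.1] at hs
    simp only [totalFlux, hc s ⟨hs.1, hs.2.trans ht.2⟩]
  have hT : 0 ≤ T := ht.1.trans ht.2
  have hcm : Measurable c := by
    have : Continuous c := by
      rw [funext hcd]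
      exact continuous_const.add (intervalIntegral.continuous_primitive
        (fun a b => hvi.intervalIntegrable) 0)
    exact this.measurable
  have hHd : Continuous (deriv H) := hH.continuous_deriv (by simp)
  obtain ⟨U, hU0, hU⟩ := h.exists_norm_drift_le hα hN
  obtain ⟨m, hm0, hm⟩ := h.exists_mass_le
  have hV0 : 0 ≤ V := (norm_nonneg _).trans (hV 0)
  obtain ⟨C, hC0, hC⟩ := exists_flux_bounds hH hs₀ lam hU0.le hV0
    (Real.exp_pos (|lam| * T)).le
  have hfi : ∀ s ∈ Icc 0 T, ∀ c v : Plane, Integrable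
      (flux H lam (Real.exp (-(lam * s))) c v fun x => vel α (ν s) x + F s x) (ν s) := by
    intro s hs c v
    have := h.isFiniteMeasure hs
    obtain ⟨C', -, hC'⟩ := exists_flux_bounds hH hs₀ lam hU0.le (norm_nonneg v)
      (Real.exp_pos (|lam| * T)).le
    refine Integrable.of_bound (C := C')
      (aestronglyMeasurable_flux h.measurable_field hHd _ _ _ _ _)
      (ae_of_all _ fun x => ?_)
    exact (hC' _ (exp_neg_mul_mem_Ioc hs) c v (fun x => vel α (ν s) x + F s x) x (hU s hs x)
      le_rfl).1
  have hΦb : ∀ s ∈ Icc 0 T, ‖totalFlux α F ν H lam c v s‖ ≤ C * m := by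
    intro s hs
    have := h.isFiniteMeasure hs
    have hb : ∀ x, ‖flux H lam (Real.exp (-(lam * s))) (c s) (v s)
        (fun x => vel α (ν s) x + F s x) x‖ ≤ C := fun x =>
      (hC _ (exp_neg_mul_mem_Ioc hs) (c s) (v s) (fun x => vel α (ν s) x + F s x) x (hU s hs x)
        (hV s)).1
    refine (norm_integral_le_of_norm_le_const (ae_of_all _ hb)).trans ?_
    exact mul_le_mul_of_nonneg_left (hm s hs) hC0
  have hΦi : IntervalIntegrable (totalFlux α F ν H lam c v) volume 0 t := by
    rw [intervalIntegrable_iff_integrableOn_Icc_of_le ht.1]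
    refine Measure.integrableOn_of_bounded (M := C * m) (by simp)
      (measurable_integral_flux h.measurable_field hHd lam hcm hvm).aestronglyMeasurable ?_
    filter_upwards [ae_restrict_mem measurableSet_Icc] with s hs
    exact hΦb s ⟨hs.1, hs.2.trans ht.2⟩
  have hHi : ∀ s ∈ Icc 0 T, ∀ (τ : ℝ) (c : Plane), τ ≠ 0 →
      Integrable (fun x => H (τ ^ 2 * ‖x - c‖ ^ 2)) (ν s) := by
    intro s hs τ c hτ
    have := h.isFiniteMeasure hs
    have hcont : Continuous fun x : Plane => H (τ ^ 2 * ‖x - c‖ ^ 2) := by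
      have := hH.continuous
      fun_prop
    obtain ⟨K, hK⟩ := (isCompact_Icc (a := (0 : ℝ)) (b := |s₀|)).exists_bound_of_continuousOn
      hH.continuous.continuousOn
    refine Integrable.of_bound (C := max K 0) hcont.aestronglyMeasurable (ae_of_all _ fun x => ?_)
    by_cases hx : τ ^ 2 * ‖x - c‖ ^ 2 ≤ |s₀|
    · exact le_max_of_le_left (hK _ ⟨by positivity, hx⟩)
    · rw [hs₀ _ ((le_abs_self s₀).trans (le_of_not_ge hx)), norm_zero]
      exact le_max_right _ _
  -- The identity holds for the smooth centre `γ`; replacing `γ` by `c` changes the two sides by at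
  -- most `K * δ ≤ η` in total.
  refine eq_of_abs_sub_le_all fun η hη => ?_
  set K := C * m + (C * m * T + C * m) with hK
  have hK0 : 0 ≤ K := by positivity
  obtain ⟨γ, hγ, hγ0, hγi, hγv, hγc⟩ := exists_smooth_center hvi (c 0)
    (δ := η / (K + 1)) (by positivity)
  set δ := η / (K + 1) with hδ
  have hδ0 : 0 < δ := by positivity
  have hγc' : ∀ s ∈ Icc 0 T, ‖γ s - c s‖ ≤ δ := fun s hs => by
    rw [hcd s]; exact hγc s hs.1
  have hw := h.radial_smooth hH hγ lam hs₀ ht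
  rw [hγ0] at hw
  have hγd : Continuous (deriv γ) := hγ.continuous_deriv (by simp)
  have e1 : |(∫ x, H (Real.exp (-(lam * t)) ^ 2 * ‖x - γ t‖ ^ 2) ∂ν t) -
      ∫ x, H (Real.exp (-(lam * t)) ^ 2 * ‖x - c t‖ ^ 2) ∂ν t| ≤ C * m * δ := by
    have := h.isFiniteMeasure ht
    refine (abs_integral_sub_le_of_abs_le (hHi t ht _ _ (Real.exp_pos _).ne')
      (hHi t ht _ _ (Real.exp_pos _).ne') (C := C * δ) (by positivity) (fun x => ?_)
      (hm t ht)).trans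
      (le_of_eq (by ring))
    exact (((hC _ (exp_neg_mul_mem_Ioc ht) (c t) (v t) (fun x => vel α (ν t) x + F t x) x
      (hU t ht x) (hV t)).2 (γ t)
      (v t)).2).trans (mul_le_mul_of_nonneg_left (hγc' t ht) hC0)
  have hpt : ∀ s ∈ Icc 0 T, ‖totalFlux α F ν H lam γ (deriv γ) s - totalFlux α F ν H lam c v s‖ ≤
      C * m * (δ + ‖deriv γ s - v s‖) := by
    intro s hs
    have := h.isFiniteMeasure hs
    refine (abs_integral_sub_le_of_abs_le (hfi s hs _ _) (hfi s hs _ _)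
      (C := C * (δ + ‖deriv γ s - v s‖)) (by positivity) (fun x => ?_) (hm s hs)).trans
      (le_of_eq (by ring))
    refine (((hC _ (exp_neg_mul_mem_Ioc hs) (c s) (v s) (fun x => vel α (ν s) x + F s x) x
      (hU s hs x) (hV s)).2 (γ s)
      (deriv γ s)).1).trans (mul_le_mul_of_nonneg_left ?_ hC0)
    linarith [hγc' s hs]
  have hni : IntervalIntegrable (fun s => ‖deriv γ s - v s‖) volume 0 t :=
    (hγi.sub hvi).norm.intervalIntegrable
  have hri : IntervalIntegrable (fun s => C * m * (δ + ‖deriv γ s - v s‖)) volume 0 t :=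
    (intervalIntegrable_const.add hni).const_mul _
  -- Obtained from the difference with the flux for `c`, which has the integrable majorant of `hpt`.
  have hΦγi : IntervalIntegrable (totalFlux α F ν H lam γ (deriv γ)) volume 0 t := by
    have hd : IntervalIntegrable (fun s => totalFlux α F ν H lam γ (deriv γ) s -
        totalFlux α F ν H lam c v s) volume 0 t := by
      refine hri.mono_fun' ?_ ?_
      · exact ((measurable_integral_flux h.measurable_field hHd lam hγ.continuous.measurable
          hγd.measurable).sub
          (measurable_integral_flux h.measurable_field hHd lam hcm hvm)).aestronglyMeasurable
      · filter_upwards [ae_restrict_mem measurableSet_uIoc] with s hs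
        rw [uIoc_of_le ht.1] at hs
        exact hpt s ⟨hs.1.le, hs.2.trans ht.2⟩
    simpa using hd.add hΦi
  have e2 : |(∫ s in (0 : ℝ)..t, totalFlux α F ν H lam γ (deriv γ) s) -
      ∫ s in (0 : ℝ)..t, totalFlux α F ν H lam c v s| ≤
      (C * m * T + C * m) * δ := by
    rw [← intervalIntegral.integral_sub hΦγi hΦi, ← Real.norm_eq_abs]
    refine (intervalIntegral.norm_integral_le_of_norm_le ht.1 ?_ hri).trans ?_
    · refine ae_of_all _ fun s hs => hpt s ⟨hs.1.le, hs.2.trans ht.2⟩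
    · rw [intervalIntegral.integral_const_mul, intervalIntegral.integral_add
        intervalIntegrable_const hni,
        intervalIntegral.integral_const, sub_zero, smul_eq_mul]
      have h1 : ∫ s in (0 : ℝ)..t, ‖deriv γ s - v s‖ ≤ δ := by
        rw [intervalIntegral.integral_of_le ht.1]
        exact (setIntegral_le_integral (hγi.sub hvi).norm
          (ae_of_all _ fun s => norm_nonneg _)).trans hγv
      have h2 : t * δ ≤ T * δ := mul_le_mul_of_nonneg_right ht.2 hδ0.le
      calc C * m * (t * δ + ∫ s in (0 : ℝ)..t, ‖deriv γ s - v s‖) ≤ C * m * (T * δ + δ) :=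
            mul_le_mul_of_nonneg_left (add_le_add h2 h1) (by positivity)
        _ = _ := by ring
  have e3 : K * δ ≤ η := by
    rw [hδ, mul_div_assoc', div_le_iff₀ (by positivity)]
    nlinarith
  have hw' : (∫ x, H (Real.exp (-(lam * t)) ^ 2 * ‖x - γ t‖ ^ 2) ∂ν t) -
      ∫ x, H (‖x - c 0‖ ^ 2) ∂ν 0 = ∫ s in (0 : ℝ)..t, totalFlux α F ν H lam γ (deriv γ) s := hw
  have e1' := abs_le.1 e1
  have e2' := abs_le.1 e2
  have e4 : C * m * δ + (C * m * T + C * m) * δ ≤ η := by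
    refine le_trans (le_of_eq ?_) e3
    rw [hK]; ring
  change |_ - ∫ s in (0 : ℝ)..t, totalFlux α F ν H lam c v s| ≤ η
  rw [abs_le]
  constructor <;> linarith [e1'.1, e1'.2, e2'.1, e2'.2]

end RadialForm

/-- No integrability is required: a non-integrable `f` has integral zero, and `κ * t ≥ 0`. -/
lemma intervalIntegral_le_of_le {f : ℝ → ℝ} {t κ : ℝ} (ht : 0 ≤ t) (hκ : 0 ≤ κ)
    (hf : ∀ s ∈ Icc 0 t, f s ≤ κ) : ∫ s in (0 : ℝ)..t, f s ≤ κ * t := by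
  by_cases hi : IntervalIntegrable f volume 0 t
  · refine (intervalIntegral.integral_mono_on ht hi intervalIntegrable_const hf).trans ?_
    simp [mul_comm]
  · rw [intervalIntegral.integral_undef hi]
    positivity

/-! ### Growing and shrinking disks: conservation of mass and bounded supports -/

section Propagation

variable {α N A T : ℝ} {F : ℝ → Plane → Plane} {ν : ProbabilityTheory.Kernel ℝ Plane}

lemma contDiff_one_sub_step (r : ℝ) : ContDiff ℝ ∞ fun s => 1 - step r s :=
  contDiff_const.sub (contDiff_step r)

lemma deriv_one_sub_step (r s : ℝ) : deriv (fun s => 1 - step r s) s = -deriv (step r) s := by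
  simp [deriv_const_sub]

lemma integrable_one_sub_step (μ : Measure Plane) [IsFiniteMeasure μ] (r τ : ℝ) (c : Plane) :
    Integrable (fun x => 1 - step r (τ ^ 2 * ‖x - c‖ ^ 2)) μ := by
  have hc : Continuous fun x : Plane => 1 - step r (τ ^ 2 * ‖x - c‖ ^ 2) := by
    have := (contDiff_step r).continuous
    fun_prop
  refine Integrable.of_bound (C := 1) hc.aestronglyMeasurable (ae_of_all _ fun x => ?_)
  rw [Real.norm_eq_abs, abs_le]
  constructor <;> linarith [step_nonneg r (τ ^ 2 * ‖x - c‖ ^ 2),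
    step_le_one r (τ ^ 2 * ‖x - c‖ ^ 2)]

/-- The weak formulation for a smoothed indicator function of a disk with fixed centre. -/
lemma IsWeakFlow.disk [ProbabilityTheory.IsSFiniteKernel ν] (h : IsWeakFlow α N A T F ν)
    (hα : α ∈ Ioo (0 : ℝ) 1) (hN : 0 < N) {r : ℝ} (hr : 0 < r) (lam : ℝ) (z : Plane)
    {t : ℝ} (ht : t ∈ Icc 0 T) :
    (∫ x, (1 - step r (Real.exp (-(lam * t)) ^ 2 * ‖x - z‖ ^ 2)) ∂ν t) -
      ∫ x, (1 - step r (‖x - z‖ ^ 2)) ∂ν 0 =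
      ∫ s in (0 : ℝ)..t, totalFlux α F ν (fun s => 1 - step r s) lam (fun _ => z) 0 s :=
  h.radial_of_vanishing hα hN (contDiff_one_sub_step r) lam (s₀ := 2 * r ^ 2)
    (fun s hs => by rw [step_eq_one hr hs, sub_self]) (c := fun _ => z) (v := 0)
    measurable_zero (integrable_zero _ _ _) (V := 0) (by simp) (by simp) ht

/-- The disk `τ ‖x - c‖ < r` grows at the rate `lam ‖x - c‖` when `τ = exp (-lam t)`. If particles
at and beyond its edge move outwards no faster than that, it loses no mass. -/
lemma flux_one_sub_step_nonneg {r lam τ : ℝ} (hr : 0 < r) (hτ : 0 < τ) {c : Plane}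
    {u : Plane → Plane} {x : Plane}
    (h : r ≤ τ * ‖x - c‖ → inner ℝ (u x) (x - c) ≤ lam * ‖x - c‖ ^ 2) :
    0 ≤ flux (fun s => 1 - step r s) lam τ c 0 u x := by
  rw [flux, deriv_one_sub_step]
  by_cases hx : r ≤ τ * ‖x - c‖
  · have h1 := deriv_step_nonneg hr (τ ^ 2 * ‖x - c‖ ^ 2)
    have h2 := h hx
    rw [sub_zero]
    have : 0 ≤ 2 * τ ^ 2 * deriv (step r) (τ ^ 2 * ‖x - c‖ ^ 2) := by positivity
    nlinarith
  · rw [deriv_step_eq_zero hr]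
    · simp
    · rw [← mul_pow]
      exact pow_lt_pow_left₀ (not_le.1 hx) (by positivity) two_ne_zero

lemma flux_one_sub_step_nonpos {r lam τ : ℝ} (hr : 0 < r) (hτ : 0 < τ) {c : Plane}
    {u : Plane → Plane} {x : Plane}
    (h : r ≤ τ * ‖x - c‖ → lam * ‖x - c‖ ^ 2 ≤ inner ℝ (u x) (x - c)) :
    flux (fun s => 1 - step r s) lam τ c 0 u x ≤ 0 := by
  rw [flux, deriv_one_sub_step]
  by_cases hx : r ≤ τ * ‖x - c‖
  · have h1 := deriv_step_nonneg hr (τ ^ 2 * ‖x - c‖ ^ 2)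
    have h2 := h hx
    rw [sub_zero]
    have : 0 ≤ 2 * τ ^ 2 * deriv (step r) (τ ^ 2 * ‖x - c‖ ^ 2) := by positivity
    nlinarith
  · rw [deriv_step_eq_zero hr]
    · simp
    · rw [← mul_pow]
      exact pow_lt_pow_left₀ (not_le.1 hx) (by positivity) two_ne_zero

/-- Compactly supported test functions do not by themselves exclude mass arriving from infinity. It
is excluded by disks that shrink faster than the drift (`lam = -U`): they gain no mass, and at time
`t` they still contain any prescribed ball. -/
lemma IsWeakFlow.mass_le_one [ProbabilityTheory.IsSFiniteKernel ν] (h : IsWeakFlow α N A T F ν)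
    (hα : α ∈ Ioo (0 : ℝ) 1) (hN : 0 < N) (h0 : IsProbabilityMeasure (ν 0)) {t : ℝ}
    (ht : t ∈ Icc 0 T) : ν t univ ≤ 1 := by
  obtain ⟨U, hU0, hU⟩ := h.exists_norm_drift_le hα hN
  have := h.isFiniteMeasure ht
  have hball : ∀ n : ℕ, ν t (Metric.closedBall (0 : Plane) n) ≤ 1 := by
    intro n
    -- The `+ 1` keeps the edge of the disk at distance at least 1 from the origin up to time `T`,
    -- where its speed `U * ‖x‖` dominates the drift bound `U`.
    set r : ℝ := Real.exp (U * T) * (n + 1) with hr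
    have hr0 : 0 < r := by positivity
    have hd := h.disk hα hN hr0 (-U) 0 ht
    have hneg : ∫ s in (0 : ℝ)..t, totalFlux α F ν (fun s => 1 - step r s) (-U) (fun _ => 0) 0 s
        ≤ 0 * t := by
      refine intervalIntegral_le_of_le ht.1 le_rfl fun s hs => integral_nonpos fun x => ?_
      have hs' : s ∈ Icc 0 T := ⟨hs.1, hs.2.trans ht.2⟩
      refine flux_one_sub_step_nonpos hr0 (Real.exp_pos _) fun hx => ?_
      have h1 : 1 ≤ ‖x - 0‖ := by
        have h2 : Real.exp (-(-U * s)) ≤ Real.exp (U * T) :=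
          Real.exp_le_exp.2 (by nlinarith [hs'.2])
        have h3 : Real.exp (U * T) * 1 ≤ Real.exp (U * T) * ‖x - 0‖ :=
          calc Real.exp (U * T) * 1 ≤ r := by
                rw [hr]; gcongr; linarith [n.cast_nonneg (α := ℝ)]
            _ ≤ _ := hx
            _ ≤ _ := by gcongr
        exact le_of_mul_le_mul_left h3 (Real.exp_pos _)
      have h4 := abs_le.1 (abs_real_inner_le_norm (vel α (ν s) x + F s x) (x - 0))
      have h5 : ‖vel α (ν s) x + F s x‖ * ‖x - 0‖ ≤ U * ‖x - 0‖ ^ 2 := by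
        have := hU s hs' x
        nlinarith [norm_nonneg (x - 0), norm_nonneg (vel α (ν s) x + F s x)]
      linarith [h4.1]
    have h0' : ∫ x, (1 - step r (‖x - 0‖ ^ 2)) ∂ν 0 ≤ 1 := by
      have hi := integrable_one_sub_step (ν 0) r 1 0
      simp only [one_pow, one_mul] at hi
      refine (integral_mono hi (integrable_const (1 : ℝ)) fun x => ?_).trans (by simp)
      simp only
      linarith [step_nonneg r (‖x - 0‖ ^ 2)]
    have h1 : (ν t).real (Metric.closedBall (0 : Plane) n) ≤
        ∫ x, (1 - step r (Real.exp (-(-U * t)) ^ 2 * ‖x - 0‖ ^ 2)) ∂ν t := by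
      rw [← integral_indicator_one Metric.isClosed_closedBall.measurableSet]
      refine integral_mono ((integrable_const (1 : ℝ)).indicator
        Metric.isClosed_closedBall.measurableSet) (integrable_one_sub_step _ _ _ _) fun x => ?_
      by_cases hx : x ∈ Metric.closedBall (0 : Plane) n
      · rw [indicator_of_mem hx]
        have hx' : ‖x - 0‖ ≤ n := by simpa using hx
        have h2 : Real.exp (-(-U * t)) ≤ Real.exp (U * T) :=
          Real.exp_le_exp.2 (by nlinarith [ht.2])
        rw [step_eq_zero hr0]
        · simp
        · rw [← mul_pow]
          refine pow_le_pow_left₀ (by positivity) ?_ 2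
          rw [hr]
          exact mul_le_mul h2 (by linarith) (norm_nonneg _) (Real.exp_pos _).le
      · rw [indicator_of_notMem hx]
        simp only
        linarith [step_le_one r (Real.exp (-(-U * t)) ^ 2 * ‖x - 0‖ ^ 2)]
    have h2 : (ν t).real (Metric.closedBall (0 : Plane) n) ≤ 1 := by linarith
    rw [← ENNReal.ofReal_one]
    exact (ENNReal.le_ofReal_iff_toReal_le (measure_ne_top _ _) zero_le_one).2 h2
  have hlim := tendsto_measure_iUnion_atTop (μ := ν t)
    (s := fun n : ℕ => Metric.closedBall (0 : Plane) n)
    (fun a b hab => Metric.closedBall_subset_closedBall (by exact_mod_cast hab))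
  rw [Metric.iUnion_closedBall_nat] at hlim
  exact le_of_tendsto' hlim hball

/-- Mass conservation and finite speed of propagation. -/
lemma IsWeakFlow.exists_support [ProbabilityTheory.IsSFiniteKernel ν]
    (h : IsWeakFlow α N A T F ν)
    (hα : α ∈ Ioo (0 : ℝ) 1) (hN : 0 < N) (h0 : IsProbabilityMeasure (ν 0)) {r₀ : ℝ}
    (hr₀ : ∀ᵐ x ∂ν 0, ‖x‖ ≤ r₀) :
    ∃ ρ : ℝ, ∀ t ∈ Icc 0 T, IsProbabilityMeasure (ν t) ∧ ∀ᵐ x ∂ν t, ‖x‖ ≤ ρ := by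
  obtain ⟨U, hU0, hU⟩ := h.exists_norm_drift_le hα hN
  set r : ℝ := max r₀ 1 with hr
  have hr1 : 1 ≤ r := le_max_right _ _
  have hr0 : 0 < r := by linarith
  refine ⟨2 * r * Real.exp (U * T), fun t ht => ?_⟩
  have := h.isFiniteMeasure ht
  set S := Metric.closedBall (0 : Plane) (2 * r * Real.exp (U * T)) with hS
  have hSm : MeasurableSet S := Metric.isClosed_closedBall.measurableSet
  -- A disk growing at the rate `U ‖x‖`, at least the drift bound since `r ≥ 1`, keeps all its
  -- initial mass. As the total mass is at most 1, nothing is left outside.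
  have hd := h.disk hα hN hr0 U 0 ht
  have hpos : 0 ≤ ∫ s in (0 : ℝ)..t,
      totalFlux α F ν (fun s => 1 - step r s) U (fun _ => 0) 0 s := by
    refine intervalIntegral.integral_nonneg ht.1 fun s hs => integral_nonneg fun x => ?_
    have hs' : s ∈ Icc 0 T := ⟨hs.1, hs.2.trans ht.2⟩
    refine flux_one_sub_step_nonneg hr0 (Real.exp_pos _) fun hx => ?_
    have h2 : Real.exp (-(U * s)) ≤ 1 := Real.exp_le_one_iff.2 (by nlinarith [hs'.1])
    have h1 : 1 ≤ ‖x - 0‖ := by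
      have : r ≤ 1 * ‖x - 0‖ := hx.trans (by gcongr)
      linarith
    refine (real_inner_le_norm _ _).trans ?_
    change ‖vel α (ν s) x + F s x‖ * ‖x - 0‖ ≤ U * ‖x - 0‖ ^ 2
    exact (mul_le_mul_of_nonneg_right (hU s hs' x) (norm_nonneg _)).trans
      (mul_le_mul_of_nonneg_left (by nlinarith) hU0.le)
  have h0' : ∫ x, (1 - step r (‖x - 0‖ ^ 2)) ∂ν 0 = 1 := by
    have : (fun x => 1 - step r (‖x - 0‖ ^ 2)) =ᵐ[ν 0] fun _ => (1 : ℝ) := by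
      filter_upwards [hr₀] with x hx
      rw [step_eq_zero hr0, sub_zero]
      refine pow_le_pow_left₀ (norm_nonneg _) ?_ 2
      rw [sub_zero]
      exact hx.trans (le_max_left _ _)
    rw [integral_congr_ae this]; simp
  have h1 : ∫ x, (1 - step r (Real.exp (-(U * t)) ^ 2 * ‖x - 0‖ ^ 2)) ∂ν t ≤ (ν t).real S := by
    rw [← integral_indicator_one hSm]
    refine integral_mono (integrable_one_sub_step _ _ _ _)
      ((integrable_const (1 : ℝ)).indicator hSm) fun x => ?_
    by_cases hx : x ∈ S
    · rw [indicator_of_mem hx]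
      simp only [Pi.one_apply]
      linarith [step_nonneg r (Real.exp (-(U * t)) ^ 2 * ‖x - 0‖ ^ 2)]
    · rw [indicator_of_notMem hx]
      have hx' : 2 * r * Real.exp (U * T) < ‖x - 0‖ := by simpa [hS] using hx
      have h2 : Real.exp (-(U * T)) ≤ Real.exp (-(U * t)) :=
        Real.exp_le_exp.2 (by nlinarith [ht.2])
      have h3 : 2 * r ≤ Real.exp (-(U * t)) * ‖x - 0‖ :=
        calc 2 * r = Real.exp (-(U * T)) * (2 * r * Real.exp (U * T)) := by
              rw [Real.exp_neg]; field_simp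
          _ ≤ _ := mul_le_mul h2 hx'.le (by positivity) (Real.exp_pos _).le
      rw [step_eq_one hr0, sub_self]
      rw [← mul_pow]
      nlinarith
  have h2 : 1 ≤ (ν t).real S := by linarith
  have hle := h.mass_le_one hα hN h0 ht
  have hS1 : 1 ≤ ν t S := by
    rw [← ENNReal.ofReal_one]
    exact ENNReal.ofReal_le_of_le_toReal h2
  have hu : ν t univ = 1 := le_antisymm hle (hS1.trans (measure_mono (subset_univ _)))
  have hSc : ν t Sᶜ = 0 := by
    rw [measure_compl hSm (measure_ne_top _ _), hu, tsub_eq_zero_iff_le]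
    exact hS1
  refine ⟨⟨hu⟩, ?_⟩
  rw [ae_iff]
  convert hSc using 2
  ext x
  simp [hS]

end Propagation

/-! ### Radial test functions without decay -/

section Radial

variable {α N A T : ℝ} {F : ℝ → Plane → Plane} {ν : ProbabilityTheory.Kernel ℝ Plane}

/-- The weak formulation for `H(τ² |x - c|²)` with an arbitrary smooth `H`. -/
lemma IsWeakFlow.radial [ProbabilityTheory.IsSFiniteKernel ν]
    (h : IsWeakFlow α N A T F ν) (hα : α ∈ Ioo (0 : ℝ) 1) (hN : 0 < N) {ρ : ℝ}
    (hρ : ∀ t ∈ Icc 0 T, ∀ᵐ x ∂ν t, ‖x‖ ≤ ρ) {H : ℝ → ℝ}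
    (hH : ContDiff ℝ ∞ H) (lam : ℝ) {c v : ℝ → Plane}
    (hvm : Measurable v) (hvi : Integrable v) {V : ℝ} (hV : ∀ s, ‖v s‖ ≤ V)
    (hc : ∀ t ∈ Icc 0 T, c t = c 0 + ∫ s in (0 : ℝ)..t, v s) {t : ℝ} (ht : t ∈ Icc 0 T) :
    (∫ x, H (Real.exp (-(lam * t)) ^ 2 * ‖x - c t‖ ^ 2) ∂ν t) -
      ∫ x, H (‖x - c 0‖ ^ 2) ∂ν 0 =
      ∫ s in (0 : ℝ)..t, totalFlux α F ν H lam c v s := by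
  have hT : 0 ≤ T := ht.1.trans ht.2
  have hV0 : 0 ≤ V := (norm_nonneg _).trans (hV 0)
  have hcb : ∀ s ∈ Icc 0 T, ‖c s‖ ≤ ‖c 0‖ + V * T := by
    intro s hs
    rw [hc s hs]
    refine (norm_add_le _ _).trans (add_le_add_right ?_ _)
    refine (intervalIntegral.norm_integral_le_of_norm_le_const (C := V) fun x _ => hV x).trans ?_
    rw [sub_zero, abs_of_nonneg hs.1]
    exact mul_le_mul_of_nonneg_left hs.2 hV0
  set s₁ := Real.exp (|lam| * T) ^ 2 * (ρ + (‖c 0‖ + V * T)) ^ 2 with hs₁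
  have harg : ∀ s ∈ Icc 0 T, ∀ᵐ x ∂ν s, Real.exp (-(lam * s)) ^ 2 * ‖x - c s‖ ^ 2 ≤ s₁ := by
    intro s hs
    filter_upwards [hρ s hs] with x hx
    have h1 : ‖x - c s‖ ≤ ρ + (‖c 0‖ + V * T) :=
      (norm_sub_le _ _).trans (add_le_add hx (hcb s hs))
    have h2 := exp_neg_mul_mem_Ioc (lam := lam) hs
    exact mul_le_mul (pow_le_pow_left₀ h2.1.le h2.2 2) (pow_le_pow_left₀ (norm_nonneg _) h1 2)
      (by positivity) (by positivity)
  -- The supports are uniformly bounded, so the arguments of `H` never exceed `s₁`. Truncating `H`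
  -- beyond `s₁ + 1` changes neither the integrals nor the fluxes.
  set G : ℝ → ℝ := fun s => H s * (1 - Real.smoothTransition (s - s₁ - 1)) with hG
  have hGs : ContDiff ℝ ∞ G := hH.mul (contDiff_const.sub
    ((Real.smoothTransition.contDiff (n := ⊤)).comp
      ((contDiff_id.sub contDiff_const).sub contDiff_const)))
  have hGH : ∀ s, s < s₁ + 1 → G s = H s := by
    intro s hs
    simp only [hG]
    rw [Real.smoothTransition.zero_of_nonpos (by linarith), sub_zero, mul_one]
  have hGd : ∀ s, s ≤ s₁ → deriv G s = deriv H s := by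
    intro s hs
    refine Filter.EventuallyEq.deriv_eq ?_
    filter_upwards [Iio_mem_nhds (show s < s₁ + 1 by linarith)] with x hx using hGH x hx
  have hG0 : ∀ s, s₁ + 2 ≤ s → G s = 0 := by
    intro s hs
    simp only [hG]
    rw [Real.smoothTransition.one_of_one_le (by linarith), sub_self, mul_zero]
  have hw := h.radial_of_vanishing hα hN hGs lam hG0 hvm hvi hV hc ht
  have e1 : ∫ x, G (Real.exp (-(lam * t)) ^ 2 * ‖x - c t‖ ^ 2) ∂ν t =
      ∫ x, H (Real.exp (-(lam * t)) ^ 2 * ‖x - c t‖ ^ 2) ∂ν t := by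
    refine integral_congr_ae ?_
    filter_upwards [harg t ht] with x hx
    exact hGH _ (by linarith)
  have e2 : ∫ x, G (‖x - c 0‖ ^ 2) ∂ν 0 = ∫ x, H (‖x - c 0‖ ^ 2) ∂ν 0 := by
    refine integral_congr_ae ?_
    filter_upwards [harg 0 ⟨le_rfl, hT⟩] with x hx
    refine hGH _ ?_
    simp only [mul_zero, neg_zero, Real.exp_zero, one_pow, one_mul] at hx
    linarith
  rw [← e1, ← e2, hw]
  refine intervalIntegral.integral_congr fun s hs => ?_
  rw [uIcc_of_le ht.1] at hs
  refine integral_congr_ae ?_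
  filter_upwards [harg s ⟨hs.1, hs.2.trans ht.2⟩] with x hx
  rw [flux, flux, hGd _ hx]

end Radial

/-! ### Moments -/

section Moments

variable {μ : Measure Plane} [IsProbabilityMeasure μ] {ρ : ℝ}

lemma integrable_sub_of_bounded (hρ : ∀ᵐ x ∂μ, ‖x‖ ≤ ρ) (b : Plane) :
    Integrable (fun x => x - b) μ := by
  refine Integrable.of_bound (C := ρ + ‖b‖) (by fun_prop) ?_
  filter_upwards [hρ] with x hx
  exact (norm_sub_le _ _).trans (by linarith)

lemma integrable_norm_sub_sq (hρ : ∀ᵐ x ∂μ, ‖x‖ ≤ ρ) (b : Plane) :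
    Integrable (fun x => ‖x - b‖ ^ 2) μ := by
  refine Integrable.of_bound (C := (ρ + ‖b‖) ^ 2) (by fun_prop) ?_
  filter_upwards [hρ] with x hx
  rw [Real.norm_of_nonneg (by positivity)]
  exact pow_le_pow_left₀ (norm_nonneg _) ((norm_sub_le _ _).trans (by linarith)) 2

lemma integral_sub_mean (hρ : ∀ᵐ x ∂μ, ‖x‖ ≤ ρ) : ∫ x, (x - ∫ y, y ∂μ) ∂μ = 0 := by
  have hi : Integrable (fun x : Plane => x) μ := by
    simpa using integrable_sub_of_bounded hρ 0
  rw [integral_sub hi (integrable_const _)]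
  simp

/-- Parallel axis theorem: the cross term integrates to zero about the mean. It bounds both the
variance and the distance of the mean from `b` by the second moment about `b`. -/
lemma integral_norm_sub_sq_eq (hρ : ∀ᵐ x ∂μ, ‖x‖ ≤ ρ) (b : Plane) :
    ∫ x, ‖x - b‖ ^ 2 ∂μ = ∫ x, ‖x - ∫ y, y ∂μ‖ ^ 2 ∂μ + ‖∫ y, y ∂μ - b‖ ^ 2 := by
  set c := ∫ y, y ∂μ with hc
  have h1 : ∀ x, ‖x - b‖ ^ 2 = ‖x - c‖ ^ 2 + (2 * inner ℝ (c - b) (x - c) + ‖c - b‖ ^ 2) := by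
    intro x
    rw [show x - b = (x - c) + (c - b) by abel, norm_add_sq_real, real_inner_comm]
    ring
  have hi := (integrable_sub_of_bounded hρ c).const_inner (𝕜 := ℝ) (c - b)
  have hi2 : Integrable (fun x => 2 * inner ℝ (c - b) (x - c) + ‖c - b‖ ^ 2) μ :=
    (hi.const_mul 2).add (integrable_const _)
  rw [integral_congr_ae (ae_of_all _ h1), integral_add (integrable_norm_sub_sq hρ c) hi2,
    integral_add (hi.const_mul 2) (integrable_const _), integral_const_mul,
    integral_inner (integrable_sub_of_bounded hρ c), integral_sub_mean hρ]
  simp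

/-- Relative to its average over `μ`, a Lipschitz field grows at most linearly outside the core. -/
lemma inner_sub_average_le (hρ : ∀ᵐ x ∂μ, ‖x‖ ≤ ρ) {G : Plane → Plane} {D : ℝ} (hD : 0 ≤ D)
    (hGi : Integrable G μ) (hG : ∀ x y, ‖G x - G y‖ ≤ D * ‖x - y‖) {c x : Plane} {I : ℝ}
    (hI : ∫ y, ‖y - c‖ ^ 2 ∂μ ≤ I) (hx0 : 0 < ‖x - c‖) (hx : I ≤ ‖x - c‖ ^ 2) :
    inner ℝ (G x - ∫ y, G y ∂μ) (x - c) ≤ 2 * D * ‖x - c‖ ^ 2 := by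
  set a := ‖x - c‖ with ha
  have h1 : ‖G x - ∫ y, G y ∂μ‖ ≤ 2 * D * a := by
    have e : G x - ∫ y, G y ∂μ = ∫ y, (G x - G y) ∂μ := by
      rw [integral_sub (integrable_const _) hGi]; simp
    rw [e]
    refine (norm_integral_le_integral_norm _).trans ?_
    have hpt : ∀ y, ‖G x - G y‖ ≤ D * (‖y - c‖ ^ 2 * (1 / (2 * a)) + 3 / 2 * a) := by
      intro y
      refine (hG x y).trans (mul_le_mul_of_nonneg_left ?_ hD)
      have h2 : ‖x - y‖ ≤ a + ‖y - c‖ := by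
        rw [show x - y = (x - c) - (y - c) by abel]
        exact norm_sub_le _ _
      -- Young's inequality with weight `a`; after integration the quadratic term is at most `a / 2`
      -- because `I ≤ a²`, which gives `2 * D * a` altogether.
      have h3 : ‖y - c‖ ≤ ‖y - c‖ ^ 2 * (1 / (2 * a)) + a / 2 := by
        rw [← sub_nonneg]
        have : ‖y - c‖ ^ 2 * (1 / (2 * a)) + a / 2 - ‖y - c‖ = (‖y - c‖ - a) ^ 2 / (2 * a) := by
          field_simp; ring
        rw [this]; positivity
      linarith
    have hi := (integrable_norm_sub_sq hρ c).mul_const (1 / (2 * a))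
    have hR : Integrable (fun y => D * (‖y - c‖ ^ 2 * (1 / (2 * a)) + 3 / 2 * a)) μ :=
      (hi.add (integrable_const _)).const_mul D
    refine (integral_mono ((integrable_const _).sub hGi).norm hR hpt).trans ?_
    rw [integral_const_mul, integral_add hi (integrable_const _), integral_mul_const]
    simp only [integral_const, probReal_univ, smul_eq_mul, one_mul]
    have h4 : (∫ y, ‖y - c‖ ^ 2 ∂μ) * (1 / (2 * a)) ≤ a / 2 := by
      rw [mul_one_div, div_le_iff₀ (by positivity)]
      nlinarith
    nlinarith
  refine (real_inner_le_norm _ _).trans ?_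
  nlinarith

end Moments

/-- A weak flow of probability measures with supports in a fixed disk, in a Lipschitz field. -/
structure IsCompactFlow (α N A D T ρ : ℝ) (F : ℝ → Plane → Plane)
    (ν : ProbabilityTheory.Kernel ℝ Plane) : Prop extends IsWeakFlow α N A T F ν where
  prob : ∀ t ∈ Icc 0 T, IsProbabilityMeasure (ν t)
  support : ∀ t ∈ Icc 0 T, ∀ᵐ x ∂ν t, ‖x‖ ≤ ρ
  lipschitz : ∀ t ∈ Icc 0 T, ∀ x y, ‖F t x - F t y‖ ≤ D * ‖x - y‖

/-! ### Evolution of the second moment and of the centre of mass -/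

namespace IsCompactFlow

variable {α N A D T ρ : ℝ} {F : ℝ → Plane → Plane} {ν : ProbabilityTheory.Kernel ℝ Plane}

lemma bound_nonneg (h : IsCompactFlow α N A D T ρ F ν) (hT : 0 ≤ T) : 0 ≤ A :=
  (norm_nonneg _).trans (h.norm_field_le 0 ⟨le_rfl, hT⟩ 0)

lemma integrable_field (h : IsCompactFlow α N A D T ρ F ν) {t : ℝ} (ht : t ∈ Icc 0 T) :
    Integrable (F t) (ν t) := by
  have := h.prob t ht
  exact Integrable.of_bound (C := A) (h.measurable_field.of_uncurry_left).aestronglyMeasurable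
    (ae_of_all _ (h.norm_field_le t ht))

lemma integrable_inner_field (h : IsCompactFlow α N A D T ρ F ν) {t : ℝ} (ht : t ∈ Icc 0 T)
    (v b : Plane) : Integrable (fun x => inner ℝ (F t x - v) (x - b)) (ν t) := by
  have := h.prob t ht
  refine Integrable.of_bound (C := (A + ‖v‖) * (ρ + ‖b‖)) ?_ ?_
  · exact (((h.measurable_field.of_uncurry_left).sub_const v).inner
      (measurable_id.sub_const b)).aestronglyMeasurable
  · filter_upwards [h.support t ht] with x hx
    refine (norm_inner_le_norm _ _).trans ?_
    have h1 : ‖F t x - v‖ ≤ A + ‖v‖ :=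
      (norm_sub_le _ _).trans (by linarith [h.norm_field_le t ht x])
    have h2 : ‖x - b‖ ≤ ρ + ‖b‖ := (norm_sub_le _ _).trans (by linarith)
    exact mul_le_mul h1 h2 (norm_nonneg _) ((norm_nonneg _).trans h1)

lemma integrable_inner_vel (h : IsCompactFlow α N A D T ρ F ν) (hα : α ∈ Ioo (0 : ℝ) 1)
    (hN : 0 < N) {t : ℝ} (ht : t ∈ Icc 0 T) {a : Plane → Plane} (ha : Measurable a) {C : ℝ}
    (hC : ∀ᵐ x ∂ν t, ‖a x‖ ≤ C) :
    Integrable (fun x => inner ℝ (vel α (ν t) x) (a x)) (ν t) := by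
  have := h.prob t ht
  obtain ⟨U, hU⟩ := exists_norm_vel_le (α := α) hα (h.le_volume t ht) hN univ
  rw [Measure.restrict_univ] at hU
  refine Integrable.of_bound (C := U * C) ?_ ?_
  · exact ((stronglyMeasurable_vel α _).measurable.inner ha).aestronglyMeasurable
  · filter_upwards [hC] with x hx
    exact (norm_inner_le_norm _ _).trans
      (mul_le_mul (hU x) hx (norm_nonneg _) ((norm_nonneg _).trans (hU x)))

lemma ae_norm_sub_le (h : IsCompactFlow α N A D T ρ F ν) {t : ℝ} (ht : t ∈ Icc 0 T) (b : Plane) :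
    ∀ᵐ x ∂ν t, ‖x - b‖ ≤ ρ + ‖b‖ := by
  filter_upwards [h.support t ht] with x hx
  exact (norm_sub_le _ _).trans (by linarith)

/-- The self-interaction does not contribute to the evolution of the second moment. -/
lemma totalFlux_id (h : IsCompactFlow α N A D T ρ F ν) (hα : α ∈ Ioo (0 : ℝ) 1) (hN : 0 < N)
    (lam : ℝ) (c v : ℝ → Plane) {s : ℝ} (hs : s ∈ Icc 0 T) :
    totalFlux α F ν id lam c v s = 2 * Real.exp (-(lam * s)) ^ 2 *
      ∫ x, (inner ℝ (F s x - v s) (x - c s) - lam * ‖x - c s‖ ^ 2) ∂ν s := by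
  have := h.prob s hs
  have h0 : ∫ x, inner ℝ (vel α (ν s) x) (x - c s) ∂ν s = 0 :=
    integral_inner_vel_sub_center hα (h.le_volume s hs) hN.le (c s) (h.ae_norm_sub_le hs (c s))
  have hi1 := h.integrable_inner_vel hα hN hs (a := fun x => x - c s) (by fun_prop)
    (h.ae_norm_sub_le hs (c s))
  have hi2 : Integrable
      (fun x => inner ℝ (F s x - v s) (x - c s) - lam * ‖x - c s‖ ^ 2) (ν s) :=
    (h.integrable_inner_field hs _ _).sub
      ((integrable_norm_sub_sq (h.support s hs) (c s)).const_mul lam)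
  have e : ∀ x, flux id lam (Real.exp (-(lam * s))) (c s) (v s)
      (fun x => vel α (ν s) x + F s x) x = 2 * Real.exp (-(lam * s)) ^ 2 *
        (inner ℝ (vel α (ν s) x) (x - c s) +
          (inner ℝ (F s x - v s) (x - c s) - lam * ‖x - c s‖ ^ 2)) := by
    intro x
    rw [flux, deriv_id, mul_one, add_sub_assoc, inner_add_left]
    ring
  simp only [totalFlux, e]
  rw [integral_const_mul, integral_add hi1 hi2, h0, zero_add]

/-- The second moment about a trajectory of the field grows at most exponentially. -/
lemma integral_norm_sub_sq_le [ProbabilityTheory.IsSFiniteKernel ν]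
    (h : IsCompactFlow α N A D T ρ F ν) (hα : α ∈ Ioo (0 : ℝ) 1) (hN : 0 < N) {B : ℝ → Plane}
    (hBc : ContinuousOn B (Icc 0 T))
    (hB : ∀ t ∈ Icc 0 T, B t = B 0 + ∫ s in (0 : ℝ)..t, F s (B s)) {t : ℝ} (ht : t ∈ Icc 0 T) :
    ∫ x, ‖x - B t‖ ^ 2 ∂ν t ≤ Real.exp (D * t) ^ 2 * ∫ x, ‖x - B 0‖ ^ 2 ∂ν 0 := by
  have hT : 0 ≤ T := ht.1.trans ht.2
  have hA := h.bound_nonneg hT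
  -- Time is clamped inside `B`, which is continuous only on `[0, T]`, so that `v` is measurable;
  -- the indicator makes it integrable on the line.
  set v : ℝ → Plane := (Icc 0 T).indicator fun s => F s (B (max 0 (min s T))) with hv
  have hmem : ∀ s : ℝ, max 0 (min s T) ∈ Icc 0 T := fun s =>
    ⟨le_max_left _ _, max_le hT (min_le_right _ _)⟩
  have heq : ∀ s ∈ Icc 0 T, v s = F s (B s) := by
    intro s hs
    rw [hv, indicator_of_mem hs, min_eq_left hs.2, max_eq_right hs.1]
  have hvm : Measurable v := by
    refine Measurable.indicator ?_ measurableSet_Icc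
    have hc : Continuous fun s : ℝ => B (max 0 (min s T)) :=
      hBc.comp_continuous (by fun_prop) hmem
    exact h.measurable_field.comp (measurable_id.prodMk hc.measurable)
  have hvb : ∀ s, ‖v s‖ ≤ A := by
    intro s
    by_cases hs : s ∈ Icc 0 T
    · rw [heq s hs]; exact h.norm_field_le s hs _
    · rw [hv, indicator_of_notMem hs, norm_zero]; exact hA
  have hvi : Integrable v := by
    rw [hv, integrable_indicator_iff measurableSet_Icc]
    refine Measure.integrableOn_of_bounded (M := A) (by simp) ?_ ?_
    · have hc : Continuous fun s : ℝ => B (max 0 (min s T)) :=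
        hBc.comp_continuous (by fun_prop) hmem
      exact (h.measurable_field.comp (measurable_id.prodMk hc.measurable)).aestronglyMeasurable
    · filter_upwards [ae_restrict_mem measurableSet_Icc] with s hs
      exact h.norm_field_le s hs _
  have hB' : ∀ t ∈ Icc 0 T, B t = B 0 + ∫ s in (0 : ℝ)..t, v s := by
    intro t ht
    rw [hB t ht]
    congr 1
    refine intervalIntegral.integral_congr fun s hs => ?_
    rw [uIcc_of_le ht.1] at hs
    exact (heq s ⟨hs.1, hs.2.trans ht.2⟩).symm
  -- With `lam = D` the weight `exp (-D t)²` exactly offsets the Lipschitz bound `⟨F x - F B, x - B⟩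
  -- ≤ D ‖x - B‖²`, so the weighted moment does not increase.
  have hw := h.radial hα hN h.support contDiff_id D hvm hvi hvb hB' ht
  have hneg : ∫ s in (0 : ℝ)..t, totalFlux α F ν id D B v s ≤ 0 * t := by
    refine intervalIntegral_le_of_le ht.1 le_rfl fun s hs => ?_
    have hs' : s ∈ Icc 0 T := ⟨hs.1, hs.2.trans ht.2⟩
    rw [h.totalFlux_id hα hN D B v hs', heq s hs']
    refine mul_nonpos_of_nonneg_of_nonpos (by positivity) (integral_nonpos fun x => ?_)
    have h1 := real_inner_le_norm (F s x - F s (B s)) (x - B s)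
    have h2 := h.lipschitz s hs' x (B s)
    have h3 : ‖F s x - F s (B s)‖ * ‖x - B s‖ ≤ D * ‖x - B s‖ * ‖x - B s‖ :=
      mul_le_mul_of_nonneg_right h2 (norm_nonneg _)
    simp only [Pi.zero_apply]
    nlinarith
  simp only [id] at hw
  rw [integral_const_mul] at hw
  have h1 : Real.exp (-(D * t)) ^ 2 * ∫ x, ‖x - B t‖ ^ 2 ∂ν t ≤ ∫ x, ‖x - B 0‖ ^ 2 ∂ν 0 := by
    linarith
  have h2 : Real.exp (D * t) ^ 2 * Real.exp (-(D * t)) ^ 2 = 1 := by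
    rw [← mul_pow, ← Real.exp_add]; simp
  calc ∫ x, ‖x - B t‖ ^ 2 ∂ν t
      = Real.exp (D * t) ^ 2 * (Real.exp (-(D * t)) ^ 2 * ∫ x, ‖x - B t‖ ^ 2 ∂ν t) := by
        rw [← mul_assoc, h2, one_mul]
    _ ≤ _ := mul_le_mul_of_nonneg_left h1 (by positivity)

/-- The velocity of the centre of mass. -/
def meanVelocity (T : ℝ) (F : ℝ → Plane → Plane) (ν : ProbabilityTheory.Kernel ℝ Plane) :
    ℝ → Plane := (Icc 0 T).indicator fun s => ∫ x, F s x ∂ν s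

lemma measurable_meanVelocity [ProbabilityTheory.IsSFiniteKernel ν]
    (h : IsCompactFlow α N A D T ρ F ν) : Measurable (meanVelocity T F ν) :=
  (StronglyMeasurable.integral_kernel_prod_right
    h.measurable_field.stronglyMeasurable).measurable.indicator measurableSet_Icc

lemma norm_meanVelocity_le (h : IsCompactFlow α N A D T ρ F ν) (hT : 0 ≤ T) (s : ℝ) :
    ‖meanVelocity T F ν s‖ ≤ A := by
  by_cases hs : s ∈ Icc 0 T
  · have := h.prob s hs
    rw [meanVelocity, indicator_of_mem hs]
    refine (norm_integral_le_of_norm_le_const (ae_of_all _ (h.norm_field_le s hs))).trans ?_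
    simp
  · rw [meanVelocity, indicator_of_notMem hs, norm_zero]
    exact h.bound_nonneg hT

lemma integrable_meanVelocity [ProbabilityTheory.IsSFiniteKernel ν]
    (h : IsCompactFlow α N A D T ρ F ν) (hT : 0 ≤ T) : Integrable (meanVelocity T F ν) := by
  have hi : IntegrableOn (meanVelocity T F ν) (Icc 0 T) :=
    Measure.integrableOn_of_bounded (M := A) (by simp)
      h.measurable_meanVelocity.aestronglyMeasurable
      (ae_of_all _ (h.norm_meanVelocity_le hT))
  rw [← integrable_indicator_iff measurableSet_Icc] at hi
  rwa [meanVelocity, indicator_indicator, inter_self] at hi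

/-- The self-interaction does not move the centre of mass. -/
lemma mean_eq [ProbabilityTheory.IsSFiniteKernel ν]
    (h : IsCompactFlow α N A D T ρ F ν) (hα : α ∈ Ioo (0 : ℝ) 1) (hN : 0 < N) {t : ℝ}
    (ht : t ∈ Icc 0 T) :
    ∫ x, x ∂ν t = ∫ x, x ∂ν 0 + ∫ s in (0 : ℝ)..t, meanVelocity T F ν s := by
  have hT : 0 ≤ T := ht.1.trans ht.2
  have h0 : (0 : ℝ) ∈ Icc 0 T := ⟨le_rfl, hT⟩
  have hvi := h.integrable_meanVelocity hT
  -- Only radial test functions have been prepared, so the first moment is recovered by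
  -- polarization: second moments about `a` and about `0` differ by a constant and a term linear in
  -- the mean.
  have key : ∀ a : Plane, (∫ x, ‖x - a‖ ^ 2 ∂ν t) - ∫ x, ‖x - a‖ ^ 2 ∂ν 0 =
      ∫ s in (0 : ℝ)..t, 2 * ∫ x, inner ℝ (F s x) (x - a) ∂ν s := by
    intro a
    have hw := h.radial hα hN h.support contDiff_id 0 (c := fun _ => a) (v := 0)
      measurable_zero (integrable_zero _ _ _) (V := 0) (by simp) (by simp) ht
    simp only [id, zero_mul, neg_zero, Real.exp_zero, one_pow, one_mul] at hw
    rw [hw]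
    refine intervalIntegral.integral_congr fun s hs => ?_
    rw [uIcc_of_le ht.1] at hs
    have hs' : s ∈ Icc 0 T := ⟨hs.1, hs.2.trans ht.2⟩
    have e := h.totalFlux_id hα hN 0 (fun _ => a) 0 hs'
    simp only [zero_mul, neg_zero, Real.exp_zero, one_pow, mul_one, Pi.zero_apply, sub_zero] at e
    exact e
  have hii : ∀ a : Plane, IntervalIntegrable
      (fun s => 2 * ∫ x, inner ℝ (F s x) (x - a) ∂ν s) volume 0 t := by
    intro a
    rw [intervalIntegrable_iff_integrableOn_Icc_of_le ht.1]
    refine Measure.integrableOn_of_bounded (M := 2 * (A * (ρ + ‖a‖))) (by simp) ?_ ?_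
    · refine ((StronglyMeasurable.integral_kernel_prod_right (κ := ν)
        (f := fun s x => inner ℝ (F s x) (x - a)) ?_).const_mul 2).aestronglyMeasurable
      exact (h.measurable_field.inner (measurable_snd.sub_const a)).stronglyMeasurable
    · filter_upwards [ae_restrict_mem measurableSet_Icc] with s hs
      have hs' : s ∈ Icc 0 T := ⟨hs.1, hs.2.trans ht.2⟩
      have := h.prob s hs'
      rw [norm_mul, Real.norm_of_nonneg zero_le_two]
      refine mul_le_mul_of_nonneg_left ?_ zero_le_two
      have hb : ∀ᵐ x ∂ν s, ‖(inner ℝ (F s x) (x - a) : ℝ)‖ ≤ A * (ρ + ‖a‖) := by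
        filter_upwards [h.ae_norm_sub_le hs' a] with x hx
        exact (norm_inner_le_norm _ _).trans (mul_le_mul (h.norm_field_le s hs' x) hx
          (norm_nonneg _) (h.bound_nonneg hT))
      refine (norm_integral_le_of_norm_le_const hb).trans ?_
      simp
  have hsq : ∀ s ∈ Icc 0 T, ∀ a : Plane, ∫ x, ‖x - a‖ ^ 2 ∂ν s =
      ∫ x, ‖x - 0‖ ^ 2 ∂ν s - 2 * inner ℝ a (∫ x, x ∂ν s) + ‖a‖ ^ 2 := by
    intro s hs a
    have := h.prob s hs
    rw [integral_norm_sub_sq_eq (h.support s hs) a, integral_norm_sub_sq_eq (h.support s hs) 0,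
      sub_zero, norm_sub_sq_real, real_inner_comm]
    ring
  refine ext_inner_left ℝ fun a => ?_
  have k1 := key a
  have k0 := key 0
  rw [hsq t ht a, hsq 0 h0 a] at k1
  have k2 : (∫ s in (0 : ℝ)..t, 2 * ∫ x, inner ℝ (F s x) (x - 0) ∂ν s) -
      ∫ s in (0 : ℝ)..t, 2 * ∫ x, inner ℝ (F s x) (x - a) ∂ν s =
      2 * inner ℝ a (∫ s in (0 : ℝ)..t, meanVelocity T F ν s) := by
    rw [← intervalIntegral.integral_sub (hii 0) (hii a),
      ← innerSL_apply_apply ℝ a, ← ContinuousLinearMap.intervalIntegral_comp_comm _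
        hvi.intervalIntegrable, ← intervalIntegral.integral_const_mul]
    refine intervalIntegral.integral_congr fun s hs => ?_
    rw [uIcc_of_le ht.1] at hs
    have hs' : s ∈ Icc 0 T := ⟨hs.1, hs.2.trans ht.2⟩
    simp only [innerSL_apply_apply]
    have hF : ∀ b : Plane, Integrable (fun x => inner ℝ (F s x) (x - b)) (ν s) := fun b => by
      simpa using h.integrable_inner_field hs' 0 b
    rw [← mul_sub, ← integral_sub (hF 0) (hF a), meanVelocity, indicator_of_mem hs',
      ← integral_inner (h.integrable_field hs')]
    congr 1
    refine integral_congr_ae (ae_of_all _ fun x => ?_)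
    simp only
    rw [← inner_sub_right, real_inner_comm]
    congr 1
    abel
  rw [inner_add_right]
  linarith

end IsCompactFlow

/-! ### Localization -/

lemma fluxRate_nonneg {α N I r : ℝ} (hα : 0 < α) (hN : 0 ≤ N) (hI : 0 ≤ I) (hr : 0 < r) :
    0 ≤ fluxRate α N I r := by
  have h1 := stepConst_nonneg
  have h2 := coreConst_nonneg hα
  have h3 := ballRiesz_nonneg α
  unfold fluxRate
  positivity

/-- Every power of `r` in the rate is negative, so the rate at the smallest radius serves for all
the dyadic radii. -/
lemma fluxRate_anti {α N I r r' : ℝ} (hα : α ∈ Ioo (0 : ℝ) 1) (hN : 0 ≤ N) (hI : 0 ≤ I)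
    (hr : 0 < r) (hrr : r ≤ r') : fluxRate α N I r' ≤ fluxRate α N I r := by
  have h1 := stepConst_nonneg
  have h2 := coreConst_nonneg hα.1
  have h3 := ballRiesz_nonneg α
  have hr' : 0 < r' := by linarith
  have e1 : 2 * stepConst / r' ^ 2 ≤ 2 * stepConst / r ^ 2 := by gcongr
  have e2 : (r' / 2) ^ (-(2 + α)) ≤ (r / 2) ^ (-(2 + α)) :=
    Real.rpow_le_rpow_of_nonpos (by positivity) (by linarith) (by linarith [hα.1])
  have e3 : (4 * I / r' ^ 2) ^ (1 - α / 2) ≤ (4 * I / r ^ 2) ^ (1 - α / 2) := by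
    refine Real.rpow_le_rpow (by positivity) ?_ (by linarith [hα.2])
    gcongr
  unfold fluxRate
  refine mul_le_mul e1 (add_le_add (mul_le_mul_of_nonneg_left e2 (by positivity)) ?_)
    (by positivity) (by positivity)
  exact mul_le_mul_of_nonneg_left (mul_le_mul_of_nonneg_left
    (mul_le_mul_of_nonneg_left e3 (by positivity)) (by positivity)) (abs_nonneg _)

namespace IsCompactFlow

variable {α N A D T ρ : ℝ} {F : ℝ → Plane → Plane} {ν : ProbabilityTheory.Kernel ℝ Plane}

/-- The centre of mass. -/
def mean (ν : ProbabilityTheory.Kernel ℝ Plane) (t : ℝ) : Plane := ∫ x, x ∂ν t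

/-- The points at distance at least `r exp(lam t)` from the centre of mass. -/
def outer (ν : ProbabilityTheory.Kernel ℝ Plane) (lam r t : ℝ) : Set Plane :=
  {x | r ≤ Real.exp (-(lam * t)) * ‖x - mean ν t‖}

lemma measurableSet_outer (ν : ProbabilityTheory.Kernel ℝ Plane) (lam r t : ℝ) :
    MeasurableSet (outer ν lam r t) :=
  measurableSet_le measurable_const (((measurable_id.sub_const _).norm).const_mul _)

lemma exp_mem_Ioc {lam s : ℝ} (hlam : 0 ≤ lam) (hs : 0 ≤ s) :
    Real.exp (-(lam * s)) ∈ Ioc (0 : ℝ) 1 :=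
  ⟨Real.exp_pos _, Real.exp_le_one_iff.2 (by nlinarith)⟩

lemma radial_step [ProbabilityTheory.IsSFiniteKernel ν] (h : IsCompactFlow α N A D T ρ F ν)
    (hα : α ∈ Ioo (0 : ℝ) 1) (hN : 0 < N) (lam : ℝ) {r : ℝ} (hr : 0 < r)
    (h0 : ∀ᵐ x ∂ν 0, ‖x - mean ν 0‖ ≤ r) {t : ℝ} (ht : t ∈ Icc 0 T) :
    ∫ x, step r (Real.exp (-(lam * t)) ^ 2 * ‖x - mean ν t‖ ^ 2) ∂ν t =
      ∫ s in (0 : ℝ)..t, totalFlux α F ν (step r) lam (mean ν) (meanVelocity T F ν) s := by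
  have hT : 0 ≤ T := ht.1.trans ht.2
  rw [← h.radial hα hN h.support (contDiff_step r) lam (c := mean ν) h.measurable_meanVelocity
    (h.integrable_meanVelocity hT) (h.norm_meanVelocity_le hT)
    (fun t ht => h.mean_eq hα hN ht) ht]
  have : ∫ x, step r (‖x - mean ν 0‖ ^ 2) ∂ν 0 = 0 := by
    refine integral_eq_zero_of_ae ?_
    filter_upwards [h0] with x hx
    exact step_eq_zero hr (pow_le_pow_left₀ (norm_nonneg _) hx 2)
  rw [this, sub_zero]

lemma integrable_step (μ : Measure Plane) [IsFiniteMeasure μ] (r τ : ℝ) (c : Plane) :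
    Integrable (fun x => step r (τ ^ 2 * ‖x - c‖ ^ 2)) μ := by
  have := (integrable_const (1 : ℝ)).sub (integrable_one_sub_step μ r τ c)
  exact this.congr (ae_of_all _ fun x => by simp)

/-- The field moves the particles away from the centre of mass at most at the rate `2D`. -/
lemma inner_field_sub_le (h : IsCompactFlow α N A D T ρ F ν) (hD : 0 ≤ D) {I lam r s : ℝ}
    (hlam : 0 ≤ lam) (hs : s ∈ Icc 0 T)
    (hI : ∫ x, ‖x - mean ν s‖ ^ 2 ∂ν s ≤ I) (hr : 0 < r) (hIr : I ≤ r ^ 2) {x : Plane}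
    (hx : x ∈ outer ν lam r s) :
    inner ℝ (F s x - meanVelocity T F ν s) (x - mean ν s) ≤ 2 * D * ‖x - mean ν s‖ ^ 2 := by
  have := h.prob s hs
  have hτ := exp_mem_Ioc hlam hs.1
  have hx' : r ≤ ‖x - mean ν s‖ := by
    have h1 : r ≤ Real.exp (-(lam * s)) * ‖x - mean ν s‖ := hx
    nlinarith [norm_nonneg (x - mean ν s), hτ.2]
  rw [meanVelocity, indicator_of_mem hs]
  exact inner_sub_average_le (h.support s hs) hD (h.integrable_field hs) (h.lipschitz s hs) hI
    (by linarith) (hIr.trans (pow_le_pow_left₀ hr.le hx' 2))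

lemma flux_step_eq (r lam τ : ℝ) (c v x u f : Plane) :
    flux (step r) lam τ c v (fun _ => u + f) x =
      inner ℝ u (stepGrad r τ c x) + 2 * τ ^ 2 * deriv (step r) (τ ^ 2 * ‖x - c‖ ^ 2) *
        (inner ℝ (f - v) (x - c) - lam * ‖x - c‖ ^ 2) := by
  rw [flux, stepGrad, inner_smul_right, add_sub_assoc, inner_add_left]
  ring

lemma two_mul_deriv_step_nonneg {r : ℝ} (hr : 0 < r) (τ s : ℝ) :
    0 ≤ 2 * τ ^ 2 * deriv (step r) s := by
  have := deriv_step_nonneg hr s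
  positivity

lemma deriv_step_eq_zero_of_notMem {lam r s : ℝ} (hr : 0 < r) {x : Plane}
    (hx : x ∉ outer ν lam r s) :
    deriv (step r) (Real.exp (-(lam * s)) ^ 2 * ‖x - mean ν s‖ ^ 2) = 0 := by
  refine deriv_step_eq_zero hr ?_
  rw [← mul_pow]
  exact pow_lt_pow_left₀ (not_le.1 hx) (by positivity) two_ne_zero

/-- The mass outside radius `2r` is controlled by the flux of the mass outside radius `r`. -/
lemma measureReal_outer_two_mul_le [ProbabilityTheory.IsSFiniteKernel ν]
    (h : IsCompactFlow α N A D T ρ F ν)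
    (hα : α ∈ Ioo (0 : ℝ) 1) (hN : 0 < N) (hD : 0 ≤ D) {I lam r m : ℝ} (hI0 : 0 < I)
    (hI : ∀ t ∈ Icc 0 T, ∫ x, ‖x - mean ν t‖ ^ 2 ∂ν t ≤ I) (hlam : 2 * D ≤ lam)
    (hr : 0 < r) (hIr : I ≤ r ^ 2) (h0 : ∀ᵐ x ∂ν 0, ‖x - mean ν 0‖ ≤ r) (hm0 : 0 ≤ m)
    (hm : ∀ t ∈ Icc 0 T, (ν t).real (outer ν lam r t) ≤ m) {t : ℝ} (ht : t ∈ Icc 0 T) :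
    (ν t).real (outer ν lam (2 * r) t) ≤ fluxRate α N I r * T * m := by
  have hlam0 : 0 ≤ lam := by linarith
  have hη := fluxRate_nonneg hα.1 hN.le hI0.le hr
  have h1 : ∀ s ∈ Icc 0 T, totalFlux α F ν (step r) lam (mean ν) (meanVelocity T F ν) s ≤
      fluxRate α N I r * m := by
    intro s hs
    have := h.prob s hs
    have hτ := exp_mem_Ioc hlam0 hs.1
    have hinner := h.integrable_inner_vel hα hN hs
      (measurable_stepGrad r (Real.exp (-(lam * s))) (mean ν s))
      (C := 2 * stepConst / r ^ 2 * (ρ + ‖mean ν s‖)) (by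
        have hC := stepConst_nonneg
        filter_upwards [h.ae_norm_sub_le hs (mean ν s)] with x hx
        exact (norm_stepGrad_le hr hτ _ x).trans
          (mul_le_mul_of_nonneg_left hx (by positivity)))
    have hb : ∫ x, inner ℝ (vel α (ν s) x) (stepGrad r (Real.exp (-(lam * s))) (mean ν s) x) ∂ν s ≤
        fluxRate α N I r * m :=
      (integral_inner_vel_stepGrad_le hα (h.le_volume s hs) hN
        (h.ae_norm_sub_le hs (mean ν s)) (integral_sub_mean (h.support s hs)) hI0 (hI s hs) hr
        hτ).trans (mul_le_mul_of_nonneg_left (hm s hs) hη)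
    have hpt : ∀ x, flux (step r) lam (Real.exp (-(lam * s))) (mean ν s) (meanVelocity T F ν s)
        (fun x => vel α (ν s) x + F s x) x ≤
        inner ℝ (vel α (ν s) x) (stepGrad r (Real.exp (-(lam * s))) (mean ν s) x) := by
      intro x
      have e := flux_step_eq r lam (Real.exp (-(lam * s))) (mean ν s) (meanVelocity T F ν s) x
        (vel α (ν s) x) (F s x)
      refine le_trans (le_of_eq e) ?_
      by_cases hx : x ∈ outer ν lam r s
      · have h2 := h.inner_field_sub_le hD hlam0 hs (hI s hs) hr hIr hx
        have h3 := two_mul_deriv_step_nonneg hr (Real.exp (-(lam * s)))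
          (Real.exp (-(lam * s)) ^ 2 * ‖x - mean ν s‖ ^ 2)
        have h4 : inner ℝ (F s x - meanVelocity T F ν s) (x - mean ν s) -
            lam * ‖x - mean ν s‖ ^ 2 ≤ 0 := by nlinarith [sq_nonneg ‖x - mean ν s‖]
        linarith [mul_nonpos_of_nonneg_of_nonpos h3 h4]
      · rw [deriv_step_eq_zero_of_notMem hr hx]
        simp
    -- A non-integrable flux has integral zero, and the right-hand side is nonnegative.
    by_cases hfi : Integrable (flux (step r) lam (Real.exp (-(lam * s))) (mean ν s)
        (meanVelocity T F ν s) fun x => vel α (ν s) x + F s x) (ν s)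
    · exact (integral_mono hfi hinner hpt).trans hb
    · rw [totalFlux, integral_undef hfi]
      positivity
  have h2 := h.radial_step hα hN lam hr h0 ht
  have h3 := intervalIntegral_le_of_le ht.1 (mul_nonneg hη hm0)
    fun s hs => h1 s ⟨hs.1, hs.2.trans ht.2⟩
  rw [← h2] at h3
  have := h.prob t ht
  have h4 : (ν t).real (outer ν lam (2 * r) t) ≤
      ∫ x, step r (Real.exp (-(lam * t)) ^ 2 * ‖x - mean ν t‖ ^ 2) ∂ν t := by
    rw [← integral_indicator_one (measurableSet_outer ν lam (2 * r) t)]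
    refine integral_mono ((integrable_const (1 : ℝ)).indicator
      (measurableSet_outer ν lam (2 * r) t)) (integrable_step _ _ _ _) fun x => ?_
    by_cases hx : x ∈ outer ν lam (2 * r) t
    · rw [indicator_of_mem hx]
      have hx' : 2 * r ≤ Real.exp (-(lam * t)) * ‖x - mean ν t‖ := hx
      simp only
      rw [step_eq_one hr]
      · rfl
      · rw [← mul_pow]
        nlinarith
    · rw [indicator_of_notMem hx]
      exact step_nonneg _ _
  calc _ ≤ _ := h4
    _ ≤ fluxRate α N I r * m * t := h3
    _ ≤ fluxRate α N I r * m * T := mul_le_mul_of_nonneg_left ht.2 (mul_nonneg hη hm0)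
    _ = _ := by ring

/-- Iteration of the doubling estimate from the trivial bound 1 for a probability measure.
Monotonicity of `fluxRate` gives the same factor at each stage. -/
lemma measureReal_outer_pow_le [ProbabilityTheory.IsSFiniteKernel ν]
    (h : IsCompactFlow α N A D T ρ F ν)
    (hα : α ∈ Ioo (0 : ℝ) 1) (hN : 0 < N) (hD : 0 ≤ D) {I lam r : ℝ} (hI0 : 0 < I)
    (hI : ∀ t ∈ Icc 0 T, ∫ x, ‖x - mean ν t‖ ^ 2 ∂ν t ≤ I) (hlam : 2 * D ≤ lam)
    (hr : 0 < r) (hIr : I ≤ r ^ 2) (h0 : ∀ᵐ x ∂ν 0, ‖x - mean ν 0‖ ≤ r) (n : ℕ) :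
    ∀ t ∈ Icc 0 T, (ν t).real (outer ν lam (2 ^ n * r) t) ≤ (fluxRate α N I r * T) ^ n := by
  induction n with
  | zero =>
    intro t ht
    have := h.prob t ht
    simp
  | succ n ih =>
    intro t ht
    have hT : 0 ≤ T := ht.1.trans ht.2
    have hη := fluxRate_nonneg hα.1 hN.le hI0.le hr
    have hrn : r ≤ 2 ^ n * r := le_mul_of_one_le_left hr.le (one_le_pow₀ one_le_two)
    have h1 := h.measureReal_outer_two_mul_le hα hN hD hI0 hI hlam (r := 2 ^ n * r) (by positivity)
      (hIr.trans (pow_le_pow_left₀ hr.le hrn 2)) (by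
        filter_upwards [h0] with x hx using hx.trans hrn) (by positivity) ih ht
    rw [pow_succ' 2, mul_assoc, pow_succ' (_ * T)]
    refine h1.trans (mul_le_mul_of_nonneg_right (mul_le_mul_of_nonneg_right
      (fluxRate_anti hα hN.le hI0.le hr hrn) hT) (by positivity))

/-- If little mass lies outside radius `q`, no mass gets outside radius `2q`. -/
lemma ae_notMem_outer [ProbabilityTheory.IsSFiniteKernel ν]
    (h : IsCompactFlow α N A D T ρ F ν)
    (hα : α ∈ Ioo (0 : ℝ) 1) (hN : 0 < N) (hD : 0 ≤ D) {I lam q m : ℝ}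
    (hI : ∀ t ∈ Icc 0 T, ∫ x, ‖x - mean ν t‖ ^ 2 ∂ν t ≤ I) (hlam : 2 * D + 1 ≤ lam)
    (hq : 0 < q) (hIq : I ≤ q ^ 2) (h0 : ∀ᵐ x ∂ν 0, ‖x - mean ν 0‖ ≤ 2 * q) (hm0 : 0 < m)
    (hm : ∀ t ∈ Icc 0 T, (ν t).real (outer ν lam q t) ≤ m)
    (hcore : coreConst α * I * q ^ (-(2 + α)) ≤ q ^ 2)
    (hext : |kernelConst α| *
      ((ballRiesz (1 + α) + 1) * (N ^ ((1 + α) / 2) * m ^ (1 - (1 + α) / 2))) ≤ q)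
    {t : ℝ} (ht : t ∈ Icc 0 T) :
    ∀ᵐ x ∂ν t, Real.exp (-(lam * t)) * ‖x - mean ν t‖ ≤ 2 * q := by
  have hlam0 : 0 ≤ lam := by linarith
  have h2q : 0 < 2 * q := by positivity
  have hradial : ∀ s ∈ Icc 0 T, ∀ x ∈ outer ν lam (2 * q) s,
      inner ℝ (vel α (ν s) x) (x - mean ν s) ≤ ‖x - mean ν s‖ ^ 2 := by
    intro s hs x hx
    have := h.prob s hs
    have hτ := exp_mem_Ioc hlam0 hs.1
    set τ := Real.exp (-(lam * s)) with hτd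
    set z := x - mean ν s with hz
    have hx' : 2 * q ≤ τ * ‖z‖ := hx
    have hqτ : q ≤ q / τ := by rw [le_div_iff₀ hτ.1]; nlinarith [hτ.2]
    have hz2 : 2 * (q / τ) ≤ ‖z‖ := by
      rw [mul_div_assoc', div_le_iff₀ hτ.1]; linarith
    set S := Metric.ball (mean ν s) (q / τ) with hS
    have hSm : MeasurableSet S := Metric.isOpen_ball.measurableSet
    -- With the core radius `q / τ` the exterior is exactly the set whose mass is at most `m`.
    have hSc : Sᶜ = outer ν lam q s := by
      ext y
      simp only [hS, outer, mem_compl_iff, Metric.mem_ball, not_lt, dist_eq_norm, mem_ofPred_eq]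
      rw [div_le_iff₀ hτ.1, mul_comm]
    have hi := integrable_norm_sub_sq (h.support s hs) (mean ν s)
    have hc := inner_vel_core_le hα (h.le_volume s hs) hi (integral_sub_mean (h.support s hs))
      (r := q / τ) (by positivity) (x := x) hz2
    have hI0 : 0 ≤ ∫ y, ‖y - mean ν s‖ ^ 2 ∂ν s := integral_nonneg fun y => sq_nonneg _
    have hC := coreConst_nonneg hα.1
    have hc' : coreConst α * (∫ y, ‖y - mean ν s‖ ^ 2 ∂ν s) * (q / τ) ^ (-(2 + α)) ≤ q ^ 2 := by
      refine le_trans (mul_le_mul (mul_le_mul_of_nonneg_left (hI s hs) hC)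
        (Real.rpow_le_rpow_of_nonpos hq hqτ (by linarith [hα.1])) (by positivity)
        (mul_nonneg hC (hI0.trans (hI s hs)))) hcore
    have he : ‖vel α ((ν s).restrict Sᶜ) x‖ ≤ q :=
      (norm_vel_le hα (Measure.restrict_le_self.trans (h.le_volume s hs)) hN hm0
        (by rw [measureReal_restrict_apply_univ, hSc]; exact hm s hs) x).trans hext
    have he' : inner ℝ (vel α ((ν s).restrict Sᶜ) x) z ≤ q * ‖z‖ :=
      (real_inner_le_norm _ _).trans (mul_le_mul_of_nonneg_right he (norm_nonneg _))
    rw [vel_eq_add_compl hα (h.le_volume s hs) hSm x, inner_add_left]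
    -- The core contributes at most `q² ≤ ‖z‖² / 4` and the exterior at most `q ‖z‖ ≤ ‖z‖² / 2`;
    -- together they stay below `‖z‖²`, which the extra 1 in `lam ≥ 2D + 1` compensates.
    have hqz : 2 * q ≤ ‖z‖ := by linarith
    have hc'' := hc.trans hc'
    nlinarith
  have hneg : ∫ s in (0 : ℝ)..t,
      totalFlux α F ν (step (2 * q)) lam (mean ν) (meanVelocity T F ν) s ≤ 0 * t := by
    refine intervalIntegral_le_of_le ht.1 le_rfl fun s hs => integral_nonpos fun x => ?_
    have hs' : s ∈ Icc 0 T := ⟨hs.1, hs.2.trans ht.2⟩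
    simp only [flux, Pi.zero_apply]
    by_cases hx : x ∈ outer ν lam (2 * q) s
    · refine mul_nonpos_of_nonneg_of_nonpos (two_mul_deriv_step_nonneg h2q _ _) ?_
      have h1 := h.inner_field_sub_le hD hlam0 hs' (hI s hs') h2q (by nlinarith) hx
      have h2 := hradial s hs' x hx
      rw [add_sub_assoc, inner_add_left]
      nlinarith [sq_nonneg ‖x - mean ν s‖]
    · rw [deriv_step_eq_zero_of_notMem h2q hx]
      simp
  have hle : ∫ x, step (2 * q) (Real.exp (-(lam * t)) ^ 2 * ‖x - mean ν t‖ ^ 2) ∂ν t ≤ 0 := by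
    rw [h.radial_step hα hN lam h2q h0 ht]
    linarith
  have := h.prob t ht
  have hz := (integral_eq_zero_iff_of_nonneg (fun x => step_nonneg _ _)
    (integrable_step (ν t) (2 * q) (Real.exp (-(lam * t))) (mean ν t))).1
    (le_antisymm hle (integral_nonneg fun x => step_nonneg _ _))
  filter_upwards [hz] with x hx
  by_contra! hlt
  have hpos : 0 < step (2 * q) (Real.exp (-(lam * t)) ^ 2 * ‖x - mean ν t‖ ^ 2) := by
    refine step_pos h2q ?_
    rw [← mul_pow]
    exact pow_lt_pow_left₀ hlt h2q.le two_ne_zero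
  exact hpos.ne hx.symm

/-- Localization around a trajectory of the field, under explicit smallness conditions. -/
theorem localization [ProbabilityTheory.IsSFiniteKernel ν]
    (h : IsCompactFlow α N A D T ρ F ν) (hα : α ∈ Ioo (0 : ℝ) 1) (hN : 0 < N) (hD : 0 ≤ D)
    (hT : 0 ≤ T) {B : ℝ → Plane} (hBc : ContinuousOn B (Icc 0 T))
    (hB : ∀ t ∈ Icc 0 T, B t = B 0 + ∫ s in (0 : ℝ)..t, F s (B s)) {ε R m : ℝ} {n : ℕ}
    (hε : 0 < ε) (h0 : ∀ᵐ x ∂ν 0, ‖x - B 0‖ ≤ ε) (hR : 2 * ε ≤ R)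
    (hIR : Real.exp (D * T) * ε ≤ R) (hm0 : 0 < m)
    (hm : (fluxRate α N ((Real.exp (D * T) * ε) ^ 2) R * T) ^ n ≤ m)
    (hcore : coreConst α * (Real.exp (D * T) * ε) ^ 2 * R ^ (-(2 + α)) ≤ R ^ 2)
    (hext : |kernelConst α| *
      ((ballRiesz (1 + α) + 1) * (N ^ ((1 + α) / 2) * m ^ (1 - (1 + α) / 2))) ≤ R)
    {t : ℝ} (ht : t ∈ Icc 0 T) :
    ∀ᵐ x ∂ν t, ‖x - B t‖ ≤
      2 ^ (n + 1) * R * Real.exp ((2 * D + 1) * T) + Real.exp (D * T) * ε := by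
  set I := (Real.exp (D * T) * ε) ^ 2 with hI
  have hI0 : 0 < I := by positivity
  have hR0 : 0 < R := by linarith
  have h00 : (0 : ℝ) ∈ Icc 0 T := ⟨le_rfl, hT⟩
  have hB0 : ∫ x, ‖x - B 0‖ ^ 2 ∂ν 0 ≤ ε ^ 2 := by
    have := h.prob 0 h00
    refine (integral_mono_ae (integrable_norm_sub_sq (h.support 0 h00) _)
      (integrable_const (ε ^ 2)) ?_).trans (by simp)
    filter_upwards [h0] with x hx
    exact pow_le_pow_left₀ (norm_nonneg _) hx 2
  have hIB : ∀ t ∈ Icc 0 T, ∫ x, ‖x - B t‖ ^ 2 ∂ν t ≤ I := by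
    intro t ht
    refine (h.integral_norm_sub_sq_le hα hN hBc hB ht).trans ?_
    rw [hI, mul_pow]
    refine mul_le_mul (pow_le_pow_left₀ (Real.exp_pos _).le (Real.exp_le_exp.2 ?_) 2) hB0
      (integral_nonneg fun x => sq_nonneg _) (by positivity)
    exact mul_le_mul_of_nonneg_left ht.2 hD
  have hsplit : ∀ t ∈ Icc 0 T, ∫ x, ‖x - B t‖ ^ 2 ∂ν t =
      ∫ x, ‖x - mean ν t‖ ^ 2 ∂ν t + ‖mean ν t - B t‖ ^ 2 := by
    intro t ht
    have := h.prob t ht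
    exact integral_norm_sub_sq_eq (h.support t ht) (B t)
  have hIc : ∀ t ∈ Icc 0 T, ∫ x, ‖x - mean ν t‖ ^ 2 ∂ν t ≤ I := fun t ht => by
    linarith [hIB t ht, hsplit t ht, sq_nonneg ‖mean ν t - B t‖]
  -- By the parallel axis identity the second moment about `B` also controls the distance of the
  -- centre of mass from `B`.
  have hmB : ∀ t ∈ Icc 0 T, ‖mean ν t - B t‖ ≤ Real.exp (D * T) * ε := fun t ht => by
    have h1 : 0 ≤ ∫ x, ‖x - mean ν t‖ ^ 2 ∂ν t := integral_nonneg fun x => sq_nonneg _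
    refine (pow_le_pow_iff_left₀ (norm_nonneg _) (by positivity) two_ne_zero).1 ?_
    linarith [hIB t ht, hsplit t ht]
  have hm0' : ‖mean ν 0 - B 0‖ ≤ ε := by
    have h1 : 0 ≤ ∫ x, ‖x - mean ν 0‖ ^ 2 ∂ν 0 := integral_nonneg fun x => sq_nonneg _
    refine (pow_le_pow_iff_left₀ (norm_nonneg _) hε.le two_ne_zero).1 ?_
    linarith [hsplit 0 h00]
  have h0' : ∀ᵐ x ∂ν 0, ‖x - mean ν 0‖ ≤ R := by
    filter_upwards [h0] with x hx
    have : ‖x - mean ν 0‖ ≤ ‖x - B 0‖ + ‖mean ν 0 - B 0‖ := by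
      rw [show x - mean ν 0 = (x - B 0) - (mean ν 0 - B 0) by abel]
      exact norm_sub_le _ _
    linarith
  have hIR2 : I ≤ R ^ 2 := pow_le_pow_left₀ (by positivity) hIR 2
  have hq : R ≤ 2 ^ n * R := le_mul_of_one_le_left hR0.le (one_le_pow₀ one_le_two)
  have hmass := h.measureReal_outer_pow_le hα hN hD (lam := 2 * D + 1) hI0 hIc (by linarith)
    hR0 hIR2 h0' n
  have hC := coreConst_nonneg hα.1
  have hfin := h.ae_notMem_outer hα hN hD (lam := 2 * D + 1) (q := 2 ^ n * R) hIc le_rfl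
    (by positivity) (hIR2.trans (pow_le_pow_left₀ hR0.le hq 2))
    (by filter_upwards [h0'] with x hx; linarith) hm0
    (fun t ht => (hmass t ht).trans hm)
    ((mul_le_mul_of_nonneg_left (Real.rpow_le_rpow_of_nonpos hR0 hq (by linarith [hα.1]))
      (by positivity)).trans (hcore.trans (pow_le_pow_left₀ hR0.le hq 2)))
    (hext.trans hq) ht
  filter_upwards [hfin] with x hx
  have h1 : ‖x - B t‖ ≤ ‖x - mean ν t‖ + ‖mean ν t - B t‖ := by
    rw [show x - B t = (x - mean ν t) + (mean ν t - B t) by abel]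
    exact norm_add_le _ _
  have h2 : ‖x - mean ν t‖ ≤ 2 ^ (n + 1) * R * Real.exp ((2 * D + 1) * T) := by
    have e : ‖x - mean ν t‖ = Real.exp ((2 * D + 1) * t) *
        (Real.exp (-((2 * D + 1) * t)) * ‖x - mean ν t‖) := by
      rw [← mul_assoc, ← Real.exp_add, add_neg_cancel, Real.exp_zero, one_mul]
    rw [e]
    have h3 : Real.exp ((2 * D + 1) * t) ≤ Real.exp ((2 * D + 1) * T) :=
      Real.exp_le_exp.2 (mul_le_mul_of_nonneg_left ht.2 (by linarith))
    calc _ ≤ Real.exp ((2 * D + 1) * T) * (2 * (2 ^ n * R)) :=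
          mul_le_mul h3 hx (by positivity) (Real.exp_pos _).le
      _ = _ := by ring
  linarith [hmB t ht]

end IsCompactFlow

/-! ### From solutions to measure-valued flows -/

/-- The measures with densities `θ t`. -/
def massKernel (θ : ℝ → Plane → ℝ) : ProbabilityTheory.Kernel ℝ Plane :=
  ProbabilityTheory.Kernel.withDensity (ProbabilityTheory.Kernel.const ℝ volume)
    fun t x => ((θ t x).toNNReal : ENNReal)

instance (θ : ℝ → Plane → ℝ) : ProbabilityTheory.IsSFiniteKernel (massKernel θ) := by
  unfold massKernel; infer_instance

section Bridge

variable {α : ℝ} {F : ℝ → Plane → Plane} {θ : ℝ → Plane → ℝ}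

lemma massKernel_apply (hθ : Measurable (Function.uncurry θ)) (t : ℝ) :
    massKernel θ t = volume.withDensity fun x => ENNReal.ofReal (θ t x) := by
  rw [massKernel, ProbabilityTheory.Kernel.withDensity_apply _
    (by exact hθ.real_toNNReal.coe_nnreal_ennreal)]
  rfl

lemma integral_massKernel {E : Type*} [NormedAddCommGroup E] [NormedSpace ℝ E]
    (hθ : Measurable (Function.uncurry θ)) {t : ℝ} (h0 : ∀ᵐ x, 0 ≤ θ t x) (g : Plane → E) :
    ∫ x, g x ∂massKernel θ t = ∫ x, θ t x • g x := by
  rw [massKernel, ProbabilityTheory.Kernel.integral_withDensity (by exact hθ.real_toNNReal)]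
  simp only [ProbabilityTheory.Kernel.const_apply]
  refine integral_congr_ae ?_
  filter_upwards [h0] with x hx
  rw [NNReal.smul_def, Real.coe_toNNReal _ hx]

lemma velocity_eq_vel (hθ : Measurable (Function.uncurry θ)) {t : ℝ} (h0 : ∀ᵐ x, 0 ≤ θ t x)
    (x : Plane) : velocity α (θ t) x = vel α (massKernel θ t) x := by
  rw [vel, integral_massKernel hθ h0, velocity]

lemma massKernel_le (hθ : Measurable (Function.uncurry θ)) {t N : ℝ} (hN : ∀ᵐ x, θ t x ≤ N) :
    massKernel θ t ≤ ENNReal.ofReal N • volume := by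
  rw [massKernel_apply hθ, ← withDensity_const]
  refine withDensity_mono ?_
  filter_upwards [hN] with x hx using ENNReal.ofReal_le_ofReal hx

lemma massKernel_univ (hθ : Measurable (Function.uncurry θ)) {t : ℝ} (hi : Integrable (θ t))
    (h0 : ∀ᵐ x, 0 ≤ θ t x) : massKernel θ t univ = ENNReal.ofReal (∫ x, θ t x) := by
  rw [massKernel_apply hθ, withDensity_apply _ MeasurableSet.univ, Measure.restrict_univ,
    ofReal_integral_eq_lintegral_ofReal hi h0]

/-- The propagation of bounds is used twice: the lower bound 0 makes `θ t` the density of a measure,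
and the upper bound keeps that density at most `N`. -/
lemma IsSolution.isWeakFlow (h : IsSolution α F θ) {A D : ℝ} (hF : IsExternalField A D F) {N : ℝ}
    (h0 : ∀ᵐ x, 0 ≤ θ 0 x) (hN : ∀ᵐ x, θ 0 x ≤ N) (T : ℝ) :
    IsWeakFlow α N A T F (massKernel θ) where
  measurable_field := hF.measurable
  norm_field_le t ht := hF.bounded t ht.1
  le_volume t ht := massKernel_le h.measurable (h.upper N hN t ht.1)
  mass_le := by
    obtain ⟨C, hC⟩ := h.mass_bound T
    refine ⟨C, fun t ht => ?_⟩
    rw [massKernel_univ h.measurable (h.integrable t ht.1) (h.lower 0 h0 t ht.1)]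
    exact ENNReal.ofReal_le_ofReal
      ((integral_mono (h.integrable t ht.1) (h.integrable t ht.1).abs
        fun x => le_abs_self _).trans (hC t ht))
  weak_form f hf hfc t ht := by
    have hT : 0 ≤ T := ht.1.trans ht.2
    rw [integral_massKernel h.measurable (h.lower 0 h0 t ht.1),
      integral_massKernel h.measurable (h.lower 0 h0 0 le_rfl)]
    simp only [smul_eq_mul]
    rw [h.weak_form f hf hfc t ht.1]
    refine intervalIntegral.integral_congr fun s hs => ?_
    rw [uIcc_of_le ht.1] at hs
    have hs0 := h.lower 0 h0 s hs.1
    rw [integral_massKernel h.measurable hs0]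
    refine integral_congr_ae (ae_of_all _ fun x => ?_)
    simp only [smul_eq_mul]
    rw [velocity_eq_vel h.measurable hs0]

lemma ae_massKernel_of_fieldSupport (hθ : Measurable (Function.uncurry θ)) {t : ℝ} {S : Set Plane}
    (hS : fieldSupport (θ t) ⊆ S) : ∀ᵐ x ∂massKernel θ t, x ∈ S := by
  have h1 : ∀ᵐ x ∂(volume.restrict (Function.support (θ t))), x ∈ S :=
    Filter.mem_of_superset Measure.support_mem_ae hS
  have hm : MeasurableSet (Function.support (θ t)) :=
    measurableSet_support hθ.of_uncurry_left
  rw [ae_restrict_iff' hm] at h1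
  rw [massKernel_apply hθ, ae_withDensity_iff (hθ.of_uncurry_left).ennreal_ofReal]
  filter_upwards [h1] with x hx hx0
  refine hx fun h => hx0 ?_
  rw [h, ENNReal.ofReal_zero]

/-- For `θ t ≥ 0` the mass measure and Lebesgue measure on `{θ t ≠ 0}` have the same null sets.
Closedness of `S` is needed because the support is a closure; the open disk is recovered later from
a strict inequality of radii. -/
lemma fieldSupport_subset_of_ae (hθ : Measurable (Function.uncurry θ)) {t : ℝ}
    (h0 : ∀ᵐ x, 0 ≤ θ t x) {S : Set Plane} (hS : IsClosed S)
    (h : ∀ᵐ x ∂massKernel θ t, x ∈ S) : fieldSupport (θ t) ⊆ S := by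
  refine Measure.support_subset_of_isClosed hS ?_
  have hm : MeasurableSet (Function.support (θ t)) :=
    measurableSet_support hθ.of_uncurry_left
  change ∀ᵐ x ∂(volume.restrict (Function.support (θ t))), x ∈ S
  rw [ae_restrict_iff' hm]
  rw [massKernel_apply hθ, ae_withDensity_iff (hθ.of_uncurry_left).ennreal_ofReal] at h
  filter_upwards [h, h0] with x hx hx0 hne
  refine hx ?_
  rw [ne_eq, ENNReal.ofReal_eq_zero, not_le]
  exact lt_of_le_of_ne hx0 (Ne.symm hne)

/-- Localization of solutions, under explicit smallness conditions. -/
theorem IsSolution.fieldSupport_subset (h : IsSolution α F θ) (hα : α ∈ Ioo (0 : ℝ) 1) {A D : ℝ}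
    (hF : IsExternalField A D F) (hD : 0 ≤ D) {N : ℝ} (hN : 0 < N) (h0 : ∀ᵐ x, 0 ≤ θ 0 x)
    (h1 : ∫ x, θ 0 x = 1) (hθN : ∀ᵐ x, θ 0 x ≤ N) {z : Plane} {ε : ℝ} (hε : 0 < ε)
    (hz : fieldSupport (θ 0) ⊆ Metric.ball z ε) {B : ℝ → Plane} (hB : IsTrajectory F z B)
    {T R m : ℝ} {n : ℕ} (hR : 2 * ε ≤ R)
    (hIR : Real.exp (D * T) * ε ≤ R) (hm0 : 0 < m)
    (hm : (fluxRate α N ((Real.exp (D * T) * ε) ^ 2) R * T) ^ n ≤ m)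
    (hcore : coreConst α * (Real.exp (D * T) * ε) ^ 2 * R ^ (-(2 + α)) ≤ R ^ 2)
    (hext : |kernelConst α| *
      ((ballRiesz (1 + α) + 1) * (N ^ ((1 + α) / 2) * m ^ (1 - (1 + α) / 2))) ≤ R)
    {t : ℝ} (ht : t ∈ Icc 0 T) :
    fieldSupport (θ t) ⊆ Metric.closedBall (B t)
      (2 ^ (n + 1) * R * Real.exp ((2 * D + 1) * T) + Real.exp (D * T) * ε) := by
  have hT : 0 ≤ T := ht.1.trans ht.2
  have hw := h.isWeakFlow hF h0 hθN T
  have hp0 : IsProbabilityMeasure (massKernel θ 0) := by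
    constructor
    rw [massKernel_univ h.measurable (h.integrable 0 le_rfl) h0, h1, ENNReal.ofReal_one]
  have hz0 : ∀ᵐ x ∂massKernel θ 0, ‖x - z‖ ≤ ε := by
    filter_upwards [ae_massKernel_of_fieldSupport h.measurable hz] with x hx
    rw [← dist_eq_norm]
    exact (Metric.mem_ball.1 hx).le
  have hr₀ : ∀ᵐ x ∂massKernel θ 0, ‖x‖ ≤ ε + ‖z‖ := by
    filter_upwards [hz0] with x hx
    have := norm_add_le (x - z) z
    rw [sub_add_cancel] at this
    linarith
  obtain ⟨ρ, hρ⟩ := hw.exists_support hα hN hp0 hr₀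
  have hc : IsCompactFlow α N A D T ρ F (massKernel θ) :=
    { hw with
      prob := fun t ht => (hρ t ht).1
      support := fun t ht => (hρ t ht).2
      lipschitz := fun t ht => hF.lipschitz t ht.1 }
  have hB0 : B 0 = z := by
    have := hB.eq_integral 0 le_rfl
    simpa using this
  rw [← hB0] at hz0
  have hfin := hc.localization hα hN hD hT (B := B)
    (hB.continuousOn.mono Icc_subset_Ici_self)
    (fun t ht => by rw [hB0]; exact hB.eq_integral t ht.1) hε hz0 hR hIR hm0 hm hcore hext ht
  refine fieldSupport_subset_of_ae h.measurable (h.lower 0 h0 t ht.1) Metric.isClosed_closedBall ?_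
  filter_upwards [hfin] with x hx
  rwa [Metric.mem_closedBall, dist_eq_norm]

end Bridge

/-! ### Choice of the scales -/

lemma eventually_const_mul_rpow_le (C : ℝ) {e : ℝ} (he : 0 < e) :
    ∀ᶠ x : ℝ in nhdsWithin 0 (Ioi 0), C * x ^ e ≤ 1 := by
  have h1 : Filter.Tendsto (fun x : ℝ => C * x ^ e) (nhdsWithin 0 (Ioi 0)) (nhds (C * 0 ^ e)) :=
    (((Real.continuousAt_rpow_const 0 e (Or.inr he.le)).const_mul C).tendsto).mono_left
      nhdsWithin_le_nhds
  rw [Real.zero_rpow he.ne', mul_zero] at h1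
  exact h1.eventually_le_const one_pos

lemma eventually_const_mul_rpow_mul_abs_log_le (C : ℝ) {e : ℝ} (he : 0 < e) :
    ∀ᶠ x : ℝ in nhdsWithin 0 (Ioi 0), C * (x ^ e * |Real.log x|) ≤ 1 := by
  have h1 := ((tendsto_log_mul_rpow_nhdsGT_zero he).abs).const_mul C
  rw [abs_zero, mul_zero] at h1
  filter_upwards [h1.eventually_le_const one_pos, self_mem_nhdsWithin] with x hx hx0
  rwa [abs_mul, abs_of_nonneg (Real.rpow_nonneg (le_of_lt hx0) e), mul_comm |Real.log x|] at hx

lemma exp_mul_abs_log {x : ℝ} (hx : x ∈ Ioo (0 : ℝ) 1) (κ ζ : ℝ) :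
    Real.exp (κ * (ζ * |Real.log x|)) = x ^ (-(κ * ζ)) := by
  rw [Real.rpow_def_of_pos hx.1, abs_of_neg (Real.log_neg hx.1 hx.2)]
  congr 1; ring

lemma fluxRate_rpow {α M x : ℝ} (hM : 0 < M) (hx : 0 < x) (b i : ℝ) :
    fluxRate α (M * x ^ (-2 : ℝ)) ((x ^ i) ^ 2) (x ^ b) =
      2 * stepConst * coreConst α * 2 ^ (2 + α) * x ^ (2 * i - b * (4 + α)) +
      2 * stepConst * (|kernelConst α| * ((ballRiesz α + 1) * (M ^ (α / 2) * 4 ^ (1 - α / 2)))) *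
        x ^ (-2 * b - α + (2 * i - 2 * b) * (1 - α / 2)) := by
  have hb : (x ^ b) ^ 2 = x ^ (2 * b) := by
    rw [← Real.rpow_natCast, ← Real.rpow_mul hx.le]; congr 1; push_cast; ring
  have hi : (x ^ i) ^ 2 = x ^ (2 * i) := by
    rw [← Real.rpow_natCast, ← Real.rpow_mul hx.le]; congr 1; push_cast; ring
  have e1 : (x ^ b / 2) ^ (-(2 + α)) = 2 ^ (2 + α) * x ^ (-(b * (2 + α))) := by
    rw [Real.div_rpow (by positivity) two_pos.le, ← Real.rpow_mul hx.le, Real.rpow_neg two_pos.le,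
      div_inv_eq_mul, mul_comm]
    congr 2; ring
  have e2 : (M * x ^ (-2 : ℝ)) ^ (α / 2) = M ^ (α / 2) * x ^ (-α) := by
    rw [Real.mul_rpow hM.le (by positivity), ← Real.rpow_mul hx.le]
    congr 2; ring
  have e3 : (4 * x ^ (2 * i) / x ^ (2 * b)) ^ (1 - α / 2) =
      4 ^ (1 - α / 2) * x ^ ((2 * i - 2 * b) * (1 - α / 2)) := by
    rw [mul_div_assoc, ← Real.rpow_sub hx, Real.mul_rpow (by norm_num) (by positivity),
      ← Real.rpow_mul hx.le]
  have e4 : ∀ y : ℝ, y / x ^ (2 * b) = y * x ^ (-(2 * b)) := fun y => by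
    rw [Real.rpow_neg hx.le, div_eq_mul_inv]
  have e5 : x ^ (2 * i - b * (4 + α)) = x ^ (-(2 * b)) * (x ^ (2 * i) * x ^ (-(b * (2 + α)))) := by
    rw [← Real.rpow_add hx, ← Real.rpow_add hx]; congr 1; ring
  have e6 : x ^ (-2 * b - α + (2 * i - 2 * b) * (1 - α / 2)) =
      x ^ (-(2 * b)) * (x ^ (-α) * x ^ ((2 * i - 2 * b) * (1 - α / 2))) := by
    rw [← Real.rpow_add hx, ← Real.rpow_add hx]; congr 1; ring
  rw [fluxRate, hb, hi, e1, e2, e3, e4 (2 * stepConst), e5, e6]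
  ring

/-- The scales for which the smallness conditions of the localization theorem hold. -/
lemma exists_scales {α β M D : ℝ} (hα : α ∈ Ioo (0 : ℝ) 1) (hM : 0 < M) (hD : 0 ≤ D)
    (hβ : β ∈ Ioo (0 : ℝ) ((2 - 2 * α) / (4 - α))) :
    ∃ ζ > (0 : ℝ), ∃ n : ℕ, ∃ b δ : ℝ, ∀ᶠ ε : ℝ in nhdsWithin 0 (Ioi 0), ε < 1 ∧
      2 * ε ≤ ε ^ b ∧ Real.exp (D * (ζ * |Real.log ε|)) * ε ≤ ε ^ b ∧
      (fluxRate α (M * ε ^ (-2 : ℝ)) ((Real.exp (D * (ζ * |Real.log ε|)) * ε) ^ 2) (ε ^ b) *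
        (ζ * |Real.log ε|)) ^ n ≤ ε ^ (δ * n) ∧
      coreConst α * (Real.exp (D * (ζ * |Real.log ε|)) * ε) ^ 2 * (ε ^ b) ^ (-(2 + α)) ≤
        (ε ^ b) ^ 2 ∧
      |kernelConst α| * ((ballRiesz (1 + α) + 1) * ((M * ε ^ (-2 : ℝ)) ^ ((1 + α) / 2) *
        (ε ^ (δ * n)) ^ (1 - (1 + α) / 2))) ≤ ε ^ b ∧
      2 ^ (n + 1) * ε ^ b * Real.exp ((2 * D + 1) * (ζ * |Real.log ε|)) +
        Real.exp (D * (ζ * |Real.log ε|)) * ε < ε ^ β := by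
  obtain ⟨hα0, hα1⟩ := hα
  -- The iteration starts at radius `ε^b`, smaller than `ε^β`; the gap `b - β` pays for the dilation
  -- and for `2^(n+1)`.
  obtain ⟨b, hβb, hb⟩ := exists_between hβ.2
  have hb0 : 0 < b := hβ.1.trans hβb
  -- This is the exponent of `ε` in the exterior part of `fluxRate` when the second moment is `ε²`.
  -- The core part has the larger exponent `2 - b(4 + α)`, the difference being `2α(1 - b)`.
  have hG : 0 < 2 - 2 * α - b * (4 - α) := by
    rw [lt_div_iff₀ (by linarith)] at hb; linarith
  have hb1 : b < 1 := by nlinarith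
  set G := 2 - 2 * α - b * (4 - α) with hGd
  have hG1 : G ≤ 2 * (1 - b) := by nlinarith
  -- The first bound keeps the growth of the second moment from spoiling the exponents of the flux,
  -- the second keeps the dilated radius below `ε^β`.
  set ζ := min (G / 4) ((b - β) / 2) / (2 * D + 1) with hζ
  have hζ0 : 0 < ζ := div_pos (lt_min (by linarith) (by linarith)) (by linarith)
  have hζm : (2 * D + 1) * ζ = min (G / 4) ((b - β) / 2) := by
    rw [hζ]; field_simp
  have hζ1 : (2 * D + 1) * ζ ≤ G / 4 := hζm.le.trans (min_le_left _ _)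
  have hζ2 : (2 * D + 1) * ζ ≤ (b - β) / 2 := hζm.le.trans (min_le_right _ _)
  have hDζ0 : 0 ≤ D * ζ := by positivity
  have hDζ : D * ζ ≤ G / 8 := by nlinarith
  -- The flux exponents stay at least `2δ`: one `δ` absorbs the constants and `|log ε|`, the other
  -- is the gain per doubling.
  set δ := G / 4 with hδ
  have hδ0 : 0 < δ := by positivity
  -- Chosen so that `m = ε^(δn)` compensates `N^((1+α)/2)`, of order `ε^(-(1+α))`, and leaves `ε^b`
  -- times one spare power of `ε` for the constants.
  obtain ⟨n, hn⟩ := exists_nat_ge ((1 + (1 + α) + b) / (δ * ((1 - α) / 2)))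
  have hn' : 1 + (1 + α) + b ≤ δ * n * ((1 - α) / 2) := by
    rw [div_le_iff₀ (mul_pos hδ0 (by linarith))] at hn
    linarith
  set i := 1 - D * ζ with hi
  have hie : ∀ ε ∈ Ioo (0 : ℝ) 1, Real.exp (D * (ζ * |Real.log ε|)) * ε = ε ^ i := by
    intro ε hε
    rw [exp_mul_abs_log hε, hi]
    nth_rewrite 2 [← Real.rpow_one ε]
    rw [← Real.rpow_add hε.1]; congr 1; ring
  set C₁ := 2 * stepConst * coreConst α * 2 ^ (2 + α) with hC₁
  set C₂ := 2 * stepConst * (|kernelConst α| * ((ballRiesz α + 1) *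
    (M ^ (α / 2) * 4 ^ (1 - α / 2)))) with hC₂
  have hs := stepConst_nonneg
  have hcc := coreConst_nonneg hα0
  have hbr := ballRiesz_nonneg α
  have hC₁0 : 0 ≤ C₁ := by positivity
  have hC₂0 : 0 ≤ C₂ := by positivity
  have hE1 : 2 * δ ≤ 2 * i - b * (4 + α) := by
    rw [hi, hδ]; nlinarith
  -- The growth of the second moment costs `D ζ (2 - α) ≤ G / 4`, so at least `3G / 4` remains.
  have hE2 : 2 * δ ≤ -2 * b - α + (2 * i - 2 * b) * (1 - α / 2) := by
    have : -2 * b - α + (2 * i - 2 * b) * (1 - α / 2) = G - D * ζ * (2 - α) := by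
      rw [hi, hGd]; ring
    rw [this, hδ]
    nlinarith
  refine ⟨ζ, hζ0, n, b, δ, ?_⟩
  filter_upwards [self_mem_nhdsWithin,
    nhdsWithin_le_nhds (Iio_mem_nhds (show (0 : ℝ) < 1 by norm_num)),
    eventually_const_mul_rpow_le 2 (show 0 < 1 - b by linarith),
    eventually_const_mul_rpow_mul_abs_log_le ((C₁ + C₂) * ζ) hδ0,
    eventually_const_mul_rpow_le (coreConst α) (show 0 < 2 * δ by positivity),
    eventually_const_mul_rpow_le (|kernelConst α| * ((ballRiesz (1 + α) + 1) * M ^ ((1 + α) / 2)))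
      one_pos,
    -- The factors 4 here and in the next condition make each of the two radii at most `ε^β / 4`, so
    -- their sum is strictly below `ε^β`.
    eventually_const_mul_rpow_le (4 * 2 ^ (n + 1)) (show 0 < b - β - (2 * D + 1) * ζ by linarith),
    eventually_const_mul_rpow_le 4 (show 0 < i - β by rw [hi]; linarith)]
    with ε hε0 hε1 h1 h2 h3 h4 h5 h6
  have hε : ε ∈ Ioo (0 : ℝ) 1 := ⟨hε0, hε1⟩
  have hpos : 0 < ε := hε0
  have hmono : ∀ {x y : ℝ}, x ≤ y → ε ^ y ≤ ε ^ x := fun hxy =>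
    Real.rpow_le_rpow_of_exponent_ge hpos (le_of_lt hε1) hxy
  have hb2 : (ε ^ b) ^ 2 = ε ^ (2 * b) := by
    rw [← Real.rpow_natCast, ← Real.rpow_mul hpos.le]; congr 1; push_cast; ring
  have hi2 : (ε ^ i) ^ 2 = ε ^ (2 * i) := by
    rw [← Real.rpow_natCast, ← Real.rpow_mul hpos.le]; congr 1; push_cast; ring
  rw [hie ε hε, exp_mul_abs_log hε]
  refine ⟨hε1, ?_, hmono ?_, ?_, ?_, ?_, ?_⟩
  · calc 2 * ε = 2 * ε ^ (1 - b) * ε ^ b := by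
          rw [mul_assoc, ← Real.rpow_add hpos, sub_add_cancel, Real.rpow_one]
      _ ≤ 1 * ε ^ b := mul_le_mul_of_nonneg_right h1 (by positivity)
      _ = _ := one_mul _
  · rw [hi]; linarith
  · rw [Real.rpow_mul hpos.le, Real.rpow_natCast]
    have hL : 0 ≤ ζ * |Real.log ε| := by positivity
    refine pow_le_pow_left₀ (mul_nonneg (fluxRate_nonneg hα0 (by positivity) (by positivity)
      (by positivity)) hL) ?_ n
    rw [fluxRate_rpow hM hpos]
    calc _ ≤ (C₁ * ε ^ (2 * δ) + C₂ * ε ^ (2 * δ)) * (ζ * |Real.log ε|) := by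
          refine mul_le_mul_of_nonneg_right (add_le_add
            (mul_le_mul_of_nonneg_left (hmono hE1) hC₁0)
            (mul_le_mul_of_nonneg_left (hmono hE2) hC₂0)) hL
      _ = (C₁ + C₂) * ζ * (ε ^ δ * |Real.log ε|) * ε ^ δ := by
          rw [two_mul, Real.rpow_add hpos]; ring
      _ ≤ 1 * ε ^ δ := mul_le_mul_of_nonneg_right h2 (by positivity)
      _ = _ := one_mul _
  · rw [hb2, hi2, ← Real.rpow_mul hpos.le]
    calc coreConst α * ε ^ (2 * i) * ε ^ (b * -(2 + α))
        = coreConst α * ε ^ (2 * i - b * (4 + α)) * ε ^ (2 * b) := by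
          rw [mul_assoc, mul_assoc, ← Real.rpow_add hpos, ← Real.rpow_add hpos]
          congr 2; ring
      _ ≤ coreConst α * ε ^ (2 * δ) * ε ^ (2 * b) := by
          refine mul_le_mul_of_nonneg_right (mul_le_mul_of_nonneg_left (hmono hE1) hcc)
            (by positivity)
      _ ≤ 1 * ε ^ (2 * b) := mul_le_mul_of_nonneg_right h3 (by positivity)
      _ = _ := one_mul _
  · have hbr' := ballRiesz_nonneg (1 + α)
    have e2 : (M * ε ^ (-2 : ℝ)) ^ ((1 + α) / 2) = M ^ ((1 + α) / 2) * ε ^ (-(1 + α)) := by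
      rw [Real.mul_rpow hM.le (by positivity), ← Real.rpow_mul hpos.le]
      congr 2; ring
    rw [e2, ← Real.rpow_mul hpos.le]
    have e3 : ε ^ (-(1 + α)) * ε ^ (δ * n * (1 - (1 + α) / 2)) ≤ ε ^ (1 : ℝ) * ε ^ b := by
      rw [← Real.rpow_add hpos, ← Real.rpow_add hpos]
      refine hmono ?_
      have : δ * n * (1 - (1 + α) / 2) = δ * n * ((1 - α) / 2) := by ring
      rw [this]
      linarith
    calc _ = |kernelConst α| * ((ballRiesz (1 + α) + 1) * M ^ ((1 + α) / 2)) *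
          (ε ^ (-(1 + α)) * ε ^ (δ * n * (1 - (1 + α) / 2))) := by ring
      _ ≤ |kernelConst α| * ((ballRiesz (1 + α) + 1) * M ^ ((1 + α) / 2)) *
          (ε ^ (1 : ℝ) * ε ^ b) := mul_le_mul_of_nonneg_left e3 (by positivity)
      _ = |kernelConst α| * ((ballRiesz (1 + α) + 1) * M ^ ((1 + α) / 2)) * ε ^ (1 : ℝ) *
          ε ^ b := by ring
      _ ≤ 1 * ε ^ b := mul_le_mul_of_nonneg_right h4 (by positivity)
      _ = _ := one_mul _
  · have hβp : 0 < ε ^ β := by positivity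
    have e1 : 2 ^ (n + 1) * ε ^ b * ε ^ (-((2 * D + 1) * ζ)) =
        (4 * 2 ^ (n + 1) * ε ^ (b - β - (2 * D + 1) * ζ)) * ε ^ β / 4 := by
      rw [mul_assoc, ← Real.rpow_add hpos, mul_assoc _ _ (ε ^ β), ← Real.rpow_add hpos,
        show b - β - (2 * D + 1) * ζ + β = b + -((2 * D + 1) * ζ) by ring]
      ring
    have e2 : ε ^ i = 4 * ε ^ (i - β) * ε ^ β / 4 := by
      rw [mul_assoc, ← Real.rpow_add hpos, sub_add_cancel]
      ring
    rw [e1, e2]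
    linarith [mul_le_mul_of_nonneg_right h5 hβp.le, mul_le_mul_of_nonneg_right h6 hβp.le]

end MSQG

end

/-! ### The lower bound for the localization time -/

theorem theorem2 (α : ℝ) (hα : α ∈ Set.Ioo (0 : ℝ) 1) (M A D : ℝ) (hM : 0 < M)
    (β : ℝ) (hβ : β ∈ Set.Ioo (0 : ℝ) ((2 - 2 * α) / (4 - α))) :
    ∃ ε₁ ∈ Set.Ioo (0 : ℝ) 1, ∃ ζ₁ > (0 : ℝ), ∀ ε ∈ Set.Ioo (0 : ℝ) ε₁,
      ∀ (F : ℝ → Plane → Plane) (θ : ℝ → Plane → ℝ) (z : Plane) (B : ℝ → Plane),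
        MSQG.IsExternalField A D F →
        MSQG.IsSolution α F θ →
        (∀ᵐ x, 0 ≤ θ 0 x) →
        (∫ x, θ 0 x = 1) →
        (∀ᵐ x, θ 0 x ≤ M * ε ^ (-2 : ℝ)) →
        MSQG.fieldSupport (θ 0) ⊆ Metric.ball z ε →
        MSQG.IsTrajectory F z B →
        ((ζ₁ * |Real.log ε| : ℝ) : EReal) < MSQG.localizationTime θ B (ε ^ β) := by
  -- No field exists when `D < 0`: the Lipschitz inequality fails for two points at distance 1.
  rcases lt_or_ge D 0 with hD | hD
  · refine ⟨1 / 2, by norm_num, 1, one_pos, fun ε _ F θ z B hF => ?_⟩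
    exfalso
    have h1 := hF.lipschitz 0 le_rfl (EuclideanSpace.single 0 1) 0
    have h2 : ‖(EuclideanSpace.single 0 1 : Plane) - 0‖ = 1 := by simp
    rw [h2, mul_one] at h1
    linarith [norm_nonneg (F 0 (EuclideanSpace.single 0 1) - F 0 0)]
  obtain ⟨ζ, hζ, n, b, δ, hev⟩ := MSQG.exists_scales hα hM hD hβ
  obtain ⟨ε₀, hε₀, hall⟩ := mem_nhdsGT_iff_exists_Ioo_subset.1 hev
  -- Localization holds up to and including the time `ζ |log ε|`; halving `ζ` makes the inequality
  -- strict.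
  refine ⟨min ε₀ (1 / 2), ⟨lt_min hε₀ (by norm_num), (min_le_right _ _).trans_lt (by norm_num)⟩,
    ζ / 2, by positivity, fun ε hε F θ z B hF hθ h0 h1 hN hz hB => ?_⟩
  obtain ⟨hε1, c1, c2, c3, c4, c5, c6⟩ := hall ⟨hε.1, hε.2.trans_le (min_le_left _ _)⟩
  have hε0 : 0 < ε := hε.1
  have hlog : 0 < |Real.log ε| := abs_pos.2 (Real.log_neg hε0 hε1).ne
  have hT : 0 < ζ * |Real.log ε| := by positivity
  refine lt_of_lt_of_le (EReal.coe_lt_coe_iff.2 (?_ : _ < ζ * |Real.log ε|)) (le_sSup ?_)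
  · nlinarith
  · refine ⟨ζ * |Real.log ε|, ⟨hT, fun s hs => ?_⟩, rfl⟩
    exact (hθ.fieldSupport_subset hα hF hD (by positivity) h0 h1 hN hε0 hz hB c1 c2 (by positivity)
      c3 c4 c5 hs).trans (Metric.closedBall_subset_ball c6)
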